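/- **Conventions.** All points lie in the real projective plane $\mathbf{RP}^2$, and $(ab)(cd)$ denotes the intersection of the line through $a,b$ with the line through $c,d$. The pentagram map $T$ sends a bi-infinite path $P=(P_i)_{i\in\mathbf Z}$ to the path with vertices $T(P)_i=(P_{i-1}P_{i+1})(P_iP_{i+2})$. Two labeled paths agree *as unlabeled paths* if one arises from the other by shifting, or reversing and shifting, the labels. A path is *locally convex* if any four consecutive vertices are, in order, the vertices of a strictly convex quadrilateral and these quadrilaterals determine the same edges; it is *embedded* if these edges meet only in the common vertices of consecutive edges. **Seeds.** Let $n\ge 4$ and $1\le k\le n-1$. A *seed* of type $(n,k)$ is a strictly convex $n$-gon with consecutive vertices $A_1,\dots,A_n$ (indices mod $n$) in $\mathbf{RP}^2$, together with a point $B_j$ in the interior of the edge $A_jA_{j+1}$ for each $j=n-k+1,\dots,n$. The *seed map* sends $(A,B)$ to $(A^*,B^*)$, where $A_i^*=A_{i+1}$ for $1\le i\le n-k$, $A_i^*=B_i$ for $n-k+1\le i\le n$, $B_n^*=(A_1A_2^*)(A_n^*A_1^*)$, and $B_j^*=(A_{j+1}B_{j+1}^*)(A_j^*A_{j+1}^*)$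 for $j=n-1,\dots,n-k+1$. A seed $s$ *generates* the labeled path $P$ if there are seeds $(s_m)_{m\in\mathbf Z}$ such that $s_0=s$, $s_{m+1}$ is the image of $s_m$ under the seed map, and $P_{m+1}$ is the first vertex $A_1$ of $s_m$, for all $m\in\mathbf Z$. **Spirals.** A *labeled PLC (properly locally convex) pentagram spiral of type $(n,k)$* is a path $P=(P_i)_{i\in\mathbf Z}$ such that 1. $k$ is the smallest positive integer for which $T^k(P)=P$ as unlabeled paths; 2. the paths $P,T(P),\dots,T^{k-1}(P)$ are locally convex, embedded and pairwise disjoint; 3. $T^{2k}(P_j)=P_{j+2n+k}$ for all $j$, where $T^2$ is labeled canonically, that is, $T^2(P_j)$ is the vertex of $T^2(P)$ which depends on $P_{j-3},\dots,P_{j+3}$ (so the labels increase inwards); 4. $P$ is generated by a seed of type $(n,k)$. Let ${\cal C}(n,k)$ be the set of these spirals modulo projective transformations. A family of spirals (or of seeds) is smooth if all vertices (and marked points) depend smoothly on the parameters, and the spaces of projective classes of spirals and of seeds carry the quotient smooth (diffeological) structures. Let $T_{n,k}:{\cal C}(n,k)\to{\cal C}(n,k)$ be the shift map, induced by $(P_i)\mapsto(P_{i+1})$.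 **Theorem.** Let $n\ge4$ and $1\le k\le n-1$. The space ${\cal C}(n,k)$ is diffeomorphic to an open ball of dimension $(2n-8)+k$. Every seed of type $(n,k)$ generates exactly one labeled PLC pentagram spiral of type $(n,k)$, and every such spiral is generated by exactly one seed. This correspondence induces a diffeomorphism $\Psi$ from ${\cal C}(n,k)$ to the space of projective classes of seeds of type $(n,k)$. The seed map carries seeds to seeds and induces a diffeomorphism $\tau$ of the space of projective classes of seeds, and $\Psi\circ T_{n,k}=\tau\circ\Psi$. -/

import Mathlib

open scoped ContDiff Topology

noncomputable section

namespace PentagramSpiral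

/-! ### The real projective plane -/

/-- Homogeneous coordinate vectors. -/
abbrev Vec : Type := Fin 3 → ℝ

/-- The real projective plane: lines through the origin of `ℝ³`. -/
abbrev RP2 : Type := Projectivization ℝ Vec

/-- The group of projective transformations of the real projective plane. -/
abbrev PGL3 : Type := Matrix.ProjGenLinGroup (Fin 3) ℝ

/-- The nonzero vector `v` is a vector of homogeneous coordinates for the point `x`. -/
def Represents (v : Vec) (x : RP2) : Prop :=
  ∃ h : v ≠ 0, Projectivization.mk ℝ v h = x

/-- The determinant of three vectors. -/
def det3 (a b c : Vec) : ℝ := Matrix.det (Matrix.of ![a, b, c])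

/-- The point `(ab)(cd)`, that is, the intersection of the line through `a`, `b` with the line
through `c`, `d`. (A line is encoded by its normal vector, so that both the line through two
distinct points and the intersection point of two distinct lines are cross products.) -/
def meet (a b c d : RP2) : RP2 :=
  Projectivization.cross (Projectivization.cross a b) (Projectivization.cross c d)

/-! ### Smooth structures

Smoothness on the spaces below is expressed by diffeologies. Smooth manifolds form a full
subcategory of diffeological spaces, so a space which is diffeomorphic as a diffeological space
to an open ball of `ℝᴺ` is a smooth manifold diffeomorphic to this ball. -/

/-- A map into the projective plane is smooth if locally it is given by homogeneous
coordinates which depend smoothly on the parameters. -/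
instance : DiffeologicalSpace RP2 :=
  .ofCorePlotsOn {
    isPlotOn := fun {m u} _ p => ∀ x ∈ u, ∃ g : EuclideanSpace ℝ (Fin m) → Vec,
      ContDiffAt ℝ ∞ g x ∧ ∀ᶠ y in 𝓝 x, Represents (g y) (p y)
    isPlotOn_congr := by
      have key : ∀ {m : ℕ} {u : Set (EuclideanSpace ℝ (Fin m))} (_ : IsOpen u)
          {p q : EuclideanSpace ℝ (Fin m) → RP2}, Set.EqOn p q u →
          (∀ x ∈ u, ∃ g : EuclideanSpace ℝ (Fin m) → Vec,
            ContDiffAt ℝ ∞ g x ∧ ∀ᶠ y in 𝓝 x, Represents (g y) (p y)) →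
          ∀ x ∈ u, ∃ g : EuclideanSpace ℝ (Fin m) → Vec,
            ContDiffAt ℝ ∞ g x ∧ ∀ᶠ y in 𝓝 x, Represents (g y) (q y) := by
        intro m u hu p q h hp x hx
        obtain ⟨g, hg, hgp⟩ := hp x hx
        refine ⟨g, hg, ?_⟩
        filter_upwards [hgp, hu.mem_nhds hx] with y hy hyu
        rwa [← h hyu]
      intro m u hu p q h
      exact ⟨key hu h, key hu h.symm⟩
    isPlot_const := by
      intro m x y _
      exact ⟨fun _ => x.rep, contDiffAt_const,
        Filter.Eventually.of_forall fun _ => ⟨x.rep_nonzero, x.mk_rep⟩⟩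
    isPlotOn_reparam := by
      intro m l u v hu hv p f h hp hf x hx
      obtain ⟨g, hg, hgp⟩ := hp (f x) (h hx)
      have hfx : ContDiffAt ℝ ∞ f x := (hf x hx).contDiffAt (hv.mem_nhds hx)
      exact ⟨g ∘ f, hg.comp x hfx, hfx.continuousAt.eventually hgp⟩
    locality := by
      intro m u hu p hp x hx
      obtain ⟨v, hv, hxv, hpv⟩ := hp x hx
      exact hpv x hxv }

/-- The diffeology on `X` induced by a family of maps `f i : X → Y`: a map into `X` is smooth
if and only if all its compositions with the maps `f i` are smooth. Applied to a family of
coordinate functions, this is the subspace diffeology of the product diffeology. -/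
@[reducible]
def inducedBy {ι X Y : Type*} [DiffeologicalSpace Y] (f : ι → X → Y) : DiffeologicalSpace X where
  plots _ := {p | ∀ i, Diffeology.IsPlot (f i ∘ p)}
  constant_plots x i := Diffeology.isPlot_const (x := f i x)
  plot_reparam hp hg i := Diffeology.isPlot_reparam (hp i) hg
  locality {m p} hp i := by
    refine DiffeologicalSpace.locality (p := f i ∘ p) fun x => ?_
    obtain ⟨u, hu, hxu, h⟩ := hp x
    exact ⟨u, hu, hxu, fun hg hg' => h hg hg' i⟩

/-- The quotient diffeology: the finest diffeology for which the projection is smooth. -/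
instance {X : Type*} [DiffeologicalSpace X] (r : Setoid X) : DiffeologicalSpace (Quotient r) :=
  .generateFrom {q | ∃ p : EuclideanSpace ℝ (Fin q.1) → X,
    Diffeology.IsPlot p ∧ q.2 = fun y => Quotient.mk r (p y)}

/-- Subsets of `ℝᴺ`, such as open balls, carry the subspace diffeology: a map into the subset
is smooth if and only if it is smooth as a map into `ℝᴺ`. -/
instance {N : ℕ} (S : Set (EuclideanSpace ℝ (Fin N))) : DiffeologicalSpace S :=
  inducedBy fun (_ : Unit) (x : S) => (x : EuclideanSpace ℝ (Fin N))

/-- A bijection which is smooth in both directions. -/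
def IsDiffeomorphism {X Y : Type*} [DiffeologicalSpace X] [DiffeologicalSpace Y]
    (e : X ≃ Y) : Prop :=
  Diffeology.DSmooth e ∧ Diffeology.DSmooth e.symm

/-! ### Polygonal paths and the pentagram map -/

/-- The labeled pentagram map on bi-infinite paths, with `T(P)₁ = (P₀P₂)(P₁P₃)`. -/
def pentagram (P : ℤ → RP2) : ℤ → RP2 := fun i => meet (P (i - 1)) (P (i + 1)) (P i) (P (i + 2))

/-- `P` and `Q` agree as unlabeled paths. -/
def SamePath (P Q : ℤ → RP2) : Prop :=
  ∃ c : ℤ, (∀ i, Q i = P (i + c)) ∨ ∀ i, Q i = P (c - i)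

/-- `v` lists homogeneous coordinates of the vertices of `P`, with signs such that any four
consecutive vertices `P_i, P_{i+1}, P_{i+2}, P_{i+3}` are, in this order, the vertices of a
strictly convex quadrilateral whose sides `P_iP_{i+1}` consist of the nonnegative combinations of
`v i` and `v (i + 1)`. (If such coordinates exist, they are unique up to positive factors.) -/
def IsConvexLift (v : ℤ → Vec) (P : ℤ → RP2) : Prop :=
  (∀ i, Represents (v i) (P i)) ∧
  ∀ i, 0 < det3 (v i) (v (i + 1)) (v (i + 2)) ∧ 0 < det3 (v i) (v (i + 1)) (v (i + 3)) ∧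
    0 < det3 (v i) (v (i + 2)) (v (i + 3))

/-- Local convexity of a bi-infinite path: any four consecutive vertices are the vertices of a
strictly convex quadrilateral, consistently along the path. -/
def IsLocallyConvex (P : ℤ → RP2) : Prop := ∃ v, IsConvexLift v P

/-- The edge from `P_i` (included) to `P_{i+1}` (excluded) of a locally convex path. -/
def halfOpenEdge (P : ℤ → RP2) (i : ℤ) : Set RP2 :=
  {x | ∃ v, IsConvexLift v P ∧ ∃ s t : ℝ, 0 < s ∧ 0 ≤ t ∧ Represents (s • v i + t • v (i + 1)) x}

/-- The set of all points on a locally convex path. -/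
def trace (P : ℤ → RP2) : Set RP2 := ⋃ i, halfOpenEdge P i

/-- A locally convex path is embedded if it has no self-intersections. -/
def IsEmbedded (P : ℤ → RP2) : Prop :=
  Pairwise fun i j => Disjoint (halfOpenEdge P i) (halfOpenEdge P j)

/-- `P` is a weak pentagram spiral of order `k`: `k` is the smallest positive integer such that
the `k`-th iterate of the pentagram map carries `P` to itself as an unlabeled path. -/
def IsWeakSpiral (k : ℕ) (P : ℤ → RP2) : Prop :=
  0 < k ∧ SamePath P (pentagram^[k] P) ∧ ∀ j, 0 < j → j < k → ¬ SamePath P (pentagram^[j] P)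

/-- The first `k` iterates of `P` are locally convex, embedded, and pairwise disjoint. -/
def IsProperlyLocallyConvex (k : ℕ) (P : ℤ → RP2) : Prop :=
  (∀ j, j < k → IsLocallyConvex (pentagram^[j] P) ∧ IsEmbedded (pentagram^[j] P)) ∧
  ∀ i j, i < j → j < k → Disjoint (trace (pentagram^[i] P)) (trace (pentagram^[j] P))

/-- The labeled path `P` has type `(n, k)`: with `μ = n + k / 2`, the `2k`-th iterate of the
pentagram map carries `P_j` to `P_{j + 2μ}`. Here the square of the pentagram map is labeled in the
canonical, reversal-invariant way: it carries the vertex `P_j` to `pentagram (pentagram P) (j - 1)`,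
a point which depends on `P_{j-3}, …, P_{j+3}`. Since `n > 0`, this also fixes the direction of the
labeling: the labels increase as the path moves inwards. -/
def HasType (n k : ℕ) (P : ℤ → RP2) : Prop :=
  ∀ j : ℤ, pentagram^[2 * k] P (j - k) = P (j + (2 * n + k))

/-! ### Seeds and the seed map -/

/-- An `n`-gon with `k` additional points. The vertices are `A_1, …, A_n`, with indices
taken mod `n`, so that `A_i` is `s.1 i` and `A_n` is `s.1 0`. The additional points are
`B_{n-k+1}, …, B_n`, listed backwards: `s.2 j` is `B_{n-j}` for `j = 0, …, k - 1`. -/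
abbrev MarkedPolygon (n k : ℕ) : Type := (ZMod n → RP2) × (Fin k → RP2)

/-- A seed of type `(n, k)`: the points `A_1, …, A_n` are the consecutive vertices of a strictly
convex polygon of the projective plane, and `B_j` lies in the interior of the edge `A_jA_{j+1}` for
`j = n-k+1, …, n`.

Strict convexity is expressed by homogeneous coordinates with positive determinants. If the polygon
lies in an affine chart, where it is strictly convex, then, after a reflection of the chart, the
vectors `(x, y, 1)` have this property. Conversely, if all these determinants are positive,
a functional `det3 a₁ a₂ · + ε g` with small `ε > 0` and `g` positive on `a₁, a₂` is positive
on all `a_i`, hence the `A_i` are in strictly convex position in the affine chart in which this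
functional does not vanish, and the edge `A_jA_{j+1}` consists of the nonnegative
combinations of `a_j` and `a_{j+1}`. -/
def IsSeed {n k : ℕ} (s : MarkedPolygon n k) : Prop :=
  ∃ a : ZMod n → Vec, (∀ i, Represents (a i) (s.1 i)) ∧
    (∀ i j l : ℕ, 1 ≤ i → i < j → j < l → l ≤ n → 0 < det3 (a i) (a j) (a l)) ∧
    ∀ j : Fin k, ∃ x y : ℝ, 0 < x ∧ 0 < y ∧
      Represents (x • a (-(j : ℕ)) + y • a (1 - (j : ℕ))) (s.2 j)

/-- The vertices of the new polygon: `A*_i = A_{i+1}` for `i = 1, …, n-k`, and `A*_i = B_i` for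
`i = n-k+1, …, n`. (For `i = 1, …, n`, the residue `(-i).val` is `n - i`.) -/
def newVertex {n k : ℕ} (s : MarkedPolygon n k) (i : ZMod n) : RP2 :=
  if h : (-i).val < k then s.2 ⟨(-i).val, h⟩ else s.1 (i + 1)

/-- The new marked points: `newMark s j` is `B*_{n-j}`, where `B*_n = (A_1A*_2)(A*_nA*_1)` and
`B*_i = (A_{i+1}B*_{i+1})(A*_iA*_{i+1})` for `i = n-1, …, n-k+1`. -/
def newMark {n k : ℕ} (s : MarkedPolygon n k) : ℕ → RP2
  | 0 => meet (s.1 1) (newVertex s 2) (newVertex s 0) (newVertex s 1)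
  | j + 1 => meet (s.1 (-(j : ℕ))) (newMark s j)
      (newVertex s (-((j + 1 : ℕ) : ZMod n))) (newVertex s (-(j : ℕ)))

/-- The seed map. -/
def seedMap {n k : ℕ} (s : MarkedPolygon n k) : MarkedPolygon n k :=
  (newVertex s, fun j => newMark s j)

/-- The seed `s` generates the labeled path `P`: there is a bi-infinite orbit of seeds of the
seed map, starting with `s` at time `0`, and `P` is the path through the first vertices of the
seeds of this orbit, labeled such that `P_1` is the first vertex `A_1` of `s`. -/
def Generates {n k : ℕ} (s : MarkedPolygon n k) (P : ℤ → RP2) : Prop :=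
  ∃ S : ℤ → MarkedPolygon n k, S 0 = s ∧ (∀ m, IsSeed (S m)) ∧
    (∀ m, S (m + 1) = seedMap (S m)) ∧ ∀ m, P (m + 1) = (S m).1 1

/-! ### Labeled PLC pentagram spirals -/

/-- `P` is a labeled properly locally convex pentagram spiral of type `(n, k)`. -/
structure IsPLCSpiral (n k : ℕ) (P : ℤ → RP2) : Prop where
  weakSpiral : IsWeakSpiral k P
  properlyLocallyConvex : IsProperlyLocallyConvex k P
  hasType : HasType n k P
  comesFromSeed : ∃ s : MarkedPolygon n k, Generates s P

/-- The shift: the `i`-th vertex of the new labeled path is the `(i+1)`-st vertex of the old. -/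
def shift (P : ℤ → RP2) : ℤ → RP2 := fun i => P (i + 1)

lemma pentagram_shift (P : ℤ → RP2) : pentagram (shift P) = shift (pentagram P) := by
  funext i
  simp only [pentagram, shift]
  congr 2 <;> ring_nf

lemma iterate_pentagram_shift (j : ℕ) (P : ℤ → RP2) :
    pentagram^[j] (shift P) = shift (pentagram^[j] P) :=
  (Function.Commute.iterate_left (f := pentagram) (g := shift) pentagram_shift j) P

lemma samePath_shift {P Q : ℤ → RP2} : SamePath (shift P) (shift Q) ↔ SamePath P Q := by
  constructor
  · rintro ⟨c, h | h⟩
    · refine ⟨c, Or.inl fun i => ?_⟩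
      have := h (i - 1)
      simp only [shift] at this
      rw [show i - 1 + 1 = i by ring, show i - 1 + c + 1 = i + c by ring] at this
      exact this
    · refine ⟨c + 2, Or.inr fun i => ?_⟩
      have := h (i - 1)
      simp only [shift] at this
      rw [show i - 1 + 1 = i by ring, show c - (i - 1) + 1 = c + 2 - i by ring] at this
      exact this
  · rintro ⟨c, h | h⟩
    · refine ⟨c, Or.inl fun i => ?_⟩
      simp only [shift]
      rw [h, show i + 1 + c = i + c + 1 by ring]
    · refine ⟨c - 2, Or.inr fun i => ?_⟩
      simp only [shift]
      rw [h, show c - (i + 1) = c - 2 - i + 1 by ring]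

lemma isConvexLift_shift {v : ℤ → Vec} {P : ℤ → RP2} (h : IsConvexLift v P) :
    IsConvexLift (fun i => v (i + 1)) (shift P) := by
  refine ⟨fun i => h.1 (i + 1), fun i => ?_⟩
  have := h.2 (i + 1)
  rw [show i + 1 + 2 = i + 2 + 1 by ring, show i + 1 + 3 = i + 3 + 1 by ring] at this
  exact this

lemma isConvexLift_unshift {v : ℤ → Vec} {P : ℤ → RP2} (h : IsConvexLift v (shift P)) :
    IsConvexLift (fun i => v (i - 1)) P := by
  refine ⟨fun i => ?_, fun i => ?_⟩
  · have := h.1 (i - 1)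
    simp only [shift] at this
    rwa [show i - 1 + 1 = i by ring] at this
  · have := h.2 (i - 1)
    simp only [show i - 1 + 1 = i + 1 - 1 by ring, show i - 1 + 2 = i + 2 - 1 by ring,
      show i - 1 + 3 = i + 3 - 1 by ring] at this
    exact this

lemma halfOpenEdge_shift (P : ℤ → RP2) (i : ℤ) :
    halfOpenEdge (shift P) i = halfOpenEdge P (i + 1) := by
  ext x
  constructor
  · rintro ⟨v, hv, s, t, hs, ht, hx⟩
    refine ⟨_, isConvexLift_unshift hv, s, t, hs, ht, ?_⟩
    simpa using hx
  · rintro ⟨v, hv, s, t, hs, ht, hx⟩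
    exact ⟨_, isConvexLift_shift hv, s, t, hs, ht, hx⟩

lemma trace_shift (P : ℤ → RP2) : trace (shift P) = trace P := by
  simp only [trace, halfOpenEdge_shift]
  exact (Equiv.addRight (1 : ℤ)).surjective.iUnion_comp (halfOpenEdge P)

/-- Shifting the labels preserves PLC pentagram spirals and their type. -/
lemma IsPLCSpiral.shift {n k : ℕ} {P : ℤ → RP2} (h : IsPLCSpiral n k P) :
    IsPLCSpiral n k (shift P) where
  weakSpiral := by
    refine ⟨h.weakSpiral.1, ?_, fun j hj hjk => ?_⟩
    · rw [iterate_pentagram_shift, samePath_shift]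
      exact h.weakSpiral.2.1
    · rw [iterate_pentagram_shift, samePath_shift]
      exact h.weakSpiral.2.2 j hj hjk
  properlyLocallyConvex := by
    refine ⟨fun j hj => ?_, fun i j hij hj => ?_⟩
    · rw [iterate_pentagram_shift]
      obtain ⟨⟨v, hv⟩, he⟩ := h.properlyLocallyConvex.1 j hj
      refine ⟨⟨_, isConvexLift_shift hv⟩, fun a b hab => ?_⟩
      change Disjoint _ _
      rw [halfOpenEdge_shift, halfOpenEdge_shift]
      exact he (by simpa using hab)
    · rw [iterate_pentagram_shift, iterate_pentagram_shift, trace_shift, trace_shift]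
      exact h.properlyLocallyConvex.2 i j hij hj
  hasType := by
    intro j
    rw [iterate_pentagram_shift]
    simp only [PentagramSpiral.shift]
    rw [show j - (k : ℤ) + 1 = (j + 1) - k by ring, h.hasType (j + 1)]
    congr 1
    ring
  comesFromSeed := by
    obtain ⟨s, S, -, hS, hmap, hP⟩ := h.comesFromSeed
    exact ⟨S 1, fun m => S (m + 1), by simp, fun m => hS _, fun m => hmap _, fun m => hP _⟩

/-- The labeled PLC pentagram spirals of type `(n, k)`. -/
abbrev Spiral (n k : ℕ) : Type := {P : ℤ → RP2 // IsPLCSpiral n k P}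

/-- A family of spirals is smooth if all vertices depend smoothly on the parameters. -/
instance (n k : ℕ) : DiffeologicalSpace (Spiral n k) :=
  inducedBy fun (i : ℤ) (P : Spiral n k) => P.1 i

/-- Projective equivalence of labeled spirals. -/
def spiralSetoid (n k : ℕ) : Setoid (Spiral n k) :=
  (MulAction.orbitRel PGL3 (ℤ → RP2)).comap Subtype.val

/-- The space `C(n, k)` of projective equivalence classes of labeled PLC pentagram spirals of type
`(n, k)`. -/
abbrev SpiralSpace (n k : ℕ) : Type := Quotient (spiralSetoid n k)

/-- The projective equivalence class of a labeled spiral. -/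
def spiralClass {n k : ℕ} (P : Spiral n k) : SpiralSpace n k := Quotient.mk _ P

/-- The shift map `T_{n,k}` on the space of projective equivalence classes of spirals. -/
def shiftMap (n k : ℕ) : SpiralSpace n k → SpiralSpace n k :=
  Quotient.map (fun P => ⟨shift P.1, P.2.shift⟩) (by
    rintro P Q ⟨g, hg⟩
    refine ⟨g, ?_⟩
    funext i
    exact congrFun hg (i + 1))

/-- The seeds of type `(n, k)`. -/
abbrev Seed (n k : ℕ) : Type := {s : MarkedPolygon n k // IsSeed s}

/-- A family of seeds is smooth if all vertices and all marked points depend smoothly on the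
parameters. -/
instance (n k : ℕ) : DiffeologicalSpace (Seed n k) :=
  inducedBy fun (i : ZMod n ⊕ Fin k) (s : Seed n k) => Sum.elim s.1.1 s.1.2 i

/-- Projective equivalence of seeds. -/
def seedSetoid (n k : ℕ) : Setoid (Seed n k) :=
  (MulAction.orbitRel PGL3 (MarkedPolygon n k)).comap Subtype.val

/-- The space of projective equivalence classes of seeds of type `(n, k)`. -/
abbrev SeedSpace (n k : ℕ) : Type := Quotient (seedSetoid n k)

/-- The projective equivalence class of a seed. -/
def seedClass {n k : ℕ} (s : Seed n k) : SeedSpace n k := Quotient.mk _ s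

end PentagramSpiral

end

/-!
The proof lifts everything to homogeneous coordinates in `ℝ³`. A strictly convex polygon becomes
a sequence of vectors `a i` all of whose cyclically ordered determinants are positive, and such
a lift is unique up to positive factors. One step of the seed map replaces `a i` by
`b i = x i • a i + y i • a (i + 1)`, with `y i > 0`, and with `x i > 0` if the edge carries a marked
point and `x i = 0` otherwise. Such a step preserves convexity (`PolyConvex.of_edges`), and the
marked points of the successor are determined by the requirement that, for two consecutive steps
`a → b → c`, the points `a (i + 1)`, `c i`, `c (i + 1)` are collinear.

*The seed map is bijective.* The marked points of the successor exist because the coefficients in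
their recursive construction are positive (`IsStep.exists_next`). Conversely, the old vertices are
recovered one after the other, by moving a vertex outwards along an edge until it meets the line
through two points of the next polygon; convexity survives because the vertex does not reach the
line through the next two vertices (`PolyConvex.update`, `IsStep.exists_prev`). Both constructions
consist of intersections of transversal lines, so the seed map is a diffeomorphism.

*Orbits are spirals.* Let `S m` be an orbit of seeds. By the collinearities above, the path through
the vertices with a marked index `i` is the image of the path through the vertices with the index
`i + 1` under the pentagram map (`IsStep.pentagram_meet`), whereas vertices with an unmarked index
are only relabeled. Thus `T^j(P)`, for `j ≤ k`, runs through the vertices with the index `1 - j` of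
all polygons, and `T^k(P)` is `P` up to a shift by `n + k`, which gives the periodicity and the
type. Local convexity holds because products of nonnegative bidiagonal matrices have nonnegative
minors (`IsOrbitLift.det3_pos`). The polygons are nested, and every half-open edge of one
of the paths lies on the boundary of a polygon `S m` and outside `S (m + 1)`, so the paths are
embedded and disjoint (`IsOrbitLift.edge_ne`), and `k` is minimal. Since the vertices of all
polygons of the orbit can be read off from `P` and its images under `T`, the correspondence between
seeds and spirals is bijective and smooth in both directions, and it commutes with projective
transformations.

*Seeds form a ball.* If the first two vertices are sent to the points at infinity of the coordinate
axes, the remaining vertices become a descending convex chain. The ratios of the widths of its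
edges, the relative changes of the slope, and the positions of the marked points on their edges are
`(n - 4) + (n - 4) + k` positive projective invariants, which can be prescribed arbitrarily
(`coord_normalSeed`) and determine the seed up to projective transformations
(`IsSeed.exists_smul_eq_normalSeed`). Their logarithms identify the space of projective classes of
seeds with a Euclidean space, which is diffeomorphic to the open unit ball.
-/

noncomputable section

namespace PentagramSpiral

open Diffeology

/-! ### Determinants of vectors in `ℝ³` -/

lemma det3_eq (a b c : Vec) : det3 a b c =
    a 0 * (b 1 * c 2 - b 2 * c 1) - a 1 * (b 0 * c 2 - b 2 * c 0)
      + a 2 * (b 0 * c 1 - b 1 * c 0) := by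
  simp [det3, Matrix.det_fin_three]
  ring

lemma det3_rotate (a b c : Vec) : det3 b c a = det3 a b c := by
  simp only [det3_eq]; ring

lemma det3_swap_left (a b c : Vec) : det3 b a c = -det3 a b c := by
  simp only [det3_eq]; ring

lemma det3_swap_right (a b c : Vec) : det3 a c b = -det3 a b c := by
  simp only [det3_eq]; ring

@[simp] lemma det3_self_left (a b : Vec) : det3 a a b = 0 := by
  simp only [det3_eq]; ring

@[simp] lemma det3_self_right (a b : Vec) : det3 a b b = 0 := by
  simp only [det3_eq]; ring

@[simp] lemma det3_self_outer (a b : Vec) : det3 a b a = 0 := by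
  simp only [det3_eq]; ring

lemma det3_comb_left (x y : ℝ) (a b c d : Vec) :
    det3 (x • a + y • b) c d = x * det3 a c d + y * det3 b c d := by
  simp only [det3_eq, Pi.add_apply, Pi.smul_apply, smul_eq_mul]; ring

lemma det3_comb_mid (x y : ℝ) (a b c d : Vec) :
    det3 c (x • a + y • b) d = x * det3 c a d + y * det3 c b d := by
  simp only [det3_eq, Pi.add_apply, Pi.smul_apply, smul_eq_mul]; ring

lemma det3_comb_right (x y : ℝ) (a b c d : Vec) :
    det3 c d (x • a + y • b) = x * det3 c d a + y * det3 c d b := by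
  simp only [det3_eq, Pi.add_apply, Pi.smul_apply, smul_eq_mul]; ring

lemma det3_smul_left (x : ℝ) (a b c : Vec) : det3 (x • a) b c = x * det3 a b c := by
  simp only [det3_eq, Pi.smul_apply, smul_eq_mul]; ring

lemma det3_smul_mid (x : ℝ) (a b c : Vec) : det3 a (x • b) c = x * det3 a b c := by
  simp only [det3_eq, Pi.smul_apply, smul_eq_mul]; ring

lemma det3_smul_right (x : ℝ) (a b c : Vec) : det3 a b (x • c) = x * det3 a b c := by
  simp only [det3_eq, Pi.smul_apply, smul_eq_mul]; ring

lemma det3_zero_left (a b : Vec) : det3 0 a b = 0 := by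
  simp [det3_eq]

/-- Cramer's rule. -/
lemma det3_cramer (u v w c : Vec) :
    det3 u v w • c = det3 c v w • u + det3 u c w • v + det3 u v c • w := by
  ext i
  fin_cases i <;>
    simp only [det3_eq, Pi.add_apply, Pi.smul_apply, smul_eq_mul, Fin.zero_eta, Fin.mk_one,
      Fin.reduceFinMk] <;> ring

/-- A three-term Plücker relation. -/
lemma det3_exchange_left (a b c d e : Vec) :
    det3 b c e * det3 a c d - det3 b c d * det3 a c e = det3 a b c * det3 c d e := by
  simp only [det3_eq]; ring

/-- A three-term Plücker relation. -/
lemma det3_exchange_right (a b c d e : Vec) :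
    det3 b d e * det3 a c e - det3 b c e * det3 a d e = det3 a b e * det3 c d e := by
  simp only [det3_eq]; ring

lemma cross_cross_eq (u v w z : Vec) :
    crossProduct (crossProduct u v) (crossProduct w z) = det3 u v z • w - det3 u v w • z := by
  ext i
  fin_cases i <;>
    simp [det3_eq, cross_apply] <;> ring

lemma ne_zero_left_of_det3 {a b c : Vec} (h : det3 a b c ≠ 0) : a ≠ 0 := by
  rintro rfl
  exact h (det3_zero_left _ _)

/-! ### Homogeneous coordinates -/

lemma Represents.ne_zero {v : Vec} {x : RP2} (h : Represents v x) : v ≠ 0 := h.1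

lemma Represents.eq {v : Vec} {x y : RP2} (hx : Represents v x) (hy : Represents v y) : x = y := by
  obtain ⟨h, rfl⟩ := hx
  obtain ⟨h', rfl⟩ := hy
  rfl

lemma represents_mk {v : Vec} (h : v ≠ 0) : Represents v (Projectivization.mk ℝ v h) := ⟨h, rfl⟩

lemma represents_rep (x : RP2) : Represents x.rep x := ⟨x.rep_nonzero, x.mk_rep⟩

lemma Represents.smul {v : Vec} {x : RP2} (h : Represents v x) {c : ℝ} (hc : c ≠ 0) :
    Represents (c • v) x := by
  obtain ⟨h, rfl⟩ := h
  refine ⟨smul_ne_zero hc h, ?_⟩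
  rw [Projectivization.mk_eq_mk_iff']
  exact ⟨c, rfl⟩

lemma Represents.exists_smul {v w : Vec} {x : RP2} (hv : Represents v x) (hw : Represents w x) :
    ∃ c : ℝ, c ≠ 0 ∧ w = c • v := by
  obtain ⟨h, rfl⟩ := hv
  obtain ⟨h', hw⟩ := hw
  rw [Projectivization.mk_eq_mk_iff'] at hw
  obtain ⟨c, rfl⟩ := hw
  refine ⟨c, ?_, rfl⟩
  rintro rfl
  exact h' (zero_smul _ _)

/-- The line through `a`, `b` and the line through `c`, `d` are well defined and distinct. -/
def IsTransversal (a b c d : RP2) : Prop :=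
  ∃ u v w z : Vec, Represents u a ∧ Represents v b ∧ Represents w c ∧ Represents z d ∧
    crossProduct (crossProduct u v) (crossProduct w z) ≠ 0

lemma IsTransversal.cross_ne_zero {a b c d : RP2} (h : IsTransversal a b c d) {u v w z : Vec}
    (hu : Represents u a) (hv : Represents v b) (hw : Represents w c) (hz : Represents z d) :
    crossProduct (crossProduct u v) (crossProduct w z) ≠ 0 := by
  obtain ⟨u', v', w', z', hu', hv', hw', hz', h⟩ := h
  obtain ⟨α, -, rfl⟩ := hu.exists_smul hu'
  obtain ⟨β, -, rfl⟩ := hv.exists_smul hv'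
  obtain ⟨γ, -, rfl⟩ := hw.exists_smul hw'
  obtain ⟨δ, -, rfl⟩ := hz.exists_smul hz'
  intro h0
  apply h
  simp only [map_smul, LinearMap.smul_apply, h0, smul_zero]

lemma represents_meet {a b c d : RP2} {u v w z : Vec}
    (hu : Represents u a) (hv : Represents v b) (hw : Represents w c) (hz : Represents z d)
    (h : crossProduct (crossProduct u v) (crossProduct w z) ≠ 0) :
    Represents (crossProduct (crossProduct u v) (crossProduct w z)) (meet a b c d) := by
  obtain ⟨hu0, rfl⟩ := hu
  obtain ⟨hv0, rfl⟩ := hv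
  obtain ⟨hw0, rfl⟩ := hw
  obtain ⟨hz0, rfl⟩ := hz
  have h1 : crossProduct u v ≠ 0 := by
    intro h0; apply h; rw [h0]; simp
  have h2 : crossProduct w z ≠ 0 := by
    intro h0; apply h; rw [h0]; simp
  refine ⟨h, ?_⟩
  rw [meet, Projectivization.cross_mk_of_cross_ne_zero hu0 hv0 h1,
    Projectivization.cross_mk_of_cross_ne_zero hw0 hz0 h2,
    Projectivization.cross_mk_of_cross_ne_zero h1 h2 h]

/-- A point which lies on two distinct lines is their intersection. -/
lemma meet_eq_of_lifts {a b c d x : RP2} {u v w z e : Vec}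
    (hu : Represents u a) (hv : Represents v b) (hw : Represents w c) (hz : Represents z d)
    (he : Represents e x) (h : det3 u v w ≠ 0) (hl : det3 u v e = 0) {γ δ : ℝ}
    (hδ : δ ≠ 0) (hc : e = γ • w + δ • z) :
    IsTransversal a b c d ∧ meet a b c d = x := by
  have key : crossProduct (crossProduct u v) (crossProduct w z) = (-(det3 u v w / δ)) • e := by
    rw [cross_cross_eq]
    have h1 : γ * det3 u v w + δ * det3 u v z = 0 := by
      rw [← det3_comb_right, ← hc, hl]
    have h2 : det3 u v z = -(det3 u v w / δ) * γ := by
      field_simp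
      linarith
    rw [h2, hc]
    ext i
    simp only [Pi.sub_apply, Pi.add_apply, Pi.smul_apply, smul_eq_mul]
    field_simp
    ring
  have hne : -(det3 u v w / δ) ≠ 0 := neg_ne_zero.2 (div_ne_zero h hδ)
  have h0 : crossProduct (crossProduct u v) (crossProduct w z) ≠ 0 := by
    rw [key]; exact smul_ne_zero hne he.ne_zero
  refine ⟨⟨u, v, w, z, hu, hv, hw, hz, h0⟩, ?_⟩
  have := represents_meet hu hv hw hz h0
  rw [key] at this
  exact this.eq (he.smul hne)

/-! ### Smoothness of intersection points -/

/-- Smoothness of a map into the projective plane is the local existence of smooth homogeneous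
coordinates. -/
lemma isPlot_RP2_iff {m : ℕ} {p : EuclideanSpace ℝ (Fin m) → RP2} :
    IsPlot p ↔ ∀ x, ∃ g : EuclideanSpace ℝ (Fin m) → Vec,
      ContDiffAt ℝ ∞ g x ∧ ∀ᶠ y in 𝓝 x, Represents (g y) (p y) := by
  constructor
  · intro h x
    exact h x (Set.mem_univ x)
  · intro h x _
    exact h x

lemma contDiffAt_det3 {E : Type*} [NormedAddCommGroup E] [NormedSpace ℝ E] {f g h : E → Vec} {x : E}
    (hf : ContDiffAt ℝ ∞ f x) (hg : ContDiffAt ℝ ∞ g x) (hh : ContDiffAt ℝ ∞ h x) :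
    ContDiffAt ℝ ∞ (fun y => det3 (f y) (g y) (h y)) x := by
  simp only [det3_eq]
  rw [contDiffAt_pi] at hf hg hh
  have f0 := hf 0
  have f1 := hf 1
  have f2 := hf 2
  have g0 := hg 0
  have g1 := hg 1
  have g2 := hg 2
  have h0 := hh 0
  have h1 := hh 1
  have h2 := hh 2
  fun_prop

lemma isPlot_meet {m : ℕ} {p q r s : EuclideanSpace ℝ (Fin m) → RP2} (hp : IsPlot p)
    (hq : IsPlot q) (hr : IsPlot r) (hs : IsPlot s)
    (h : ∀ y, IsTransversal (p y) (q y) (r y) (s y)) :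
    IsPlot fun y => meet (p y) (q y) (r y) (s y) := by
  rw [isPlot_RP2_iff] at *
  intro x
  obtain ⟨f, hf, hf'⟩ := hp x
  obtain ⟨g, hg, hg'⟩ := hq x
  obtain ⟨k, hk, hk'⟩ := hr x
  obtain ⟨l, hl, hl'⟩ := hs x
  refine ⟨fun y => crossProduct (crossProduct (f y) (g y)) (crossProduct (k y) (l y)), ?_, ?_⟩
  · simp only [cross_cross_eq]
    exact ((contDiffAt_det3 hf hg hl).smul hk).sub ((contDiffAt_det3 hf hg hk).smul hl)
  · filter_upwards [hf', hg', hk', hl'] with y h1 h2 h3 h4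
    exact represents_meet h1 h2 h3 h4 ((h y).cross_ne_zero h1 h2 h3 h4)

/-! ### Convex polygons and lifts -/

/-- Homogeneous coordinates of the vertices of a strictly convex `n`-gon, with coherent signs: any
three vertices, listed in cyclic order, have positive determinant. -/
def PolyConvex {n : ℕ} (a : ZMod n → Vec) : Prop :=
  ∀ (i : ZMod n) (p q : ℕ), 0 < p → p < q → q < n → 0 < det3 (a i) (a (i + p)) (a (i + q))

lemma PolyConvex.nonneg {n : ℕ} {a : ZMod n → Vec} (h : PolyConvex a) (i : ZMod n) {p q : ℕ}
    (hpq : p ≤ q) (hq : q ≤ n) : 0 ≤ det3 (a i) (a (i + p)) (a (i + q)) := by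
  rcases Nat.eq_zero_or_pos p with rfl | hp
  · simp
  rcases hpq.eq_or_lt with rfl | hpq
  · simp
  rcases hq.eq_or_lt with rfl | hq
  · simp
  exact (h i p q hp hpq hq).le

lemma PolyConvex.pos₁₂ {n : ℕ} {a : ZMod n → Vec} (h : PolyConvex a) (hn : 4 ≤ n) (i : ZMod n) :
    0 < det3 (a i) (a (i + 1)) (a (i + 2)) := by
  simpa using h i 1 2 (by lia) (by lia) (by lia)

lemma PolyConvex.pos₁₃ {n : ℕ} {a : ZMod n → Vec} (h : PolyConvex a) (hn : 4 ≤ n) (i : ZMod n) :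
    0 < det3 (a i) (a (i + 1)) (a (i + 3)) := by
  simpa using h i 1 3 (by lia) (by lia) (by lia)

lemma PolyConvex.pos₂₃ {n : ℕ} {a : ZMod n → Vec} (h : PolyConvex a) (hn : 4 ≤ n) (i : ZMod n) :
    0 < det3 (a i) (a (i + 2)) (a (i + 3)) := by
  simpa using h i 2 3 (by lia) (by lia) (by lia)

lemma PolyConvex.pos₁₂₃ {n : ℕ} {a : ZMod n → Vec} (h : PolyConvex a) (hn : 4 ≤ n) (i : ZMod n) :
    0 < det3 (a (i + 1)) (a (i + 2)) (a (i + 3)) := by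
  have := h.pos₁₂ hn (i + 1)
  rwa [show i + 1 + 1 = i + 2 by ring, show i + 1 + 2 = i + 3 by ring] at this

lemma PolyConvex.shift {n : ℕ} {a : ZMod n → Vec} (h : PolyConvex a) (d : ZMod n) :
    PolyConvex fun i => a (i + d) := by
  intro i p q hp hpq hq
  have := h (i + d) p q hp hpq hq
  simpa only [add_right_comm] using this

/-- Replacing every vertex by a point of the half-open edge to the next one, which excludes the
vertex itself, preserves convexity. -/
lemma PolyConvex.of_edges {n : ℕ} {a b : ZMod n → Vec} (h : PolyConvex a) {x y : ZMod n → ℝ}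
    (hx : ∀ i, 0 ≤ x i) (hy : ∀ i, 0 < y i) (hb : ∀ i, b i = x i • a i + y i • a (i + 1)) :
    PolyConvex b := by
  intro i p q hp hpq hq
  obtain ⟨p, rfl⟩ : ∃ p', p = p' + 1 := ⟨p - 1, by lia⟩
  obtain ⟨q, rfl⟩ : ∃ q', q = q' + 1 := ⟨q - 1, by lia⟩
  set u := i + ((p + 1 : ℕ) : ZMod n) with hu
  set v := i + ((q + 1 : ℕ) : ZMod n) with hv
  have e1 : u = i + 1 + (p : ℕ) := by rw [hu]; push_cast; ring
  have e2 : v = i + 1 + (q : ℕ) := by rw [hv]; push_cast; ring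
  have e3 : u + 1 = i + ((p + 2 : ℕ) : ZMod n) := by rw [hu]; push_cast; ring
  have e4 : v + 1 = i + ((q + 2 : ℕ) : ZMod n) := by rw [hv]; push_cast; ring
  have e5 : u + 1 = i + 1 + ((p + 1 : ℕ) : ZMod n) := by rw [hu]; push_cast; ring
  have e6 : v + 1 = i + 1 + ((q + 1 : ℕ) : ZMod n) := by rw [hv]; push_cast; ring
  have d000 : 0 ≤ det3 (a i) (a u) (a v) := by
    rw [hu, hv]; exact h.nonneg i (by lia) (by lia)
  have d001 : 0 ≤ det3 (a i) (a u) (a (v + 1)) := by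
    rw [hu, e4]; exact h.nonneg i (by lia) (by lia)
  have d010 : 0 ≤ det3 (a i) (a (u + 1)) (a v) := by
    rw [e3, hv]; exact h.nonneg i (by lia) (by lia)
  have d011 : 0 ≤ det3 (a i) (a (u + 1)) (a (v + 1)) := by
    rw [e3, e4]; exact h.nonneg i (by lia) (by lia)
  have d100 : 0 ≤ det3 (a (i + 1)) (a u) (a v) := by
    rw [e1, e2]; exact h.nonneg _ (by lia) (by lia)
  have d101 : 0 ≤ det3 (a (i + 1)) (a u) (a (v + 1)) := by
    rw [e1, e6]; exact h.nonneg _ (by lia) (by lia)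
  have d110 : 0 ≤ det3 (a (i + 1)) (a (u + 1)) (a v) := by
    rw [e5, e2]; exact h.nonneg _ (by lia) (by lia)
  have d111 : 0 < det3 (a (i + 1)) (a (u + 1)) (a (v + 1)) := by
    rw [e5, e6]; exact h _ _ _ (by lia) (by lia) (by lia)
  rw [hb i, hb u, hb v]
  simp only [det3_comb_left, det3_comb_mid, det3_comb_right]
  have := hx i
  have := hx u
  have := hx v
  have := hy i
  have := hy u
  have := hy v
  positivity

/-- A vertex `D j` of a convex polygon may be moved outwards along the line from `D (j - 1)`, as
long as it does not reach the line through the next two vertices. -/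
lemma PolyConvex.update {n : ℕ} (hn : 4 ≤ n) {D : ZMod n → Vec} (h : PolyConvex D) (i : ZMod n)
    {X : ℝ} (hX : 0 < det3 (D (i + 1) - X • D i) (D (i + 2)) (D (i + 3))) :
    PolyConvex (Function.update D (i + 1) (D (i + 1) - X • D i)) := by
  have : NeZero n := ⟨by lia⟩
  have hsub : ∀ u v : Vec, det3 (D (i + 1) - X • D i) u v
      = det3 (D (i + 1)) u v - X * det3 (D i) u v := by
    intro u v
    rw [show D (i + 1) - X • D i = (1 : ℝ) • D (i + 1) + (-X) • D i by module, det3_comb_left]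
    ring
  have pos : ∀ p q r : ℕ, p < q → q < r → r < p + n →
      0 < det3 (D (i + p)) (D (i + q)) (D (i + r)) := by
    intro p q r hpq hqr hr
    have := h (i + p) (q - p) (r - p) (by lia) (by lia) (by lia)
    rwa [add_assoc, add_assoc, ← Nat.cast_add, ← Nat.cast_add, show p + (q - p) = q by lia,
      show p + (r - p) = r by lia] at this
  have main : ∀ p q : ℕ, 0 < p → p < q → q < n →
      0 < det3 (D (i + 1) - X • D i) (D (i + 1 + p)) (D (i + 1 + q)) := by
    intro p q hp hpq hq
    have e : ∀ r : ℕ, i + 1 + (r : ZMod n) = i + ((r + 1 : ℕ) : ZMod n) := by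
      intro r; push_cast; ring
    rw [e, e]
    obtain ⟨P, hP⟩ : ∃ P, P = p + 1 := ⟨_, rfl⟩
    obtain ⟨Q, hQ⟩ : ∃ Q, Q = q + 1 := ⟨_, rfl⟩
    rw [← hP, ← hQ]
    rw [hsub] at hX ⊢
    rcases (show Q ≤ n by lia).eq_or_lt with hQn | hQn
    · rw [hQn, ZMod.natCast_self, add_zero, det3_self_outer, mul_zero, sub_zero]
      have := pos 1 P n (by lia) (by lia) (by lia)
      simpa using this
    -- the ratio of the two determinants increases with both of the other vertices
    have s1 := det3_exchange_left (D i) (D (i + 1)) (D (i + 2)) (D (i + 3)) (D (i + Q))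
    have s2 := det3_exchange_right (D i) (D (i + 1)) (D (i + 2)) (D (i + P)) (D (i + Q))
    have p012 : 0 < det3 (D i) (D (i + 1)) (D (i + 2)) := h.pos₁₂ hn i
    have p023 : 0 < det3 (D i) (D (i + 2)) (D (i + 3)) := h.pos₂₃ hn i
    have p01Q : 0 < det3 (D i) (D (i + 1)) (D (i + Q)) := by
      simpa using pos 0 1 Q (by lia) (by lia) (by lia)
    have p02Q : 0 < det3 (D i) (D (i + 2)) (D (i + Q)) := by
      simpa using pos 0 2 Q (by lia) (by lia) (by lia)
    have p0PQ : 0 < det3 (D i) (D (i + P)) (D (i + Q)) := by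
      simpa using pos 0 P Q (by lia) (by lia) (by lia)
    have p23Q : 0 ≤ det3 (D (i + 2)) (D (i + 3)) (D (i + Q)) := by
      rcases (show 3 ≤ Q by lia).eq_or_lt with rfl | h3
      · simp
      · simpa using (pos 2 3 Q (by lia) (by lia) (by lia)).le
    have p2PQ : 0 ≤ det3 (D (i + 2)) (D (i + P)) (D (i + Q)) := by
      rcases (show 2 ≤ P by lia).eq_or_lt with rfl | h3
      · simp
      · simpa using (pos 2 P Q (by lia) (by lia) (by lia)).le
    have h1 : 0 ≤ (det3 (D (i + 1)) (D (i + P)) (D (i + Q)) * det3 (D i) (D (i + 2)) (D (i + 3))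
        - det3 (D (i + 1)) (D (i + 2)) (D (i + 3)) * det3 (D i) (D (i + P)) (D (i + Q)))
        * det3 (D i) (D (i + 2)) (D (i + Q)) := by
      have t1 := mul_nonneg (mul_nonneg p012.le p23Q) p0PQ.le
      have t2 := mul_nonneg (mul_nonneg p01Q.le p2PQ) p023.le
      rw [← s1] at t1
      rw [← s2] at t2
      linarith
    have h2 := nonneg_of_mul_nonneg_left h1 p02Q
    have h3 := mul_pos p0PQ hX
    refine pos_of_mul_pos_left (b := det3 (D i) (D (i + 2)) (D (i + 3))) ?_ p023.le
    linarith
  intro i' p q hp hpq hq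
  obtain ⟨i', rfl⟩ : ∃ l, i' = i + 1 + l := ⟨i' - (i + 1), by ring⟩
  have hval : ∀ l : ℕ, 0 < l → l < n → (l : ZMod n) ≠ 0 := by
    intro l h0 hl h
    rw [ZMod.natCast_eq_zero_iff] at h
    exact absurd (Nat.le_of_dvd h0 h) (by lia)
  have hne : ∀ l : ZMod n, l ≠ 0 →
      Function.update D (i + 1) (D (i + 1) - X • D i) (i + 1 + l) = D (i + 1 + l) := by
    intro l hl
    rw [Function.update_of_ne]
    simpa using hl
  have heq : Function.update D (i + 1) (D (i + 1) - X • D i) (i + 1)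
      = D (i + 1) - X • D i := Function.update_self ..
  rw [add_assoc (i + 1), add_assoc (i + 1)]
  by_cases h0 : i' = 0
  · subst h0
    rw [zero_add, zero_add, add_zero, heq, hne _ (hval p (by lia) (by lia)),
      hne _ (hval q (by lia) (by lia))]
    exact main p q hp hpq hq
  by_cases h1 : i' + p = 0
  · rw [h1, add_zero, heq, hne _ h0, ← det3_rotate]
    have e1 : i' + q = ((q - p : ℕ) : ZMod n) := by
      rw [Nat.cast_sub hpq.le]; linear_combination h1
    have e2 : i' = ((n - p : ℕ) : ZMod n) := by
      rw [Nat.cast_sub (by lia), ZMod.natCast_self]; linear_combination h1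
    rw [hne, e1, e2]
    · exact main _ _ (by lia) (by lia) (by lia)
    · rw [e1]; exact hval _ (by lia) (by lia)
  by_cases h2 : i' + q = 0
  · rw [h2, add_zero, heq, hne _ h0, hne _ h1, det3_rotate]
    have e1 : i' + p = ((n - (q - p) : ℕ) : ZMod n) := by
      rw [Nat.cast_sub (by lia), Nat.cast_sub (by lia), ZMod.natCast_self]; linear_combination h2
    have e2 : i' = ((n - q : ℕ) : ZMod n) := by
      rw [Nat.cast_sub (by lia), ZMod.natCast_self]; linear_combination h2
    rw [e1, e2]
    exact main _ _ (by lia) (by lia) (by lia)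
  rw [hne _ h0, hne _ h1, hne _ h2, ← add_assoc, ← add_assoc]
  exact h _ p q hp hpq hq

/-! ### One step of the seed map in homogeneous coordinates -/

/-- The residues `n - k + 1, …, n` of the edges which carry marked points. -/
def Marked (k : ℕ) {n : ℕ} (i : ZMod n) : Prop := (-i).val < k

instance (k : ℕ) {n : ℕ} (i : ZMod n) : Decidable (Marked k i) :=
  inferInstanceAs (Decidable (_ < _))

lemma marked_neg {n k j : ℕ} (hj : j < k) (hkn : k ≤ n - 1) : Marked k (-(j : ZMod n)) := by
  rw [Marked, neg_neg, ZMod.val_natCast_of_lt (by lia)]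
  exact hj

lemma Marked.exists_neg {n k : ℕ} [NeZero n] {i : ZMod n} (h : Marked k i) :
    ∃ j : ℕ, j < k ∧ i = -(j : ZMod n) :=
  ⟨(-i).val, h, by rw [ZMod.natCast_zmod_val, neg_neg]⟩

lemma not_marked_one {n k : ℕ} (hn : 4 ≤ n) (hkn : k ≤ n - 1) : ¬ Marked k (1 : ZMod n) := by
  have : (-1 : ZMod n) = ((n - 1 : ℕ) : ZMod n) := by
    rw [Nat.cast_sub (by lia)]; simp
  rw [Marked, this, ZMod.val_natCast_of_lt (by lia)]
  lia

/-- The residues of the marked edges, listed forwards. -/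
lemma marked_base {n k : ℕ} (hkn : k ≤ n - 1) {r : ℕ} (hr : r < k) :
    Marked k (1 - k + r : ZMod n) := by
  have : (1 - k + r : ZMod n) = -((k - 1 - r : ℕ) : ZMod n) := by
    rw [Nat.cast_sub (by lia), Nat.cast_sub (by lia)]; push_cast; ring
  rw [this]
  exact marked_neg (by lia) hkn

lemma not_marked_base {n k : ℕ} (hk : 1 ≤ k) {r : ℕ} (hr : k ≤ r) (hrn : r < n) :
    ¬ Marked k (1 - k + r : ZMod n) := by
  have : -(1 - k + r : ZMod n) = ((n + k - 1 - r : ℕ) : ZMod n) := by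
    rw [Nat.cast_sub (by lia), Nat.cast_sub (by lia)]; push_cast; simp
    ring
  rw [Marked, this, ZMod.val_natCast_of_lt (by lia)]
  lia

lemma exists_base {n : ℕ} [NeZero n] (k : ℕ) (i : ZMod n) :
    ∃ r : ℕ, r < n ∧ i = 1 - k + r :=
  ⟨(i - (1 - k)).val, ZMod.val_lt _, by rw [ZMod.natCast_zmod_val]; ring⟩

lemma Marked.exists_base {n k : ℕ} [NeZero n] (hk : 1 ≤ k) {i : ZMod n}
    (h : Marked k i) : ∃ r : ℕ, r < k ∧ i = 1 - k + r := by
  obtain ⟨r, hr, rfl⟩ := PentagramSpiral.exists_base k i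
  refine ⟨r, ?_, rfl⟩
  by_contra hrk
  exact not_marked_base hk (by lia) hr h

/-- The polygon `b` arises from the polygon `a` as in the seed map: `b i` lies in the interior of
the edge from `a i` to `a (i + 1)` if this edge is marked, and is a positive multiple of `a (i + 1)`
otherwise. -/
structure IsStep (k : ℕ) {n : ℕ} (x y : ZMod n → ℝ) (a b : ZMod n → Vec) : Prop where
  pos_left : ∀ i, Marked k i → 0 < x i
  eq_zero : ∀ i, ¬ Marked k i → x i = 0
  pos_right : ∀ i, 0 < y i
  eq : ∀ i, b i = x i • a i + y i • a (i + 1)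

lemma IsStep.nonneg {k n : ℕ} {x y : ZMod n → ℝ} {a b : ZMod n → Vec} (h : IsStep k x y a b)
    (i : ZMod n) : 0 ≤ x i := by
  by_cases hi : Marked k i
  · exact (h.pos_left i hi).le
  · exact (h.eq_zero i hi).ge

lemma IsStep.polyConvex {k n : ℕ} {x y : ZMod n → ℝ} {a b : ZMod n → Vec} (h : IsStep k x y a b)
    (ha : PolyConvex a) : PolyConvex b :=
  ha.of_edges h.nonneg h.pos_right h.eq

/-- For two consecutive steps `a → b → c`, the incidences of the marked points: `a (i + 1)`, `c i`
and `c (i + 1)` are collinear. -/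
def Incident (k : ℕ) {n : ℕ} (a c : ZMod n → Vec) : Prop :=
  ∀ i, Marked k i → det3 (a (i + 1)) (c i) (c (i + 1)) = 0

section coordinates

variable (x₀ y₀ x₁ y₁ x₂ y₂ s t p q : ℝ) (a₀ a₁ a₂ a₃ b₀ b₁ b₂ : Vec)

lemma det3_next_left : det3 a₁ (x₁ • a₁ + y₁ • a₂)
    (s • (x₁ • a₁ + y₁ • a₂) + t • (x₂ • a₂ + y₂ • a₃)) = y₁ * t * y₂ * det3 a₁ a₂ a₃ := by
  simp only [det3_eq, Pi.add_apply, Pi.smul_apply, smul_eq_mul]; ring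

lemma det3_next_right : det3 (x₀ • a₀ + y₀ • a₁) a₁
    (s • (x₁ • a₁ + y₁ • a₂) + t • (x₂ • a₂ + y₂ • a₃)) =
      x₀ * ((s * y₁ + t * x₂) * det3 a₀ a₁ a₂ + t * y₂ * det3 a₀ a₁ a₃) := by
  simp only [det3_eq, Pi.add_apply, Pi.smul_apply, smul_eq_mul]; ring

lemma det3_edge : det3 a₀ (x₀ • a₀ + y₀ • a₁)
    (p • (x₀ • a₀ + y₀ • a₁) + q • (x₁ • a₁ + y₁ • a₂)) = q * y₀ * y₁ * det3 a₀ a₁ a₂ := by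
  simp only [det3_eq, Pi.add_apply, Pi.smul_apply, smul_eq_mul]; ring

lemma det3_corner : det3 (p • (x₀ • a₀ + y₀ • a₁) + q • (x₁ • a₁ + y₁ • a₂)) a₁
    (x₀ • a₀ + y₀ • a₁) = -(q * x₀ * y₁ * det3 a₀ a₁ a₂) := by
  simp only [det3_eq, Pi.add_apply, Pi.smul_apply, smul_eq_mul]; ring

lemma det3_two_edges : det3 b₀ (p • b₀ + q • b₁) (s • b₁ + t • b₂) = q * t * det3 b₀ b₁ b₂ := by
  simp only [det3_eq, Pi.add_apply, Pi.smul_apply, smul_eq_mul]; ring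

/-- If `u`, `v`, `w` are coplanar, then each of them is a combination of the other two. -/
lemma eq_comb_of_det3_eq_zero {u v w z : Vec} (h : det3 u v w = 0) (hz : det3 v w z ≠ 0) :
    u = (det3 u w z / det3 v w z) • v + (det3 v u z / det3 v w z) • w := by
  have := det3_cramer v w z u
  rw [det3_rotate u v w, h, zero_smul, add_zero] at this
  rw [div_eq_inv_mul, div_eq_inv_mul, mul_smul, mul_smul, ← smul_add, ← this, smul_smul,
    inv_mul_cancel₀ hz, one_smul]

end coordinates

section forward

variable {n k : ℕ} {x y : ZMod n → ℝ} {a b : ZMod n → Vec}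

/-- Homogeneous coordinates of the new marked points, from the last one backwards:
`nextMark a b j` is the point on the edge from `b (1 - j)` to `b (2 - j)`. -/
def nextMark (a b : ZMod n → Vec) : ℕ → Vec
  | 0 => b 2
  | j + 1 => det3 (a (1 - j)) (b (1 - j)) (nextMark a b j) • b (-j)
      + det3 (b (-j)) (a (1 - j)) (nextMark a b j) • b (1 - j)

/-- The coefficients in the recursion of `nextMark` are positive. Here
`s • b (i + 1) + t • b (i + 2)` is the marked point which has been constructed before. -/
lemma nextMark_coeff_pos (hn : 4 ≤ n) (ha : PolyConvex a) (hab : IsStep k x y a b) {i : ZMod n}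
    (hi : Marked k i) {s t : ℝ} (hs : 0 ≤ s) (ht : 0 < t) :
    0 < det3 (a (i + 1)) (b (i + 1)) (s • b (i + 1) + t • b (i + 2)) ∧
      0 < det3 (b i) (a (i + 1)) (s • b (i + 1) + t • b (i + 2)) := by
  rw [hab.eq i, hab.eq (i + 1), hab.eq (i + 2), show i + 1 + 1 = i + 2 by ring,
    show i + 2 + 1 = i + 3 by ring, det3_next_left, det3_next_right]
  have := ha.pos₁₂₃ hn i
  have := ha.pos₁₂ hn i
  have := ha.pos₁₃ hn i
  have := hab.pos_right (i + 1)
  have := hab.pos_right (i + 2)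
  have := hab.pos_left i hi
  have := hab.nonneg (i + 2)
  constructor <;> positivity

lemma exists_nextMark_eq (hn : 4 ≤ n) (hkn : k ≤ n - 1) (ha : PolyConvex a)
    (hab : IsStep k x y a b) {j : ℕ} (hj : j ≤ k) : ∃ s t : ℝ, 0 ≤ s ∧ 0 < t ∧
      nextMark a b j = s • b (1 - j) + t • b (2 - j) := by
  induction j with
  | zero => exact ⟨0, 1, le_rfl, one_pos, by simp [nextMark]⟩
  | succ j ih =>
    obtain ⟨s, t, hs, ht, h⟩ := ih (by lia)
    have hpos := nextMark_coeff_pos hn ha hab (marked_neg (show j < k by lia) hkn) hs ht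
    rw [show (-(j : ZMod n) + 1) = 1 - j by ring, show (-(j : ZMod n) + 2) = 2 - j by ring,
      ← h] at hpos
    refine ⟨_, _, hpos.1.le, hpos.2, ?_⟩
    rw [nextMark, show (1 - ((j + 1 : ℕ) : ZMod n)) = -j by push_cast; ring,
      show (2 - ((j + 1 : ℕ) : ZMod n)) = 1 - j by push_cast; ring]

/-- Every convex polygon with marked points has a successor under the seed map. -/
lemma IsStep.exists_next (hn : 4 ≤ n) (hkn : k ≤ n - 1) (ha : PolyConvex a)
    (hab : IsStep k x y a b) :
    ∃ (x' y' : ZMod n → ℝ) (c : ZMod n → Vec), IsStep k x' y' b c ∧ Incident k a c := by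
  have : NeZero n := ⟨by lia⟩
  set c : ZMod n → Vec := fun i => if Marked k i then nextMark a b ((-i).val + 1) else b (i + 1)
    with hc
  have c_neg : ∀ j : ℕ, j < k → c (-j) = nextMark a b (j + 1) := by
    intro j hj
    have := marked_neg (n := n) hj hkn
    rw [hc]
    dsimp only
    rw [if_pos this, neg_neg, ZMod.val_natCast_of_lt (by lia)]
  have c_one_sub : ∀ j : ℕ, j ≤ k → c (1 - j) = nextMark a b j := by
    rintro (_ | j) hj
    · rw [hc]
      dsimp only
      rw [Nat.cast_zero, sub_zero, if_neg (not_marked_one hn hkn), nextMark]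
      norm_num
    · rw [← c_neg j (by lia)]
      congr 1
      push_cast; ring
  have c_eq : ∀ i, Marked k i → c i = det3 (a (i + 1)) (b (i + 1)) (c (i + 1)) • b i
      + det3 (b i) (a (i + 1)) (c (i + 1)) • b (i + 1) := by
    intro i hi
    obtain ⟨j, hj, rfl⟩ := hi.exists_neg
    rw [c_neg j hj, nextMark, show -(j : ZMod n) + 1 = 1 - j by ring, c_one_sub j (by lia)]
  have c_pos : ∀ i, Marked k i → 0 < det3 (a (i + 1)) (b (i + 1)) (c (i + 1)) ∧
      0 < det3 (b i) (a (i + 1)) (c (i + 1)) := by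
    intro i hi
    obtain ⟨j, hj, rfl⟩ := hi.exists_neg
    obtain ⟨s, t, hs, ht, h⟩ := exists_nextMark_eq hn hkn ha hab (show j ≤ k by lia)
    have := nextMark_coeff_pos hn ha hab hi hs ht
    rw [show -(j : ZMod n) + 1 = 1 - j by ring, show -(j : ZMod n) + 2 = 2 - j by ring, ← h,
      ← c_one_sub j (by lia)] at this
    rwa [show -(j : ZMod n) + 1 = 1 - j by ring]
  refine ⟨fun i => if Marked k i then det3 (a (i + 1)) (b (i + 1)) (c (i + 1)) else 0,
    fun i => if Marked k i then det3 (b i) (a (i + 1)) (c (i + 1)) else 1, c,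
    ⟨fun i hi => ?_, fun i hi => if_neg hi, fun i => ?_, fun i => ?_⟩, fun i hi => ?_⟩
  · rw [if_pos hi]; exact (c_pos i hi).1
  · split_ifs with hi
    · exact (c_pos i hi).2
    · exact one_pos
  · split_ifs with hi
    · exact c_eq i hi
    · rw [zero_smul, one_smul, zero_add, hc]
      exact if_neg hi
  · rw [c_eq i hi, det3_comb_mid]
    rw [det3_swap_right (a (i + 1)) (c (i + 1)) (b i), det3_swap_right (a (i + 1)) (c (i + 1)),
      ← det3_rotate (b i)]
    ring

end forward

section backward

variable {n k : ℕ} {x y : ZMod n → ℝ} {b c : ZMod n → Vec}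

/-- Recovering one vertex after the other: after `l` steps, the vertices `1 - k, …, 1 - k + l` of
the old polygon are known, and they span a convex polygon together with the remaining vertices
of `b`. -/
lemma IsStep.exists_partial_prev (hn : 4 ≤ n) (hkn : k ≤ n - 1) (hb : PolyConvex b)
    (hbc : IsStep k x y b c) {l : ℕ} (hl : l ≤ k) :
    ∃ (ξ η : ZMod n → ℝ) (D : ZMod n → Vec), PolyConvex D ∧
      (∀ r < l, 0 < ξ (1 - k + r)) ∧ (∀ r, l ≤ r → r < n → ξ (1 - k + r) = 0) ∧ (∀ i, 0 < η i) ∧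
      (∀ i, b i = ξ i • D i + η i • D (i + 1)) ∧
      ∀ r < l, det3 (D (1 - k + r + 1)) (c (1 - k + r)) (c (1 - k + r + 1)) = 0 := by
  have : NeZero n := ⟨by lia⟩
  induction l with
  | zero =>
    refine ⟨fun _ => 0, fun _ => 1, fun i => b (i + (-1)), hb.shift _, by simp, by simp, by simp,
      ?_, by simp⟩
    intro i
    simp
  | succ l ih =>
    obtain ⟨ξ, η, D, hD, hξ, hξ0, hη, hbD, hcop⟩ := ih (by lia)
    have hξ' : ∀ i, 0 ≤ ξ i := by
      intro i
      obtain ⟨r, hr, rfl⟩ := exists_base k i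
      by_cases h : r < l
      · exact (hξ r h).le
      · exact (hξ0 r (by lia) hr).ge
    obtain ⟨i, hi⟩ : ∃ i : ZMod n, i = 1 - k + l := ⟨_, rfl⟩
    have hmi : Marked k i := hi ▸ marked_base hkn (show l < k by lia)
    have i0 : ξ i = 0 := hi ▸ hξ0 l le_rfl (by lia)
    have i1 : ξ (i + 1) = 0 := by
      have := hξ0 (l + 1) (by lia) (by lia)
      rwa [Nat.cast_add, Nat.cast_one, ← add_assoc, ← hi] at this
    have b0 : b i = η i • D (i + 1) := by rw [hbD, i0, zero_smul, zero_add]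
    have b1 : b (i + 1) = η (i + 1) • D (i + 2) := by
      rw [hbD, i1, zero_smul, zero_add, show i + 1 + 1 = i + 2 by ring]
    have b2 : b (i + 2) = ξ (i + 2) • D (i + 2) + η (i + 2) • D (i + 3) := by
      rw [hbD, show i + 2 + 1 = i + 3 by ring]
    have c0 : c i = (x i * η i) • D (i + 1) + (y i * η (i + 1)) • D (i + 2) := by
      rw [hbc.eq, b0, b1]; module
    have c1 : c (i + 1) = (x (i + 1) * η (i + 1) + y (i + 1) * ξ (i + 2)) • D (i + 2)
        + (y (i + 1) * η (i + 2)) • D (i + 3) := by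
      rw [hbc.eq, show i + 1 + 1 = i + 2 by ring, b1, b2]; module
    have xi := hbc.pos_left i hmi
    have x1 := hbc.nonneg (i + 1)
    have y0 := hbc.pos_right i
    have y1 := hbc.pos_right (i + 1)
    have η0 := hη i
    have η1 := hη (i + 1)
    have η2 := hη (i + 2)
    have ξ2 := hξ' (i + 2)
    have p012 := hD.pos₁₂ hn i
    have p013 := hD.pos₁₃ hn i
    have p023 := hD.pos₂₃ hn i
    have p123 := hD.pos₁₂₃ hn i
    obtain ⟨u, hu⟩ : ∃ u, u = x i * η i := ⟨_, rfl⟩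
    obtain ⟨v, hv⟩ : ∃ v, v = y i * η (i + 1) := ⟨_, rfl⟩
    obtain ⟨s, hs⟩ : ∃ s, s = x (i + 1) * η (i + 1) + y (i + 1) * ξ (i + 2) := ⟨_, rfl⟩
    obtain ⟨t, ht⟩ : ∃ t, t = y (i + 1) * η (i + 2) := ⟨_, rfl⟩
    have u0 : 0 < u := by rw [hu]; positivity
    have v0 : 0 < v := by rw [hv]; positivity
    have s0 : 0 ≤ s := by rw [hs]; positivity
    have t0 : 0 < t := by rw [ht]; positivity
    rw [← hu, ← hv] at c0
    rw [← hs, ← ht] at c1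
    have den : det3 (D i) (c i) (c (i + 1)) = u * s * det3 (D i) (D (i + 1)) (D (i + 2))
        + u * t * det3 (D i) (D (i + 1)) (D (i + 3))
        + v * t * det3 (D i) (D (i + 2)) (D (i + 3)) := by
      rw [c0, c1]; simp only [det3_eq, Pi.add_apply, Pi.smul_apply, smul_eq_mul]; ring
    have num : det3 (D (i + 1)) (c i) (c (i + 1))
        = v * t * det3 (D (i + 1)) (D (i + 2)) (D (i + 3)) := by
      rw [c0, c1]; simp only [det3_eq, Pi.add_apply, Pi.smul_apply, smul_eq_mul]; ring
    have den0 : 0 < det3 (D i) (c i) (c (i + 1)) := by rw [den]; positivity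
    have num0 : 0 < det3 (D (i + 1)) (c i) (c (i + 1)) := by rw [num]; positivity
    have hsub : ∀ (X : ℝ) (p q : Vec), det3 (D (i + 1) - X • D i) p q
        = det3 (D (i + 1)) p q - X * det3 (D i) p q := by
      intro X p q
      simp only [det3_eq, Pi.sub_apply, Pi.smul_apply, smul_eq_mul]; ring
    -- the factor which moves `D (i + 1)` onto the line through `c i` and `c (i + 1)`
    obtain ⟨X, hX⟩ : ∃ X, X = det3 (D (i + 1)) (c i) (c (i + 1)) / det3 (D i) (c i) (c (i + 1)) :=
      ⟨_, rfl⟩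
    have X0 : 0 < X := by rw [hX]; positivity
    have hcop' : det3 (D (i + 1) - X • D i) (c i) (c (i + 1)) = 0 := by
      rw [hsub, hX]; field_simp; ring
    have hconv : 0 < det3 (D (i + 1) - X • D i) (D (i + 2)) (D (i + 3)) := by
      rw [hsub, hX, sub_pos, div_mul_eq_mul_div, div_lt_iff₀ den0, num, den]
      have : 0 ≤ det3 (D (i + 1)) (D (i + 2)) (D (i + 3)) *
          (u * s * det3 (D i) (D (i + 1)) (D (i + 2))) := by positivity
      have : 0 < det3 (D (i + 1)) (D (i + 2)) (D (i + 3)) *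
          (u * t * det3 (D i) (D (i + 1)) (D (i + 3))) := by positivity
      linarith
    have hD' := hD.update hn i hconv
    set e := D (i + 1) - X • D i with he
    have hne : ∀ j, j ≠ i + 1 → Function.update D (i + 1) e j = D j :=
      fun j hj => Function.update_of_ne hj ..
    have base_ne : ∀ {r r' : ℕ}, r < n → r' < n → r ≠ r' → (1 - k + r : ZMod n) ≠ 1 - k + r' := by
      intro r r' hr hr' hrr h
      have := congrArg ZMod.val (add_left_cancel h)
      rw [ZMod.val_natCast_of_lt hr, ZMod.val_natCast_of_lt hr'] at this
      exact hrr this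
    have i1' : i + 1 = 1 - k + ((l + 1 : ℕ) : ZMod n) := by rw [hi]; push_cast; ring
    have one_ne : (1 : ZMod n) ≠ 0 := by
      have : Fact (1 < n) := ⟨by lia⟩
      exact one_ne_zero
    refine ⟨Function.update ξ i (η i * X), η, Function.update D (i + 1) e, hD', ?_, ?_, hη, ?_, ?_⟩
    · intro r hr
      rcases (show r ≤ l by lia).eq_or_lt with rfl | hr
      · rw [← hi, Function.update_self]; positivity
      · rw [Function.update_of_ne]
        · exact hξ r hr
        · rw [hi]; exact base_ne (by lia) (by lia) (by lia)
    · intro r hr hrn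
      rw [Function.update_of_ne]
      · exact hξ0 r (by lia) hrn
      · rw [hi]; exact base_ne (by lia) (by lia) (by lia)
    · intro j
      by_cases hj : j = i
      · rw [hj, Function.update_self, Function.update_self, hne _ (by simpa using one_ne), b0, he]
        module
      rw [Function.update_of_ne hj, hne (j + 1) (by simpa using hj)]
      by_cases hj1 : j = i + 1
      · rw [hj1, Function.update_self, i1, hbD (i + 1), i1, zero_smul, zero_smul]
      · rw [hne j hj1, hbD]
    · intro r hr
      rcases (show r ≤ l by lia).eq_or_lt with rfl | hr
      · rw [← hi, Function.update_self]; exact hcop'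
      · rw [hne]
        · exact hcop r hr
        · rw [hi]
          intro h
          exact base_ne (show r < n by lia) (show l < n by lia) (by lia) (add_right_cancel h)

/-- Every convex polygon with marked points has a predecessor under the seed map. -/
lemma IsStep.exists_prev (hn : 4 ≤ n) (hk : 1 ≤ k) (hkn : k ≤ n - 1) (hb : PolyConvex b)
    (hbc : IsStep k x y b c) : ∃ (ξ η : ZMod n → ℝ) (a : ZMod n → Vec),
      PolyConvex a ∧ IsStep k ξ η a b ∧ Incident k a c := by
  have : NeZero n := ⟨by lia⟩
  obtain ⟨ξ, η, D, hD, hξ, hξ0, hη, hbD, hcop⟩ := hbc.exists_partial_prev hn hkn hb le_rfl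
  refine ⟨ξ, η, D, hD, ⟨fun i hi => ?_, fun i hi => ?_, hη, hbD⟩, fun i hi => ?_⟩
  · obtain ⟨r, hr, rfl⟩ := hi.exists_base hk
    exact hξ r hr
  · obtain ⟨r, hr, rfl⟩ := exists_base k i
    refine hξ0 r ?_ hr
    by_contra h
    exact hi (marked_base hkn (by lia))
  · obtain ⟨r, hr, rfl⟩ := hi.exists_base hk
    exact hcop r hr

end backward

/-! ### Incidences between consecutive polygons -/

section incidences

variable {n k : ℕ} {x y x' y' ξ η : ZMod n → ℝ} {a b c z : ZMod n → Vec}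

lemma IsStep.det3_corner_neg (hn : 4 ≤ n) (ha : PolyConvex a) (hab : IsStep k x y a b)
    (hbc : IsStep k x' y' b c) {i : ZMod n} (hi : Marked k i) :
    det3 (c i) (a (i + 1)) (b i) < 0 := by
  rw [hbc.eq i, hab.eq (i + 1), hab.eq i, show i + 1 + 1 = i + 2 by ring, det3_corner]
  have := ha.pos₁₂ hn i
  have := hbc.pos_right i
  have := hab.pos_left i hi
  have := hab.pos_right (i + 1)
  rw [neg_lt_zero]
  positivity

lemma IsStep.det3_next_pos (hn : 4 ≤ n) (ha : PolyConvex a) (hab : IsStep k x y a b)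
    (hbc : IsStep k x' y' b c) {i : ZMod n} (hi : Marked k i) :
    0 < det3 (b i) (a (i + 1)) (c (i + 1)) := by
  have := (nextMark_coeff_pos hn ha hab hi (hbc.nonneg (i + 1)) (hbc.pos_right (i + 1))).2
  rwa [show i + 2 = i + 1 + 1 by ring, ← hbc.eq] at this

lemma IsStep.det3_two_edges_pos (hn : 4 ≤ n) (hb : PolyConvex b) (hbc : IsStep k x' y' b c)
    (i : ZMod n) : 0 < det3 (b i) (c i) (c (i + 1)) := by
  rw [hbc.eq i, hbc.eq (i + 1), show i + 1 + 1 = i + 2 by ring, det3_two_edges]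
  have := hb.pos₁₂ hn i
  have := hbc.pos_right i
  have := hbc.pos_right (i + 1)
  positivity

/-- The incidence which defines the new marked points. -/
lemma IsStep.next_meet (hn : 4 ≤ n) (ha : PolyConvex a) (hab : IsStep k x y a b)
    (hbc : IsStep k x' y' b c) (hac : Incident k a c) {i : ZMod n} (hi : Marked k i)
    {A₁ B₀ B₁ C₀ C₁ : RP2} (hA₁ : Represents (a (i + 1)) A₁) (hB₀ : Represents (b i) B₀)
    (hB₁ : Represents (b (i + 1)) B₁) (hC₀ : Represents (c i) C₀)
    (hC₁ : Represents (c (i + 1)) C₁) :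
    IsTransversal A₁ C₁ B₀ B₁ ∧ meet A₁ C₁ B₀ B₁ = C₀ := by
  refine meet_eq_of_lifts hA₁ hC₁ hB₀ hB₁ hC₀ ?_ ?_ (hbc.pos_right i).ne' (hbc.eq i)
  · rw [det3_rotate]
    exact (hab.det3_next_pos hn ha hbc hi).ne'
  · rw [det3_swap_right, hac i hi, neg_zero]

/-- The incidence which recovers the vertices of the old polygon. -/
lemma IsStep.prev_meet (hn : 4 ≤ n) (ha : PolyConvex a) (hab : IsStep k x y a b)
    (hbc : IsStep k x' y' b c) (hac : Incident k a c) {i : ZMod n} (hi : Marked k i)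
    {A₀ A₁ B₀ C₀ C₁ : RP2} (hA₀ : Represents (a i) A₀) (hA₁ : Represents (a (i + 1)) A₁)
    (hB₀ : Represents (b i) B₀) (hC₀ : Represents (c i) C₀) (hC₁ : Represents (c (i + 1)) C₁) :
    IsTransversal A₀ B₀ C₀ C₁ ∧ meet A₀ B₀ C₀ C₁ = A₁ := by
  have h := hbc.det3_two_edges_pos hn (hab.polyConvex ha) i
  rw [← det3_rotate] at h
  refine meet_eq_of_lifts hA₀ hB₀ hC₀ hC₁ hA₁ ?_ ?_ ?_ (eq_comb_of_det3_eq_zero (hac i hi) h.ne')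
  · rw [hbc.eq i, hab.eq (i + 1), hab.eq i, show i + 1 + 1 = i + 2 by ring, det3_edge]
    have := ha.pos₁₂ hn i
    have := hbc.pos_right i
    have := hab.pos_right i
    have := hab.pos_right (i + 1)
    positivity
  · rw [hab.eq i, det3_comb_mid]
    simp
  · exact div_ne_zero (hab.det3_corner_neg hn ha hbc hi).ne h.ne'

/-- For three consecutive steps `z → a → b → c`, the points `c i` arise from the points `z (i + 1)`,
`a (i + 1)`, `b (i + 1)`, `c (i + 1)` by the pentagram map. -/
lemma IsStep.pentagram_meet (hn : 4 ≤ n) (hz : PolyConvex z) (hza : IsStep k ξ η z a)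
    (hab : IsStep k x y a b) (hbc : IsStep k x' y' b c) (hzb : Incident k z b)
    (hac : Incident k a c) {i : ZMod n} (hi : Marked k i) {Z A B C C₀ : RP2}
    (hZ : Represents (z (i + 1)) Z) (hA : Represents (a (i + 1)) A)
    (hB : Represents (b (i + 1)) B) (hC : Represents (c (i + 1)) C) (hC₀ : Represents (c i) C₀) :
    IsTransversal Z B A C ∧ meet Z B A C = C₀ := by
  have ha := hza.polyConvex hz
  have h := hab.det3_next_pos hn ha hbc hi
  rw [det3_rotate (c (i + 1)), ← det3_rotate (c (i + 1))] at h
  have h1 : det3 (c i) (a (i + 1)) (c (i + 1)) = 0 := by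
    rw [det3_swap_left, hac i hi, neg_zero]
  have h2 : det3 (a (i + 1)) (c (i + 1)) (b i) ≠ 0 := by
    rw [det3_rotate]
    exact (hab.det3_next_pos hn ha hbc hi).ne'
  refine meet_eq_of_lifts hZ hB hA hC hC₀ ?_ ?_ ?_ (eq_comb_of_det3_eq_zero h1 h2)
  · rw [det3_swap_right, hab.eq (i + 1), hza.eq (i + 1), hza.eq (i + 1 + 1), det3_edge,
      show i + 1 + 1 = i + 2 by ring, show i + 2 + 1 = i + 3 by ring]
    have := hz.pos₁₂₃ hn i
    have := hab.pos_right (i + 1)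
    have := hza.pos_right (i + 1)
    have := hza.pos_right (i + 2)
    rw [neg_ne_zero]
    positivity
  · rw [hbc.eq i, det3_comb_right, det3_self_right, det3_swap_right, hzb i hi]
    simp
  · refine div_ne_zero ?_ h2
    rw [det3_swap_left, neg_ne_zero]
    exact (hab.det3_corner_neg hn ha hbc hi).ne

end incidences

/-! ### Seeds -/

section seeds

variable {n k : ℕ} {x y x' y' : ZMod n → ℝ} {a b c : ZMod n → Vec}

lemma polyConvex_of_forall {n : ℕ} {a : ZMod n → Vec}
    (h : ∀ i j l : ℕ, 1 ≤ i → i < j → j < l → l ≤ n → 0 < det3 (a i) (a j) (a l)) :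
    PolyConvex a := by
  intro i p q hp hpq hq
  have : NeZero n := ⟨by lia⟩
  obtain ⟨r, hr, rfl⟩ : ∃ r : ℕ, r < n ∧ i = ((r + 1 : ℕ) : ZMod n) :=
    ⟨(i - 1).val, ZMod.val_lt _, by push_cast; rw [ZMod.natCast_zmod_val]; ring⟩
  rw [← Nat.cast_add, ← Nat.cast_add]
  have wrap : ∀ m : ℕ, n ≤ m → (m : ZMod n) = ((m - n : ℕ) : ZMod n) := by
    intro m hm
    rw [Nat.cast_sub hm, ZMod.natCast_self, sub_zero]
  by_cases h1 : r + 1 + q ≤ n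
  · exact h _ _ _ (by lia) (by lia) (by lia) (by lia)
  rw [wrap (r + 1 + q) (by lia)]
  by_cases h2 : r + 1 + p ≤ n
  · rw [det3_rotate]
    exact h _ _ _ (by lia) (by lia) (by lia) (by lia)
  rw [wrap (r + 1 + p) (by lia), ← det3_rotate]
  exact h _ _ _ (by lia) (by lia) (by lia) (by lia)

lemma PolyConvex.forall_pos {n : ℕ} {a : ZMod n → Vec} (h : PolyConvex a) (i j l : ℕ) (hi : 1 ≤ i)
    (hij : i < j) (hjl : j < l) (hl : l ≤ n) : 0 < det3 (a i) (a j) (a l) := by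
  have := h i (j - i) (l - i) (by lia) (by lia) (by lia)
  rwa [← Nat.cast_add, ← Nat.cast_add, show i + (j - i) = j by lia,
    show i + (l - i) = l by lia] at this

lemma newVertex_of_not_marked (s : MarkedPolygon n k) {i : ZMod n} (hi : ¬ Marked k i) :
    newVertex s i = s.1 (i + 1) := dif_neg hi

lemma newVertex_neg (s : MarkedPolygon n k) (hkn : k ≤ n - 1) {j : ℕ} (hj : j < k) :
    newVertex s (-j) = s.2 ⟨j, hj⟩ := by
  have h : (-(-(j : ZMod n))).val = j := by rw [neg_neg, ZMod.val_natCast_of_lt (by lia)]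
  have h' : (-(-(j : ZMod n))).val < k := by rwa [h]
  rw [newVertex, dif_pos h']
  exact congrArg s.2 (Fin.ext h)

lemma markedPolygon_ext (hkn : k ≤ n - 1) {s t : MarkedPolygon n k} (h : ∀ i, s.1 i = t.1 i)
    (h' : ∀ i, newVertex s i = newVertex t i) : s = t := by
  refine Prod.ext (funext h) (funext fun j => ?_)
  have := h' (-(j : ℕ))
  rwa [newVertex_neg s hkn j.2, newVertex_neg t hkn j.2] at this

/-- Homogeneous coordinates for a seed: `a` for the polygon, and `b` for the points which become
the vertices of the next polygon. -/
structure IsSeedLift (s : MarkedPolygon n k) (x y : ZMod n → ℝ) (a b : ZMod n → Vec) : Prop where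
  convex : PolyConvex a
  step : IsStep k x y a b
  vertex : ∀ i, Represents (a i) (s.1 i)
  newVertex : ∀ i, Represents (b i) (newVertex s i)

lemma IsSeedLift.isSeed (hkn : k ≤ n - 1) {s : MarkedPolygon n k} (h : IsSeedLift s x y a b) :
    IsSeed s := by
  refine ⟨a, h.vertex, h.convex.forall_pos, fun j => ⟨x (-(j : ℕ)), y (-(j : ℕ)), ?_, ?_, ?_⟩⟩
  · exact h.step.pos_left _ (marked_neg j.2 hkn)
  · exact h.step.pos_right _
  · have := h.newVertex (-(j : ℕ))
    rwa [newVertex_neg s hkn j.2, h.step.eq, show -((j : ℕ) : ZMod n) + 1 = 1 - (j : ℕ) by ring]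
      at this

lemma IsSeed.exists_lift {s : MarkedPolygon n k} (hn : 4 ≤ n) (h : IsSeed s) :
    ∃ x y a b, IsSeedLift s x y a b := by
  have : NeZero n := ⟨by lia⟩
  obtain ⟨a, ha, hpos, hm⟩ := h
  choose u v hu hv huv using hm
  set x : ZMod n → ℝ := fun i => if h : (-i).val < k then u ⟨_, h⟩ else 0 with hx
  set y : ZMod n → ℝ := fun i => if h : (-i).val < k then v ⟨_, h⟩ else 1 with hy
  refine ⟨x, y, a, fun i => x i • a i + y i • a (i + 1), polyConvex_of_forall hpos,
    ⟨fun i hi => ?_, fun i hi => dif_neg hi, fun i => ?_, fun i => rfl⟩, ha, fun i => ?_⟩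
  · rw [hx]; dsimp only; rw [dif_pos (show (-i).val < k from hi)]; exact hu _
  · rw [hy]; dsimp only; split_ifs with hi
    · exact hv _
    · exact one_pos
  · rw [newVertex, hx, hy]
    dsimp only
    split_ifs with hi
    · have := huv ⟨_, hi⟩
      rwa [ZMod.natCast_zmod_val, neg_neg, show 1 - -i = i + 1 by ring] at this
    · rw [zero_smul, one_smul, zero_add]
      exact ha _

lemma newVertex_seedMap_of_not_marked (s : MarkedPolygon n k) {i : ZMod n} (hi : ¬ Marked k i) :
    newVertex (seedMap s) i = newVertex s (i + 1) := newVertex_of_not_marked _ hi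

/-- The recursion for the new marked points, with uniform indices: if the edge `i + 1` is not
marked, the next vertex takes the place of its marked point. -/
lemma newVertex_seedMap_of_marked (hn : 4 ≤ n) (hkn : k ≤ n - 1) (s : MarkedPolygon n k)
    {i : ZMod n} (hi : Marked k i) : newVertex (seedMap s) i = meet (s.1 (i + 1))
      (newVertex (seedMap s) (i + 1)) (newVertex s i) (newVertex s (i + 1)) := by
  have : NeZero n := ⟨by lia⟩
  obtain ⟨j, hj, rfl⟩ := hi.exists_neg
  rw [newVertex_neg _ hkn hj]
  change newMark s j = _
  rcases j with _ | j
  · rw [newMark, Nat.cast_zero, neg_zero, zero_add,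
      newVertex_seedMap_of_not_marked s (not_marked_one hn hkn)]
    norm_num
  · rw [newMark, show -((j + 1 : ℕ) : ZMod n) + 1 = -(j : ZMod n) by push_cast; ring,
      newVertex_neg (seedMap s) hkn (show j < k by lia)]
    rfl

/-- The lift of the image of a seed. -/
lemma IsSeedLift.seedMap (hn : 4 ≤ n) (hkn : k ≤ n - 1) {s : MarkedPolygon n k}
    (h : IsSeedLift s x y a b) (hbc : IsStep k x' y' b c) (hac : Incident k a c) :
    IsSeedLift (seedMap s) x' y' b c := by
  have : NeZero n := ⟨by lia⟩
  refine ⟨h.step.polyConvex h.convex, hbc, h.newVertex, ?_⟩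
  have unm : ∀ i, ¬ Marked k i → Represents (c i) (PentagramSpiral.newVertex
      (PentagramSpiral.seedMap s) i) := by
    intro i hi
    rw [newVertex_seedMap_of_not_marked s hi, hbc.eq, hbc.eq_zero i hi, zero_smul, zero_add]
    exact (h.newVertex _).smul (hbc.pos_right i).ne'
  have mar : ∀ j : ℕ, j ≤ k → Represents (c (1 - j)) (PentagramSpiral.newVertex
      (PentagramSpiral.seedMap s) (1 - j)) := by
    intro j hj
    induction j with
    | zero =>
      rw [Nat.cast_zero, sub_zero]
      exact unm _ (not_marked_one hn hkn)
    | succ j ih =>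
      have ih := ih (by lia)
      have hi := marked_neg (n := n) (show j < k by lia) hkn
      rw [show (1 - ((j + 1 : ℕ) : ZMod n)) = -j by push_cast; ring]
      rw [show 1 - (j : ZMod n) = -(j : ZMod n) + 1 by ring] at ih
      rw [newVertex_seedMap_of_marked hn hkn s hi]
      have hne : c (-j) ≠ 0 := by
        have := (h.step.polyConvex h.convex).of_edges hbc.nonneg hbc.pos_right hbc.eq
        exact ne_zero_left_of_det3 (this.pos₁₂ hn _).ne'
      have := (h.step.next_meet hn h.convex hbc hac hi (h.vertex _) (h.newVertex _) (h.newVertex _)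
        (represents_mk hne) ih).2
      rw [this]
      exact represents_mk hne
  intro i
  by_cases hi : Marked k i
  · obtain ⟨j, hj, rfl⟩ := hi.exists_neg
    have := mar (j + 1) (by lia)
    rwa [show (1 - ((j + 1 : ℕ) : ZMod n)) = -j by push_cast; ring] at this
  · exact unm i hi

/-- The vertices `1 - k, …, 1` of the preimage of a seed: `oldVertex t l` has the index
`1 - k + l`, and arises as the intersection of two lines, starting from a vertex which the seed map
only relabels. -/
def oldVertex (t : MarkedPolygon n k) : ℕ → RP2
  | 0 => t.1 (-k)
  | l + 1 => meet (oldVertex t l) (t.1 (1 - k + l)) (newVertex t (1 - k + l))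
      (newVertex t (1 - k + l + 1))

/-- The inverse of the seed map. The marked points of the preimage are the vertices
`n - k + 1, …, n` of the given seed. -/
def seedMapInv (t : MarkedPolygon n k) : MarkedPolygon n k :=
  (fun i => if (i - (1 - k)).val ≤ k then oldVertex t (i - (1 - k)).val else t.1 (i - 1),
    fun j => t.1 (-(j : ℕ)))

lemma newVertex_seedMapInv (hn : 4 ≤ n) (hkn : k ≤ n - 1) (t : MarkedPolygon n k)
    (i : ZMod n) : newVertex (seedMapInv t) i = t.1 i := by
  have : NeZero n := ⟨by lia⟩
  by_cases hi : Marked k i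
  · obtain ⟨j, hj, rfl⟩ := hi.exists_neg
    rw [newVertex_neg _ hkn hj]
    rfl
  · rw [newVertex_of_not_marked _ hi]
    obtain ⟨r, hr, rfl⟩ := exists_base k i
    have hkr : k ≤ r := by
      by_contra h
      exact hi (marked_base hkn (by lia))
    simp only [seedMapInv]
    rw [show (1 - k + r + 1 - (1 - k) : ZMod n) = ((r + 1 : ℕ) : ZMod n) by push_cast; ring]
    rcases (show r + 1 ≤ n by lia).eq_or_lt with h | h
    · rw [h, ZMod.natCast_self, ZMod.val_zero, if_pos (by lia), oldVertex]
      have : (r : ZMod n) = -1 := by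
        have := congrArg (Nat.cast (R := ZMod n)) h
        rw [ZMod.natCast_self] at this
        push_cast at this
        linear_combination this
      rw [this, show (1 - k + -1 : ZMod n) = -k by ring]
    · rw [ZMod.val_natCast_of_lt h, if_neg (by lia), add_sub_cancel_right]

lemma IsSeedLift.represents_oldVertex (hn : 4 ≤ n) (hk : 1 ≤ k) (hkn : k ≤ n - 1)
    {t : MarkedPolygon n k} (h : IsSeedLift t x' y' b c) (ha : PolyConvex a)
    (hab : IsStep k x y a b) (hac : Incident k a c) {l : ℕ} (hl : l ≤ k) :
    Represents (a (1 - k + l)) (oldVertex t l) := by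
  have : NeZero n := ⟨by lia⟩
  have hne : ∀ i, a i ≠ 0 := fun i => ne_zero_left_of_det3 (ha.pos₁₂ hn i).ne'
  induction l with
  | zero =>
    have hb := h.vertex (-k)
    have hm : ¬ Marked k (-(k : ZMod n)) := by
      have := not_marked_base (n := n) hk (show k ≤ n - 1 from hkn) (by lia)
      rwa [Nat.cast_sub (by lia), ZMod.natCast_self,
        show (1 - k + (0 - (1 : ℕ)) : ZMod n) = -k by push_cast; ring] at this
    rw [hab.eq, hab.eq_zero _ hm, zero_smul, zero_add,
      show -(k : ZMod n) + 1 = 1 - k + (0 : ℕ) by push_cast; ring] at hb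
    have hy := hab.pos_right (-k)
    have := hb.smul (inv_ne_zero hy.ne')
    rwa [smul_smul, inv_mul_cancel₀ hy.ne', one_smul] at this
  | succ l ih =>
    have ih := ih (by lia)
    have := (hab.prev_meet hn ha h.step hac (marked_base hkn (show l < k by lia)) ih
      (represents_mk (hne _)) (h.vertex _) (h.newVertex _) (h.newVertex _)).2
    rw [oldVertex, this, Nat.cast_add, Nat.cast_one, ← add_assoc]
    exact represents_mk (hne _)

/-- The lift of the preimage of a seed. -/
lemma IsSeedLift.seedMapInv (hn : 4 ≤ n) (hk : 1 ≤ k) (hkn : k ≤ n - 1) {t : MarkedPolygon n k}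
    (h : IsSeedLift t x' y' b c) (ha : PolyConvex a) (hab : IsStep k x y a b)
    (hac : Incident k a c) : IsSeedLift (seedMapInv t) x y a b := by
  have : NeZero n := ⟨by lia⟩
  refine ⟨ha, hab, fun i => ?_, fun i => ?_⟩
  · obtain ⟨r, hr, rfl⟩ := exists_base k i
    simp only [PentagramSpiral.seedMapInv]
    rw [add_sub_cancel_left, ZMod.val_natCast_of_lt hr]
    split_ifs with hrk
    · exact h.represents_oldVertex hn hk hkn ha hab hac hrk
    · obtain ⟨r, rfl⟩ : ∃ r', r = r' + 1 := ⟨r - 1, by lia⟩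
      have hb := h.vertex (1 - k + r)
      rw [hab.eq, hab.eq_zero _ (not_marked_base hk (by lia) (by lia)), zero_smul, zero_add] at hb
      have hy := hab.pos_right (1 - k + r)
      have := hb.smul (inv_ne_zero hy.ne')
      rw [smul_smul, inv_mul_cancel₀ hy.ne', one_smul] at this
      rwa [Nat.cast_add, Nat.cast_one, ← add_assoc, add_sub_cancel_right]
  · rw [newVertex_seedMapInv hn hkn]
    exact h.vertex i

lemma isSeed_seedMap (hn : 4 ≤ n) (hkn : k ≤ n - 1) {s : MarkedPolygon n k} (h : IsSeed s) :
    IsSeed (seedMap s) := by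
  obtain ⟨x, y, a, b, h⟩ := h.exists_lift hn
  obtain ⟨x', y', c, hbc, hac⟩ := h.step.exists_next hn hkn h.convex
  exact (h.seedMap hn hkn hbc hac).isSeed hkn

lemma isSeed_seedMapInv (hn : 4 ≤ n) (hk : 1 ≤ k) (hkn : k ≤ n - 1) {s : MarkedPolygon n k}
    (h : IsSeed s) : IsSeed (seedMapInv s) := by
  obtain ⟨x, y, b, c, h⟩ := h.exists_lift hn
  obtain ⟨x', y', a, ha, hab, hac⟩ := h.step.exists_prev hn hk hkn h.convex
  exact (h.seedMapInv hn hk hkn ha hab hac).isSeed hkn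

lemma seedMapInv_seedMap (hn : 4 ≤ n) (hk : 1 ≤ k) (hkn : k ≤ n - 1) {s : MarkedPolygon n k}
    (h : IsSeed s) : seedMapInv (seedMap s) = s := by
  obtain ⟨x, y, a, b, h⟩ := h.exists_lift hn
  obtain ⟨x', y', c, hbc, hac⟩ := h.step.exists_next hn hkn h.convex
  have h' := (h.seedMap hn hkn hbc hac).seedMapInv hn hk hkn h.convex h.step hac
  exact markedPolygon_ext hkn (fun i => (h'.vertex i).eq (h.vertex i))
    fun i => (h'.newVertex i).eq (h.newVertex i)

lemma seedMap_seedMapInv (hn : 4 ≤ n) (hk : 1 ≤ k) (hkn : k ≤ n - 1) {s : MarkedPolygon n k}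
    (h : IsSeed s) : seedMap (seedMapInv s) = s := by
  obtain ⟨x, y, b, c, h⟩ := h.exists_lift hn
  obtain ⟨x', y', a, ha, hab, hac⟩ := h.step.exists_prev hn hk hkn h.convex
  have h' := (h.seedMapInv hn hk hkn ha hab hac).seedMap hn hkn h.step hac
  exact markedPolygon_ext hkn (fun i => (h'.vertex i).eq (h.vertex i))
    fun i => (h'.newVertex i).eq (h.newVertex i)

end seeds

/-! ### Uniqueness of coherent signs -/

/-- If a rescaling by the factors `r` preserves the signs of the determinants of the first three
vertices, and of the vertices `0`, `1`, `3`, of all quadrilaterals of consecutive vertices, then all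
factors are positive. -/
lemma pos_of_triple_products {R : Type*} [CommRing R] {r : R → ℝ}
    (h₂ : ∀ i, 0 < r i * r (i + 1) * r (i + 2))
    (h₃ : ∀ i, 0 < r i * r (i + 1) * r (i + 3)) (i : R) : 0 < r i := by
  have key : ∀ i, 0 < r i * r (i + 1) := by
    intro i
    have h2 := h₂ (i - 2)
    have h3 := h₃ (i - 2)
    rw [show i - 2 + 1 = i - 1 by ring] at h2 h3
    rw [show i - 2 + 2 = i by ring] at h2
    rw [show i - 2 + 3 = i + 1 by ring] at h3
    have h := mul_pos h2 h3
    rw [show r (i - 2) * r (i - 1) * r i * (r (i - 2) * r (i - 1) * r (i + 1))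
      = (r (i - 2) * r (i - 1)) ^ 2 * (r i * r (i + 1)) by ring] at h
    exact pos_of_mul_pos_right h (sq_nonneg _)
  have h := h₂ i
  rw [mul_assoc] at h
  have h' := key (i + 1)
  rw [show i + 1 + 1 = i + 2 by ring] at h'
  exact pos_of_mul_pos_left h h'.le

lemma pos_of_mul_det3_pos {r s t D E : ℝ} (hE : 0 < E) (h : 0 < D) (hD : D = r * (s * (t * E))) :
    0 < r * s * t := by
  rw [hD, show r * (s * (t * E)) = r * s * t * E by ring] at h
  exact pos_of_mul_pos_left h hE.le

/-- Homogeneous coordinates with coherent signs for a convex polygon are unique up to positive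
factors. -/
lemma PolyConvex.exists_pos_smul {n : ℕ} (hn : 4 ≤ n) {a b : ZMod n → Vec} {A : ZMod n → RP2}
    (ha : PolyConvex a) (hb : PolyConvex b) (haA : ∀ i, Represents (a i) (A i))
    (hbA : ∀ i, Represents (b i) (A i)) :
    ∃ r : ZMod n → ℝ, (∀ i, 0 < r i) ∧ ∀ i, b i = r i • a i := by
  choose r _ hr using fun i => (haA i).exists_smul (hbA i)
  refine ⟨r, pos_of_triple_products (fun i => ?_) (fun i => ?_), hr⟩
  · refine pos_of_mul_det3_pos (ha.pos₁₂ hn i) (hb.pos₁₂ hn i) ?_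
    rw [hr, hr (i + 1), hr (i + 2), det3_smul_left, det3_smul_mid, det3_smul_right]
  · refine pos_of_mul_det3_pos (ha.pos₁₃ hn i) (hb.pos₁₃ hn i) ?_
    rw [hr, hr (i + 1), hr (i + 3), det3_smul_left, det3_smul_mid, det3_smul_right]

lemma IsConvexLift.exists_pos_smul {P : ℤ → RP2} {v w : ℤ → Vec} (hv : IsConvexLift v P)
    (hw : IsConvexLift w P) : ∃ r : ℤ → ℝ, (∀ i, 0 < r i) ∧ ∀ i, w i = r i • v i := by
  choose r _ hr using fun i => (hv.1 i).exists_smul (hw.1 i)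
  refine ⟨r, pos_of_triple_products (fun i => ?_) (fun i => ?_), hr⟩
  · refine pos_of_mul_det3_pos (hv.2 i).1 (hw.2 i).1 ?_
    rw [hr, hr (i + 1), hr (i + 2), det3_smul_left, det3_smul_mid, det3_smul_right]
  · refine pos_of_mul_det3_pos (hv.2 i).2.1 (hw.2 i).2.1 ?_
    rw [hr, hr (i + 1), hr (i + 3), det3_smul_left, det3_smul_mid, det3_smul_right]

/-- The half-open edges can be computed from any convex lift. -/
lemma IsConvexLift.exists_of_mem {P : ℤ → RP2} {v : ℤ → Vec} (hv : IsConvexLift v P) {i : ℤ}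
    {x : RP2} (hx : x ∈ halfOpenEdge P i) :
    ∃ s t : ℝ, 0 < s ∧ 0 ≤ t ∧ Represents (s • v i + t • v (i + 1)) x := by
  obtain ⟨w, hw, s, t, hs, ht, hx⟩ := hx
  obtain ⟨r, hr, hrw⟩ := hv.exists_pos_smul hw
  refine ⟨s * r i, t * r (i + 1), mul_pos hs (hr i), mul_nonneg ht (hr _).le, ?_⟩
  rwa [hrw i, hrw (i + 1), smul_smul, smul_smul] at hx

/-! ### Orbits of the seed map -/

section orbits

variable {n k : ℕ}

/-- A bi-infinite orbit of seeds of the seed map. -/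
def IsOrbit (S : ℤ → MarkedPolygon n k) : Prop :=
  (∀ m, IsSeed (S m)) ∧ ∀ m, S (m + 1) = seedMap (S m)

/-- Coherent homogeneous coordinates for all polygons of an orbit of the seed map. -/
structure IsOrbitLift (S : ℤ → MarkedPolygon n k) (x y : ℤ → ZMod n → ℝ)
    (a : ℤ → ZMod n → Vec) : Prop where
  convex : ∀ m, PolyConvex (a m)
  step : ∀ m, IsStep k (x m) (y m) (a m) (a (m + 1))
  incident : ∀ m, Incident k (a m) (a (m + 2))
  vertex : ∀ m i, Represents (a m i) ((S m).1 i)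

/-- The lifts of the single seeds fit together after a rescaling by positive factors. -/
lemma IsOrbit.exists_lift (hn : 4 ≤ n) (hkn : k ≤ n - 1) {S : ℤ → MarkedPolygon n k}
    (hS : IsOrbit S) : ∃ x y a, IsOrbitLift S x y a := by
  choose x y a b h using fun m => (hS.1 m).exists_lift hn
  have hb : ∀ m i, Represents (b m i) ((S (m + 1)).1 i) := by
    intro m i
    rw [hS.2 m]
    exact (h m).newVertex i
  choose r hr hra using fun m => ((h m).step.polyConvex (h m).convex).exists_pos_smul hn
    (h (m + 1)).convex (hb m) (h (m + 1)).vertex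
  have hstep : ∀ m, IsStep k (fun i => r m i * x m i) (fun i => r m i * y m i) (a m)
      (a (m + 1)) := by
    intro m
    refine ⟨fun i hi => mul_pos (hr m i) ((h m).step.pos_left i hi), fun i hi => ?_,
      fun i => mul_pos (hr m i) ((h m).step.pos_right i), fun i => ?_⟩
    · rw [(h m).step.eq_zero i hi, mul_zero]
    · rw [hra, (h m).step.eq, smul_add, smul_smul, smul_smul]
  refine ⟨_, _, a, fun m => (h m).convex, hstep, fun m => ?_, fun m => (h m).vertex⟩
  have hl : IsSeedLift (S m) _ _ (a m) (a (m + 1)) := ⟨(h m).convex, hstep m, (h m).vertex, by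
    intro i
    have := (h (m + 1)).vertex i
    rwa [hS.2 m] at this⟩
  obtain ⟨x', y', c, hbc, hac⟩ := (hstep m).exists_next hn hkn (h m).convex
  have hc := (hl.seedMap hn hkn hbc hac).newVertex
  have ha : ∀ i, Represents (a (m + 2) i) (newVertex (seedMap (S m)) i) := by
    intro i
    have := (h (m + 2)).vertex i
    rw [show m + 2 = m + 1 + 1 by ring, hS.2, hS.2] at this
    rwa [show m + 2 = m + 1 + 1 by ring]
  intro i hi
  obtain ⟨p, -, hp⟩ := (hc i).exists_smul (ha i)
  obtain ⟨q, -, hq⟩ := (hc (i + 1)).exists_smul (ha (i + 1))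
  rw [hp, hq, det3_smul_mid, det3_smul_right, hac i hi]
  ring

lemma IsOrbit.vertex_succ {S : ℤ → MarkedPolygon n k} (hS : IsOrbit S) (m : ℤ) {i : ZMod n}
    (hi : ¬ Marked k i) : (S (m + 1)).1 i = (S m).1 (i + 1) := by
  rw [hS.2]
  exact newVertex_of_not_marked _ hi

/-- Vertices with unmarked indices are only relabeled by the seed map. -/
lemma IsOrbit.vertex_add (hk : 1 ≤ k) {S : ℤ → MarkedPolygon n k} (hS : IsOrbit S) {r : ℕ}
    (hr : r + k ≤ n) (m : ℤ) : (S (m + r)).1 1 = (S m).1 (1 + r) := by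
  induction r generalizing m with
  | zero => simp
  | succ r ih =>
    have := ih (by lia) (m + 1)
    rw [show m + ((r + 1 : ℕ) : ℤ) = m + 1 + r by push_cast; ring, this, hS.vertex_succ]
    · rw [Nat.cast_add, Nat.cast_one, add_assoc]
    · have := not_marked_base (n := n) hk (show k ≤ k + r by lia) (by lia)
      rwa [show (1 - k + ((k + r : ℕ) : ZMod n)) = 1 + r by push_cast; ring] at this

/-- The vertices with a marked index form the image of the path of their successors under the
pentagram map. -/
lemma IsOrbit.pentagram_vertex (hn : 4 ≤ n) (hkn : k ≤ n - 1) {S : ℤ → MarkedPolygon n k}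
    (hS : IsOrbit S) (m : ℤ) {i : ZMod n} (hi : Marked k i) :
    IsTransversal ((S (m - 1)).1 (i + 1)) ((S (m + 1)).1 (i + 1)) ((S m).1 (i + 1))
      ((S (m + 2)).1 (i + 1)) ∧
    meet ((S (m - 1)).1 (i + 1)) ((S (m + 1)).1 (i + 1)) ((S m).1 (i + 1)) ((S (m + 2)).1 (i + 1))
      = (S (m + 2)).1 i := by
  obtain ⟨x, y, a, h⟩ := hS.exists_lift hn hkn
  have h1 := h.step (m - 1)
  have h2 := h.step (m + 1)
  have h3 := h.incident (m - 1)
  rw [show m - 1 + 1 = m by ring] at h1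
  rw [show m + 1 + 1 = m + 2 by ring] at h2
  rw [show m - 1 + 2 = m + 1 by ring] at h3
  exact h1.pentagram_meet hn (h.convex _) (h.step m) h2 h3 (h.incident m) hi (h.vertex _ _)
    (h.vertex _ _) (h.vertex _ _) (h.vertex _ _) (h.vertex _ _)

/-- The `j`-th image of the generated path under the pentagram map is the path through the vertices
with the index `1 - j` of all polygons of the orbit. -/
lemma IsOrbit.iterate_pentagram (hn : 4 ≤ n) (hkn : k ≤ n - 1) {S : ℤ → MarkedPolygon n k}
    (hS : IsOrbit S) {P : ℤ → RP2} (hP : ∀ m, P (m + 1) = (S m).1 1) {j : ℕ} (hj : j ≤ k) (m : ℤ) :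
    pentagram^[j] P m = (S (m - 1 + 2 * j)).1 (1 - j) := by
  induction j generalizing m with
  | zero => simp [← hP]
  | succ j ih =>
    have ih := ih (by lia)
    have := (hS.pentagram_vertex hn hkn (m - 1 + 2 * j) (marked_neg (show j < k by lia) hkn)).2
    rw [Function.iterate_succ_apply', pentagram, ih, ih, ih, ih]
    rw [show -(j : ZMod n) + 1 = 1 - j by ring] at this
    rw [show m - 1 - 1 + 2 * (j : ℤ) = m - 1 + 2 * j - 1 by ring,
      show m + 1 - 1 + 2 * (j : ℤ) = m - 1 + 2 * j + 1 by ring,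
      show m + 2 - 1 + 2 * (j : ℤ) = m - 1 + 2 * j + 2 by ring, this,
      show m - 1 + 2 * ((j + 1 : ℕ) : ℤ) = m - 1 + 2 * j + 2 by push_cast; ring,
      show (1 - ((j + 1 : ℕ) : ZMod n)) = -j by push_cast; ring]

/-- The vertex `1 - k` of a polygon becomes the vertex `1` after `n - k` further steps of
relabeling. Therefore the generated path is invariant under `T^k`, up to a shift by `n + k`. -/
lemma IsOrbit.iterate_pentagram_self (hn : 4 ≤ n) (hk : 1 ≤ k) (hkn : k ≤ n - 1)
    {S : ℤ → MarkedPolygon n k} (hS : IsOrbit S) {P : ℤ → RP2} (hP : ∀ m, P (m + 1) = (S m).1 1)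
    (m : ℤ) : pentagram^[k] P m = P (m + (n + k)) := by
  have := hS.vertex_add hk (show n - k + k ≤ n by lia) (m - 1 + 2 * k)
  rw [hS.iterate_pentagram hn hkn hP le_rfl, show m + (n + k : ℤ) = m + (n + k - 1) + 1 by ring, hP,
    show m + (n + k - 1 : ℤ) = m - 1 + 2 * k + (n - k : ℕ) by
      rw [Nat.cast_sub (by lia)]; ring, this, Nat.cast_sub (by lia), ZMod.natCast_self,
    show (1 + (0 - k) : ZMod n) = 1 - k by ring]

lemma IsOrbit.hasType (hn : 4 ≤ n) (hk : 1 ≤ k) (hkn : k ≤ n - 1)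
    {S : ℤ → MarkedPolygon n k} (hS : IsOrbit S) {P : ℤ → RP2} (hP : ∀ m, P (m + 1) = (S m).1 1) :
    HasType n k P := by
  intro j
  have h1 : pentagram^[k] P = fun m => P (m + (n + k)) :=
    funext (hS.iterate_pentagram_self hn hk hkn hP)
  have hS' : IsOrbit fun m => S (m + (n + k)) := by
    refine ⟨fun m => hS.1 _, fun m => ?_⟩
    dsimp only
    rw [add_right_comm]
    exact hS.2 _
  have h2 := hS'.iterate_pentagram_self hn hk hkn (P := fun m => P (m + (n + k)))
    (fun m => by rw [add_right_comm]; exact hP _)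
  rw [two_mul, Function.iterate_add_apply, h1, h2]
  congr 1
  ring

/-! ### Convexity and embeddedness -/

/-- Four consecutive positions of the vertex with a given index form a strictly convex
quadrilateral, since they are nonnegative combinations of four consecutive vertices of a convex
polygon, and the matrix of coefficients is a product of nonnegative bidiagonal matrices, which has
nonnegative minors. -/
lemma IsOrbitLift.det3_pos {S : ℤ → MarkedPolygon n k} {x y : ℤ → ZMod n → ℝ}
    {a : ℤ → ZMod n → Vec} (hn : 4 ≤ n) (h : IsOrbitLift S x y a) (i : ZMod n) (m : ℤ) :
    0 < det3 (a m i) (a (m + 1) i) (a (m + 2) i) ∧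
      0 < det3 (a m i) (a (m + 1) i) (a (m + 3) i) ∧
      0 < det3 (a m i) (a (m + 2) i) (a (m + 3) i) := by
  have d012 := (h.convex m).pos₁₂ hn i
  have d013 := (h.convex m).pos₁₃ hn i
  have d023 := (h.convex m).pos₂₃ hn i
  have x00 := (h.step m).nonneg i
  have y00 := (h.step m).pos_right i
  have x01 := (h.step m).nonneg (i + 1)
  have y01 := (h.step m).pos_right (i + 1)
  have x02 := (h.step m).nonneg (i + 2)
  have y02 := (h.step m).pos_right (i + 2)
  have x10 := (h.step (m + 1)).nonneg i
  have y10 := (h.step (m + 1)).pos_right i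
  have x11 := (h.step (m + 1)).nonneg (i + 1)
  have y11 := (h.step (m + 1)).pos_right (i + 1)
  have x20 := (h.step (m + 2)).nonneg i
  have y20 := (h.step (m + 2)).pos_right i
  have v1 := (h.step m).eq i
  have w1 := (h.step m).eq (i + 1)
  have z1 := (h.step m).eq (i + 2)
  have v2 := (h.step (m + 1)).eq i
  have w2 := (h.step (m + 1)).eq (i + 1)
  have v3 := (h.step (m + 2)).eq i
  rw [show i + 1 + 1 = i + 2 by ring] at w1 w2
  rw [show i + 2 + 1 = i + 3 by ring] at z1
  rw [show m + 1 + 1 = m + 2 by ring] at v2 w2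
  rw [show m + 2 + 1 = m + 3 by ring] at v3
  have e1 : det3 (a m i) (a (m + 1) i) (a (m + 2) i) = y (m + 1) i * y m i * y m (i + 1) *
      det3 (a m i) (a m (i + 1)) (a m (i + 2)) := by
    rw [v2, v1, w1]
    simp only [det3_eq, Pi.add_apply, Pi.smul_apply, smul_eq_mul]; ring
  have e2 : det3 (a m i) (a (m + 1) i) (a (m + 3) i) = y m i *
      ((x (m + 2) i * y (m + 1) i * y m (i + 1) + y (m + 2) i * (x (m + 1) (i + 1) * y m (i + 1)
        + y (m + 1) (i + 1) * x m (i + 2))) * det3 (a m i) (a m (i + 1)) (a m (i + 2))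
        + y (m + 2) i * y (m + 1) (i + 1) * y m (i + 2) *
          det3 (a m i) (a m (i + 1)) (a m (i + 3))) := by
    rw [v3, v2, w2, v1, w1, z1]
    simp only [det3_eq, Pi.add_apply, Pi.smul_apply, smul_eq_mul]; ring
  have e3 : det3 (a m i) (a (m + 2) i) (a (m + 3) i) = y (m + 2) i *
      ((x (m + 1) i * y m i * (x (m + 1) (i + 1) * y m (i + 1) + y (m + 1) (i + 1) * x m (i + 2))
        + y (m + 1) i * x m (i + 1) * (y (m + 1) (i + 1) * x m (i + 2)))
          * det3 (a m i) (a m (i + 1)) (a m (i + 2))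
        + (x (m + 1) i * y m i + y (m + 1) i * x m (i + 1)) * (y (m + 1) (i + 1) * y m (i + 2))
          * det3 (a m i) (a m (i + 1)) (a m (i + 3))
        + y (m + 1) i * y m (i + 1) * (y (m + 1) (i + 1) * y m (i + 2))
          * det3 (a m i) (a m (i + 2)) (a m (i + 3))) := by
    rw [v3, v2, w2, v1, w1, z1]
    simp only [det3_eq, Pi.add_apply, Pi.smul_apply, smul_eq_mul]; ring
  rw [e1, e2, e3]
  refine ⟨?_, ?_, ?_⟩ <;> positivity

lemma IsOrbitLift.isConvexLift {S : ℤ → MarkedPolygon n k} {x y : ℤ → ZMod n → ℝ}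
    {a : ℤ → ZMod n → Vec} (hn : 4 ≤ n) (hkn : k ≤ n - 1) (hS : IsOrbit S)
    (h : IsOrbitLift S x y a) {P : ℤ → RP2} (hP : ∀ m, P (m + 1) = (S m).1 1) {j : ℕ} (hj : j ≤ k) :
    IsConvexLift (fun m => a (m - 1 + 2 * j) (1 - j)) (pentagram^[j] P) := by
  refine ⟨fun m => ?_, fun m => ?_⟩
  · rw [hS.iterate_pentagram hn hkn hP hj]
    exact h.vertex _ _
  · have := h.det3_pos hn (1 - j) (m - 1 + 2 * j)
    rwa [show m - 1 + 2 * (j : ℤ) + 1 = m + 1 - 1 + 2 * j by ring,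
      show m - 1 + 2 * (j : ℤ) + 2 = m + 2 - 1 + 2 * j by ring,
      show m - 1 + 2 * (j : ℤ) + 3 = m + 3 - 1 + 2 * j by ring] at this

lemma PolyConvex.edge_nonneg {a : ZMod n → Vec} [NeZero n] (h : PolyConvex a)
    (i l : ZMod n) : 0 ≤ det3 (a i) (a (i + 1)) (a l) := by
  obtain ⟨r, hr, rfl⟩ : ∃ r : ℕ, r < n ∧ l = i + r :=
    ⟨(l - i).val, ZMod.val_lt _, by rw [ZMod.natCast_zmod_val]; ring⟩
  rcases Nat.eq_zero_or_pos r with rfl | h0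
  · simp
  · simpa using h.nonneg i (show 1 ≤ r by lia) hr.le

lemma PolyConvex.edge_pos {a : ZMod n → Vec} [NeZero n] (h : PolyConvex a)
    {i l : ZMod n} (h0 : l ≠ i) (h1 : l ≠ i + 1) : 0 < det3 (a i) (a (i + 1)) (a l) := by
  obtain ⟨r, hr, rfl⟩ : ∃ r : ℕ, r < n ∧ l = i + r :=
    ⟨(l - i).val, ZMod.val_lt _, by rw [ZMod.natCast_zmod_val]; ring⟩
  have : r ≠ 0 := by rintro rfl; simp at h0
  have : r ≠ 1 := by rintro rfl; simp at h1
  simpa using h i 1 r (by lia) (by lia) hr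

/-- The polygons of an orbit are nested. -/
lemma IsOrbitLift.nested {S : ℤ → MarkedPolygon n k} {x y : ℤ → ZMod n → ℝ}
    {a : ℤ → ZMod n → Vec} (h : IsOrbitLift S x y a) {u v : Vec} {m m' : ℤ} (hm : m ≤ m')
    (hpos : ∀ i, 0 ≤ det3 u v (a m i)) (i : ZMod n) : 0 ≤ det3 u v (a m' i) := by
  obtain ⟨r, rfl⟩ := Int.le.dest hm
  clear hm
  induction r generalizing i with
  | zero => simpa using hpos i
  | succ r ih =>
    rw [Nat.cast_succ, ← add_assoc, (h.step _).eq, det3_comb_right]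
    have := ih i
    have := ih (i + 1)
    have := (h.step (m + r)).nonneg i
    have := (h.step (m + r)).pos_right i
    positivity

/-- The half-open edges of the paths through the vertices `1, 0, …, 2 - k` are pairwise disjoint.
Such an edge starts at a vertex of the polygon `m` and runs along its boundary up to the polygon
`m + 1`. Two edges of the same polygon are distinguished by their supporting lines. An edge which
belongs to a later polygon lies in the polygon `m + 1`, and is separated from the first one by a
side of the polygon `m + 1`. -/
lemma IsOrbitLift.edge_ne {S : ℤ → MarkedPolygon n k} {x y : ℤ → ZMod n → ℝ}
    {a : ℤ → ZMod n → Vec} (hn : 4 ≤ n) (hkn : k ≤ n - 1) (h : IsOrbitLift S x y a)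
    {m m' : ℤ} {j j' : ℕ} (hj : j < k) (hj' : j' < k) (hm : m ≤ m') (hne : m = m' → j ≠ j')
    {s t s' t' : ℝ} (hs : 0 < s) (ht : 0 ≤ t) (hs' : 0 < s') (ht' : 0 ≤ t') {z : RP2}
    (hz : Represents (s • a m (1 - j) + t • a (m + 1) (1 - j)) z)
    (hz' : Represents (s' • a m' (1 - j') + t' • a (m' + 1) (1 - j')) z) : False := by
  have : NeZero n := ⟨by lia⟩
  obtain ⟨c, hc, hcz⟩ := hz.exists_smul hz'
  -- a support line of the polygon `m` shows that the two vectors have the same sign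
  have side : ∀ i : ZMod n, 0 < det3 (a m (i + 1)) (a m (i + 2)) (a m i) := by
    intro i
    rw [det3_rotate]
    exact (h.convex m).pos₁₂ hn i
  have same : ∀ i l, 0 ≤ det3 (a m (i + 1)) (a m (i + 2)) (a m l) := by
    intro i l
    rw [show i + 2 = i + 1 + 1 by ring]
    exact (h.convex m).edge_nonneg _ _
  have hc0 : 0 < c := by
    have e := congrArg (det3 (a m (1 - j + 1)) (a m (1 - j + 2))) hcz
    rw [det3_smul_right, det3_comb_right, det3_comb_right] at e
    have p1 := side (1 - j)
    have p2 := h.nested (show m ≤ m + 1 by lia) (same (1 - j)) (1 - j)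
    have p3 := h.nested hm (same (1 - j)) (1 - j')
    have p4 := h.nested (show m ≤ m' + 1 by lia) (same (1 - j)) (1 - j')
    by_contra hneg
    have q1 : 0 < s * det3 (a m (1 - j + 1)) (a m (1 - j + 2)) (a m (1 - j)) +
        t * det3 (a m (1 - j + 1)) (a m (1 - j + 2)) (a (m + 1) (1 - j)) := by positivity
    have q2 := mul_neg_of_neg_of_pos (lt_of_le_of_ne (not_lt.1 hneg) hc) q1
    rw [← e] at q2
    have q3 : 0 ≤ s' * det3 (a m (1 - j + 1)) (a m (1 - j + 2)) (a m' (1 - j')) +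
        t' * det3 (a m (1 - j + 1)) (a m (1 - j + 2)) (a (m' + 1) (1 - j')) := by positivity
    linarith
  rcases hm.eq_or_lt with rfl | hlt
  · -- two edges of the same polygon
    have key : ∀ (i i' : ZMod n) (s t s' t' c : ℝ), 0 < s → 0 ≤ t → 0 < s' → 0 ≤ t' →
        s' • a m i' + t' • a (m + 1) i' = c • (s • a m i + t • a (m + 1) i) → i' ≠ i →
        i' = i + 1 := by
      intro i i' s t s' t' c hs ht hs' ht' e hii
      by_contra h1
      have p1 := (h.convex m).edge_pos hii h1
      have p2 := h.nested (show m ≤ m + 1 by lia) ((h.convex m).edge_nonneg i) i'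
      have e := congrArg (det3 (a m i) (a m (i + 1))) e
      rw [det3_smul_right, det3_comb_right, det3_comb_right, det3_self_outer,
        (h.step m).eq i, det3_comb_right, det3_self_outer, det3_self_right] at e
      have : 0 < s' * det3 (a m i) (a m (i + 1)) (a m i') +
        t' * det3 (a m i) (a m (i + 1)) (a (m + 1) i') := by positivity
      rw [e] at this
      simp at this
    have hii : (1 - j' : ZMod n) ≠ 1 - j := by
      intro e
      have := congrArg ZMod.val (sub_right_injective e)
      rw [ZMod.val_natCast_of_lt (by lia), ZMod.val_natCast_of_lt (by lia)] at this
      exact hne rfl this.symm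
    have e1 := key _ _ _ _ _ _ c hs ht hs' ht' hcz hii
    have e2 := key _ _ _ _ _ _ c⁻¹ hs' ht' hs ht (by
      rw [hcz, smul_smul, inv_mul_cancel₀ hc, one_smul]) hii.symm
    rw [e1] at e2
    have e3 : ((2 : ℕ) : ZMod n) = 0 := by push_cast; linear_combination -e2
    rw [ZMod.natCast_eq_zero_iff] at e3
    exact absurd (Nat.le_of_dvd (by lia) e3) (by lia)
  · -- the edges of the polygon `m` with the indices `2 - k, …, 1` do not meet the next polygon
    obtain ⟨i, hi⟩ : ∃ i : ZMod n, i = -j := ⟨_, rfl⟩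
    have hmi : Marked k i := hi ▸ marked_neg hj hkn
    rw [show (1 - j : ZMod n) = i + 1 by rw [hi]; ring] at *
    have e := congrArg (det3 (a (m + 1) i) (a (m + 1) (i + 1))) hcz
    rw [det3_smul_right, det3_comb_right, det3_comb_right, det3_self_right] at e
    have p3 := h.nested (show m + 1 ≤ m' by lia) ((h.convex (m + 1)).edge_nonneg i) (1 - j')
    have p4 := h.nested (show m + 1 ≤ m' + 1 by lia) ((h.convex (m + 1)).edge_nonneg i) (1 - j')
    have p5 : det3 (a (m + 1) i) (a (m + 1) (i + 1)) (a m (i + 1)) < 0 := by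
      have q : det3 (a (m + 1) i) (a (m + 1) (i + 1)) (a m (i + 1)) = -(x m i * y m (i + 1) *
          det3 (a m i) (a m (i + 1)) (a m (i + 2))) := by
        rw [(h.step m).eq i, (h.step m).eq (i + 1), show i + 1 + 1 = i + 2 by ring]
        simp only [det3_eq, Pi.add_apply, Pi.smul_apply, smul_eq_mul]; ring
      have := (h.step m).pos_left i hmi
      have := (h.step m).pos_right (i + 1)
      have := (h.convex m).pos₁₂ hn i
      rw [q, neg_lt_zero]
      positivity
    have q1 : 0 ≤ s' * det3 (a (m + 1) i) (a (m + 1) (i + 1)) (a m' (1 - j')) +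
        t' * det3 (a (m + 1) i) (a (m + 1) (i + 1)) (a (m' + 1) (1 - j')) := by positivity
    rw [e, mul_zero, add_zero] at q1
    have q2 := mul_neg_of_pos_of_neg hc0 (mul_neg_of_pos_of_neg hs p5)
    linarith

lemma IsOrbit.disjoint_edges (hn : 4 ≤ n) (hkn : k ≤ n - 1) {S : ℤ → MarkedPolygon n k}
    (hS : IsOrbit S) {P : ℤ → RP2} (hP : ∀ m, P (m + 1) = (S m).1 1) {j j' : ℕ} (hj : j < k)
    (hj' : j' < k) {r r' : ℤ} (hne : j = j' → r ≠ r') :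
    Disjoint (halfOpenEdge (pentagram^[j] P) r) (halfOpenEdge (pentagram^[j'] P) r') := by
  obtain ⟨x, y, a, h⟩ := hS.exists_lift hn hkn
  rw [Set.disjoint_left]
  intro z hz hz'
  obtain ⟨s, t, hs, ht, hz⟩ := (h.isConvexLift hn hkn hS hP hj.le).exists_of_mem hz
  obtain ⟨s', t', hs', ht', hz'⟩ := (h.isConvexLift hn hkn hS hP hj'.le).exists_of_mem hz'
  rw [show r + 1 - 1 + 2 * (j : ℤ) = r - 1 + 2 * j + 1 by ring] at hz
  rw [show r' + 1 - 1 + 2 * (j' : ℤ) = r' - 1 + 2 * j' + 1 by ring] at hz'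
  rcases le_total (r - 1 + 2 * (j : ℤ)) (r' - 1 + 2 * j') with hm | hm
  · exact h.edge_ne hn hkn hj hj' hm (by lia) hs ht hs' ht' hz hz'
  · exact h.edge_ne hn hkn hj' hj hm (by lia) hs' ht' hs ht hz' hz

lemma IsOrbit.isPLCSpiral (hn : 4 ≤ n) (hk : 1 ≤ k) (hkn : k ≤ n - 1)
    {S : ℤ → MarkedPolygon n k} (hS : IsOrbit S) {P : ℤ → RP2} (hP : ∀ m, P (m + 1) = (S m).1 1) :
    IsPLCSpiral n k P := by
  obtain ⟨x, y, a, h⟩ := hS.exists_lift hn hkn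
  have hdisj : ∀ i j, i < j → j < k →
      Disjoint (trace (pentagram^[i] P)) (trace (pentagram^[j] P)) := by
    intro i j hij hj
    rw [trace, trace, Set.disjoint_iUnion_left]
    intro r
    rw [Set.disjoint_iUnion_right]
    intro r'
    exact hS.disjoint_edges hn hkn hP (by lia) hj (by lia)
  have hmem : ∀ j, j < k → ∀ r, pentagram^[j] P r ∈ trace (pentagram^[j] P) := by
    intro j hj r
    have hv := h.isConvexLift hn hkn hS hP hj.le
    refine Set.mem_iUnion.2 ⟨r, _, hv, 1, 0, one_pos, le_rfl, ?_⟩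
    rw [one_smul, zero_smul, add_zero]
    exact hv.1 r
  refine ⟨⟨hk, ⟨n + k, Or.inl (hS.iterate_pentagram_self hn hk hkn hP)⟩, ?_⟩,
    ⟨fun j hj => ⟨⟨_, h.isConvexLift hn hkn hS hP hj.le⟩, fun r r' hrr =>
      hS.disjoint_edges hn hkn hP hj hj fun _ => hrr⟩, hdisj⟩, hS.hasType hn hk hkn hP,
    ⟨S 0, S, rfl, hS.1, hS.2, hP⟩⟩
  -- paths which agree up to labels have common vertices, so disjointness makes `k` minimal
  rintro j hj0 hj ⟨c, hc⟩
  obtain ⟨r, hr⟩ : ∃ r, pentagram^[j] P 0 = P r := by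
    rcases hc with hc | hc
    · exact ⟨_, hc 0⟩
    · exact ⟨_, hc 0⟩
  refine Set.disjoint_left.1 (hdisj 0 j hj0 hj) (hmem 0 hk r) ?_
  have := hmem j hj 0
  rwa [hr] at this

end orbits

/-! ### Equivariance under projective transformations -/

section equivariance

open scoped MatrixGroups

lemma det3_mulVec (M : Matrix (Fin 3) (Fin 3) ℝ) (u v w : Vec) :
    det3 (M.mulVec u) (M.mulVec v) (M.mulVec w) = M.det * det3 u v w := by
  rw [det3, det3, ← Matrix.det_transpose (Matrix.of ![u, v, w]), ← Matrix.det_mul,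
    ← Matrix.det_transpose]
  congr 1
  ext i j
  fin_cases j <;> simp [Matrix.mul_apply, Matrix.mulVec, dotProduct]

lemma Represents.smul_mk {v : Vec} {x : RP2} (h : Represents v x) (g : GL (Fin 3) ℝ) :
    Represents (g.1.mulVec v) ((Matrix.ProjGenLinGroup.mk g : PGL3) • x) := by
  obtain ⟨h, rfl⟩ := h
  rw [Projectivization.PGL.mk_smul_mk]
  exact ⟨_, rfl⟩

/-- Every projective transformation is induced by a linear map of positive determinant. -/
lemma exists_linear_smul (g : PGL3) : ∃ (L : Vec →ₗ[ℝ] Vec) (d : ℝ), 0 < d ∧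
    (∀ u v w, det3 (L u) (L v) (L w) = d * det3 u v w) ∧
    ∀ v x, Represents v x → Represents (L v) (g • x) := by
  induction g using Matrix.ProjGenLinGroup.induction_on with | mk g =>
  have hg : g.1.det ≠ 0 := by
    have := g.isUnit
    rw [Matrix.isUnit_iff_isUnit_det] at this
    exact this.ne_zero
  -- in odd dimension, a matrix of negative determinant may be replaced by its negative
  rcases lt_or_gt_of_ne hg with h | h
  · refine ⟨(-g.1).mulVecLin, (-g.1).det, ?_, fun u v w => det3_mulVec _ u v w, fun v x hx => ?_⟩
    · rw [Matrix.det_neg, Fintype.card_fin, show ((-1 : ℝ)) ^ 3 = -1 by norm_num]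
      linarith
    · have := (hx.smul_mk g).smul (c := -1) (by norm_num)
      rwa [neg_one_smul, ← Matrix.neg_mulVec] at this
  · exact ⟨g.1.mulVecLin, g.1.det, h, fun u v w => det3_mulVec _ u v w, fun v x hx => hx.smul_mk g⟩

variable {n k : ℕ} {x y x' y' : ZMod n → ℝ} {a b c : ZMod n → Vec}

lemma newVertex_smul (g : PGL3) (s : MarkedPolygon n k) (i : ZMod n) :
    newVertex (g • s) i = g • newVertex s i := by
  rw [newVertex, newVertex]
  split_ifs <;> rfl

lemma IsStep.map (h : IsStep k x y a b) (L : Vec →ₗ[ℝ] Vec) :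
    IsStep k x y (fun i => L (a i)) (fun i => L (b i)) := by
  refine ⟨h.pos_left, h.eq_zero, h.pos_right, fun i => ?_⟩
  rw [h.eq, map_add, map_smul, map_smul]

lemma IsSeedLift.smul {s : MarkedPolygon n k} (h : IsSeedLift s x y a b) {g : PGL3}
    {L : Vec →ₗ[ℝ] Vec} {d : ℝ} (hd : 0 < d)
    (hL : ∀ u v w, det3 (L u) (L v) (L w) = d * det3 u v w)
    (hg : ∀ v x, Represents v x → Represents (L v) (g • x)) :
    IsSeedLift (g • s) x y (fun i => L (a i)) (fun i => L (b i)) := by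
  refine ⟨fun i p q hp hpq hq => ?_, h.step.map L, fun i => hg _ _ (h.vertex i), fun i => ?_⟩
  · rw [hL]
    exact mul_pos hd (h.convex i p q hp hpq hq)
  · rw [newVertex_smul]
    exact hg _ _ (h.newVertex i)

lemma IsSeed.smul (hn : 4 ≤ n) (hkn : k ≤ n - 1) {s : MarkedPolygon n k} (h : IsSeed s)
    (g : PGL3) : IsSeed (g • s) := by
  obtain ⟨x, y, a, b, h⟩ := h.exists_lift hn
  obtain ⟨L, d, hd, hL, hg⟩ := exists_linear_smul g
  exact (h.smul hd hL hg).isSeed hkn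

lemma seedMap_smul (hn : 4 ≤ n) (hkn : k ≤ n - 1) {s : MarkedPolygon n k} (h : IsSeed s)
    (g : PGL3) : seedMap (g • s) = g • seedMap s := by
  obtain ⟨x, y, a, b, h⟩ := h.exists_lift hn
  obtain ⟨L, d, hd, hL, hg⟩ := exists_linear_smul g
  obtain ⟨x', y', c, hbc, hac⟩ := h.step.exists_next hn hkn h.convex
  have h1 := (h.seedMap hn hkn hbc hac).smul hd hL hg
  have h2 := (h.smul hd hL hg).seedMap hn hkn (hbc.map L) fun i hi => by
    rw [hL, hac i hi, mul_zero]
  exact markedPolygon_ext hkn (fun i => (h2.vertex i).eq (h1.vertex i))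
    fun i => (h2.newVertex i).eq (h1.newVertex i)

lemma Generates.smul (hn : 4 ≤ n) (hkn : k ≤ n - 1) {s : MarkedPolygon n k} {P : ℤ → RP2}
    (h : Generates s P) (g : PGL3) : Generates (g • s) (g • P) := by
  obtain ⟨S, rfl, hS, hm, hP⟩ := h
  refine ⟨fun m => g • S m, rfl, fun m => (hS m).smul hn hkn g, fun m => ?_, fun m => ?_⟩
  · change g • S (m + 1) = _
    rw [hm, seedMap_smul hn hkn (hS m)]
  · rw [Pi.smul_apply, hP]
    rfl

end equivariance

/-! ### Diffeologies -/

section diffeology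

lemma dSmooth_quotient_mk {X : Type*} [DiffeologicalSpace X] (r : Setoid X) :
    DSmooth (fun x : X => (Quotient.mk r x : Quotient r)) :=
  fun _ p hp => DiffeologicalSpace.isPlot_generatedFrom_of_mem ⟨p, hp, rfl⟩

lemma dSmooth_of_quotient {X Y : Type*} [DiffeologicalSpace X] [DiffeologicalSpace Y]
    {r : Setoid X} {f : Quotient r → Y} (h : DSmooth fun x => f (Quotient.mk r x)) :
    DSmooth f := by
  intro m p hp
  -- the diffeology for which exactly the `p` with smooth `f ∘ p` are plots contains the generators
  refine hp (inducedBy fun (_ : Unit) => f) ?_ ()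
  rintro q ⟨p', hp', hq⟩ _
  change IsPlot (f ∘ q.2)
  rw [hq]
  exact h _ _ hp'

lemma isDiffeomorphism_quotientCongr {X Y : Type*} [DiffeologicalSpace X] [DiffeologicalSpace Y]
    {r : Setoid X} {r' : Setoid Y} {e : X ≃ Y} (h : IsDiffeomorphism e)
    (hr : ∀ x x', r x x' ↔ r' (e x) (e x')) : IsDiffeomorphism (Quotient.congr e hr) := by
  constructor
  · exact dSmooth_of_quotient ((dSmooth_quotient_mk r').comp h.1)
  · exact dSmooth_of_quotient ((dSmooth_quotient_mk r).comp h.2)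

lemma IsDiffeomorphism.trans {X Y Z : Type*} [DiffeologicalSpace X] [DiffeologicalSpace Y]
    [DiffeologicalSpace Z] {e : X ≃ Y} {f : Y ≃ Z} (he : IsDiffeomorphism e)
    (hf : IsDiffeomorphism f) : IsDiffeomorphism (e.trans f) :=
  ⟨hf.1.comp he.1, he.2.comp hf.2⟩

lemma IsDiffeomorphism.symm {X Y : Type*} [DiffeologicalSpace X] [DiffeologicalSpace Y]
    {e : X ≃ Y} (he : IsDiffeomorphism e) : IsDiffeomorphism e.symm := ⟨he.2, he.1⟩

variable {n k : ℕ}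

lemma isPlot_seed_iff {m : ℕ} {p : EuclideanSpace ℝ (Fin m) → Seed n k} :
    IsPlot p ↔ (∀ i, IsPlot fun z => (p z).1.1 i) ∧ ∀ j, IsPlot fun z => (p z).1.2 j :=
  ⟨fun h => ⟨fun i => h (Sum.inl i), fun j => h (Sum.inr j)⟩,
    fun h i => Sum.casesOn i h.1 h.2⟩

lemma isPlot_spiral_iff {m : ℕ} {p : EuclideanSpace ℝ (Fin m) → Spiral n k} :
    IsPlot p ↔ ∀ i, IsPlot fun z => (p z).1 i := Iff.rfl

end diffeology

/-! ### The seed map is a diffeomorphism -/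

section smooth

variable {n k : ℕ}

/-- The seed map as a permutation of the set of seeds. -/
def seedEquiv (hn : 4 ≤ n) (hk : 1 ≤ k) (hkn : k ≤ n - 1) : Equiv.Perm (Seed n k) where
  toFun s := ⟨seedMap s.1, isSeed_seedMap hn hkn s.2⟩
  invFun s := ⟨seedMapInv s.1, isSeed_seedMapInv hn hk hkn s.2⟩
  left_inv s := Subtype.ext (seedMapInv_seedMap hn hk hkn s.2)
  right_inv s := Subtype.ext (seedMap_seedMapInv hn hk hkn s.2)

lemma isTransversal_next (hn : 4 ≤ n) (hkn : k ≤ n - 1) (s : Seed n k) {i : ZMod n}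
    (hi : Marked k i) : IsTransversal (s.1.1 (i + 1)) (newVertex (seedMap s.1) (i + 1))
      (newVertex s.1 i) (newVertex s.1 (i + 1)) := by
  obtain ⟨x, y, a, b, h⟩ := s.2.exists_lift hn
  obtain ⟨x', y', c, hbc, hac⟩ := h.step.exists_next hn hkn h.convex
  have h' := h.seedMap hn hkn hbc hac
  exact (h.step.next_meet hn h.convex hbc hac hi (h.vertex _) (h.newVertex _) (h.newVertex _)
    (h'.newVertex _) (h'.newVertex _)).1

lemma isTransversal_prev (hn : 4 ≤ n) (hk : 1 ≤ k) (hkn : k ≤ n - 1) (t : Seed n k) {l : ℕ}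
    (hl : l < k) : IsTransversal (oldVertex t.1 l) (t.1.1 (1 - k + l)) (newVertex t.1 (1 - k + l))
      (newVertex t.1 (1 - k + l + 1)) := by
  obtain ⟨x, y, b, c, h⟩ := t.2.exists_lift hn
  obtain ⟨x', y', a, ha, hab, hac⟩ := h.step.exists_prev hn hk hkn h.convex
  exact (hab.prev_meet hn ha h.step hac (marked_base hkn hl)
    (h.represents_oldVertex hn hk hkn ha hab hac hl.le)
    (represents_mk (ne_zero_left_of_det3 (ha.pos₁₂ hn _).ne')) (h.vertex _) (h.newVertex _)
    (h.newVertex _)).1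

lemma isPlot_newVertex {m : ℕ} {p : EuclideanSpace ℝ (Fin m) → Seed n k} (hp : IsPlot p)
    (i : ZMod n) : IsPlot fun z => newVertex (p z).1 i := by
  rw [isPlot_seed_iff] at hp
  by_cases hi : (-i).val < k
  · simp only [newVertex, dif_pos hi]
    exact hp.2 _
  · simp only [newVertex, dif_neg hi]
    exact hp.1 _

lemma isPlot_newMark (hn : 4 ≤ n) (hkn : k ≤ n - 1) {m : ℕ}
    {p : EuclideanSpace ℝ (Fin m) → Seed n k} (hp : IsPlot p) {j : ℕ} (hj : j ≤ k) :
    IsPlot fun z => newVertex (seedMap (p z).1) (1 - j) := by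
  induction j with
  | zero =>
    simp only [Nat.cast_zero, sub_zero,
      newVertex_seedMap_of_not_marked _ (not_marked_one hn hkn)]
    exact isPlot_newVertex hp _
  | succ j ih =>
    have hi := marked_neg (n := n) (show j < k by lia) hkn
    have ih := ih (by lia)
    rw [show (1 - ((j + 1 : ℕ) : ZMod n)) = -j by push_cast; ring]
    rw [show 1 - (j : ZMod n) = -(j : ZMod n) + 1 by ring] at ih
    simp only [newVertex_seedMap_of_marked hn hkn _ hi]
    exact isPlot_meet ((isPlot_seed_iff.1 hp).1 _) ih (isPlot_newVertex hp _)
      (isPlot_newVertex hp _) fun z => isTransversal_next hn hkn (p z) hi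

lemma isPlot_oldVertex (hn : 4 ≤ n) (hk : 1 ≤ k) (hkn : k ≤ n - 1) {m : ℕ}
    {p : EuclideanSpace ℝ (Fin m) → Seed n k} (hp : IsPlot p) {l : ℕ} (hl : l ≤ k) :
    IsPlot fun z => oldVertex (p z).1 l := by
  induction l with
  | zero => exact (isPlot_seed_iff.1 hp).1 _
  | succ l ih =>
    exact isPlot_meet (ih (by lia)) ((isPlot_seed_iff.1 hp).1 _) (isPlot_newVertex hp _)
      (isPlot_newVertex hp _) fun z => isTransversal_prev hn hk hkn (p z) (by lia)

lemma isDiffeomorphism_seedEquiv (hn : 4 ≤ n) (hk : 1 ≤ k) (hkn : k ≤ n - 1) :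
    IsDiffeomorphism (seedEquiv hn hk hkn) := by
  constructor
  · intro m p hp
    rw [isPlot_seed_iff]
    refine ⟨fun i => isPlot_newVertex hp i, fun j => ?_⟩
    have := isPlot_newMark hn hkn hp (show (j : ℕ) + 1 ≤ k from j.2)
    rw [show (1 - (((j : ℕ) + 1 : ℕ) : ZMod n)) = -(j : ℕ) by push_cast; ring] at this
    simp only [newVertex_neg _ hkn j.2] at this
    exact this
  · intro m p hp
    rw [isPlot_seed_iff]
    refine ⟨fun i => ?_, fun j => (isPlot_seed_iff.1 hp).1 _⟩
    change IsPlot fun z => (seedMapInv (p z).1).1 i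
    by_cases hi : (i - (1 - k)).val ≤ k
    · simp only [seedMapInv, if_pos hi]
      exact isPlot_oldVertex hn hk hkn hp hi
    · simp only [seedMapInv, if_neg hi]
      exact (isPlot_seed_iff.1 hp).1 _

lemma dSmooth_seedEquiv_zpow (hn : 4 ≤ n) (hk : 1 ≤ k) (hkn : k ≤ n - 1) (m : ℤ) :
    DSmooth (seedEquiv hn hk hkn ^ m) := by
  have key : ∀ e : Equiv.Perm (Seed n k), DSmooth e → ∀ r : ℕ, DSmooth (e ^ r) := by
    intro e he r
    induction r with
    | zero => exact dSmooth_id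
    | succ r ih =>
      rw [pow_succ]
      exact ih.comp he
  obtain ⟨h1, h2⟩ := isDiffeomorphism_seedEquiv hn hk hkn
  rcases m.eq_nat_or_neg with ⟨r, rfl | rfl⟩
  · rw [zpow_natCast]
    exact key _ h1 r
  · rw [zpow_neg, zpow_natCast, ← inv_pow]
    exact key _ h2 r

/-! ### The correspondence between seeds and spirals -/

/-- The orbit of a seed under the seed map. -/
def orbit (hn : 4 ≤ n) (hk : 1 ≤ k) (hkn : k ≤ n - 1) (s : Seed n k) (m : ℤ) : Seed n k :=
  (seedEquiv hn hk hkn ^ m) s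

lemma isOrbit_orbit (hn : 4 ≤ n) (hk : 1 ≤ k) (hkn : k ≤ n - 1) (s : Seed n k) :
    IsOrbit fun m => (orbit hn hk hkn s m).1 := by
  refine ⟨fun m => (orbit hn hk hkn s m).2, fun m => ?_⟩
  dsimp only [orbit]
  rw [add_comm, zpow_one_add]
  rfl

/-- The spiral which is generated by a seed. -/
def spiralOf (hn : 4 ≤ n) (hk : 1 ≤ k) (hkn : k ≤ n - 1) (s : Seed n k) : Spiral n k :=
  ⟨fun m => (orbit hn hk hkn s (m - 1)).1.1 1,
    (isOrbit_orbit hn hk hkn s).isPLCSpiral hn hk hkn fun m => by rw [add_sub_cancel_right]⟩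

lemma generates_spiralOf (hn : 4 ≤ n) (hk : 1 ≤ k) (hkn : k ≤ n - 1) (s : Seed n k) :
    Generates s.1 (spiralOf hn hk hkn s).1 :=
  ⟨fun m => (orbit hn hk hkn s m).1, rfl, (isOrbit_orbit hn hk hkn s).1,
    (isOrbit_orbit hn hk hkn s).2, fun m => by simp only [spiralOf]; rw [add_sub_cancel_right]⟩

lemma IsOrbit.eq_of_zero (hn : 4 ≤ n) (hk : 1 ≤ k) (hkn : k ≤ n - 1)
    {S S' : ℤ → MarkedPolygon n k} (hS : IsOrbit S) (hS' : IsOrbit S') (h : S 0 = S' 0) (m : ℤ) :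
    S m = S' m := by
  induction m using Int.induction_on with
  | zero => exact h
  | succ m ih => rw [hS.2, hS'.2, ih]
  | pred m ih =>
    have h1 := hS.2 (-m - 1)
    have h2 := hS'.2 (-m - 1)
    rw [sub_add_cancel] at h1 h2
    rw [← seedMapInv_seedMap hn hk hkn (hS.1 (-m - 1)), ← h1, ih, h2,
      seedMapInv_seedMap hn hk hkn (hS'.1 _)]

lemma Generates.unique_path (hn : 4 ≤ n) (hk : 1 ≤ k) (hkn : k ≤ n - 1) {s : MarkedPolygon n k}
    {P Q : ℤ → RP2} (hP : Generates s P) (hQ : Generates s Q) : P = Q := by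
  obtain ⟨S, hS0, hS, hSm, hP⟩ := hP
  obtain ⟨S', hS0', hS', hSm', hQ⟩ := hQ
  funext m
  have := IsOrbit.eq_of_zero hn hk hkn ⟨hS, hSm⟩ ⟨hS', hSm'⟩ (hS0.trans hS0'.symm) (m - 1)
  rw [← sub_add_cancel m 1, hP, hQ, this]

/-- All vertices of the polygons of an orbit are vertices of the generated path or of its images
under the pentagram map. -/
lemma IsOrbit.vertex_eq (hn : 4 ≤ n) (hk : 1 ≤ k) (hkn : k ≤ n - 1) {S : ℤ → MarkedPolygon n k}
    (hS : IsOrbit S) {P : ℤ → RP2} (hP : ∀ m, P (m + 1) = (S m).1 1) {r : ℕ} (hr : r < n) (m : ℤ) :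
    (S m).1 (1 - k + r) =
      if r ≤ k then pentagram^[k - r] P (m + 1 - 2 * (k - r : ℕ)) else P (m + (r - k : ℕ) + 1) := by
  split_ifs with h
  · rw [hS.iterate_pentagram hn hkn hP (by lia), show m + 1 - 2 * ((k - r : ℕ) : ℤ) - 1
      + 2 * ((k - r : ℕ) : ℤ) = m by ring, Nat.cast_sub h,
      show (1 - (k - r) : ZMod n) = 1 - k + r by ring]
  · rw [hP, hS.vertex_add hk (by lia), Nat.cast_sub (by lia),
      show (1 + (r - k) : ZMod n) = 1 - k + r by ring]

/-- A path determines the seed: its images under the pentagram map consist of the vertices of all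
polygons of the orbit, and the marked points are vertices of the next polygon. -/
lemma Generates.unique_seed (hn : 4 ≤ n) (hk : 1 ≤ k) (hkn : k ≤ n - 1) {s t : MarkedPolygon n k}
    {P : ℤ → RP2} (hs : Generates s P) (ht : Generates t P) : s = t := by
  have : NeZero n := ⟨by lia⟩
  obtain ⟨S, rfl, hS, hSm, hP⟩ := hs
  obtain ⟨S', rfl, hS', hSm', hP'⟩ := ht
  have key : ∀ m i, (S m).1 i = (S' m).1 i := by
    intro m i
    obtain ⟨r, hr, rfl⟩ := exists_base k i
    rw [IsOrbit.vertex_eq hn hk hkn ⟨hS, hSm⟩ hP hr, IsOrbit.vertex_eq hn hk hkn ⟨hS', hSm'⟩ hP' hr]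
  refine markedPolygon_ext hkn (key 0) fun i => ?_
  have := key 1 i
  rwa [show (1 : ℤ) = 0 + 1 by rfl, hSm, hSm'] at this

/-- The correspondence between seeds and spirals. -/
def spiralEquiv (hn : 4 ≤ n) (hk : 1 ≤ k) (hkn : k ≤ n - 1) : Seed n k ≃ Spiral n k :=
  Equiv.ofBijective (spiralOf hn hk hkn) <| by
    constructor
    · intro s t h
      refine Subtype.ext ((generates_spiralOf hn hk hkn s).unique_seed hn hk hkn ?_)
      rw [h]
      exact generates_spiralOf hn hk hkn t
    · intro P
      obtain ⟨s, hs⟩ := P.2.comesFromSeed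
      have hseed : IsSeed s := by
        obtain ⟨S, rfl, hS, -⟩ := hs
        exact hS 0
      exact ⟨⟨s, hseed⟩, Subtype.ext
        ((generates_spiralOf hn hk hkn ⟨s, hseed⟩).unique_path hn hk hkn hs)⟩

lemma generates_iff (hn : 4 ≤ n) (hk : 1 ≤ k) (hkn : k ≤ n - 1) (s : Seed n k) (P : Spiral n k) :
    Generates s.1 P.1 ↔ spiralEquiv hn hk hkn s = P := by
  constructor
  · intro h
    exact Subtype.ext ((generates_spiralOf hn hk hkn s).unique_path hn hk hkn h)
  · rintro rfl
    exact generates_spiralOf hn hk hkn s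

lemma isPlot_iterate_pentagram (hn : 4 ≤ n) (hkn : k ≤ n - 1) {l : ℕ}
    {p : EuclideanSpace ℝ (Fin l) → Spiral n k} (hp : IsPlot p) {j : ℕ} (hj : j ≤ k) (m : ℤ) :
    IsPlot fun z => pentagram^[j] (p z).1 m := by
  induction j generalizing m with
  | zero => exact isPlot_spiral_iff.1 hp m
  | succ j ih =>
    have ih := ih (by lia)
    simp only [Function.iterate_succ_apply']
    refine isPlot_meet (ih _) (ih _) (ih _) (ih _) fun z => ?_
    obtain ⟨s, S, -, hS, hSm, hP⟩ := (p z).2.comesFromSeed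
    have hS : IsOrbit S := ⟨hS, hSm⟩
    have h := (hS.pentagram_vertex hn hkn (m - 1 + 2 * j) (marked_neg (show j < k by lia) hkn)).1
    rw [show -(j : ZMod n) + 1 = 1 - j by ring] at h
    rw [hS.iterate_pentagram hn hkn hP (by lia), hS.iterate_pentagram hn hkn hP (by lia),
      hS.iterate_pentagram hn hkn hP (by lia), hS.iterate_pentagram hn hkn hP (by lia)]
    rwa [show m - 1 - 1 + 2 * (j : ℤ) = m - 1 + 2 * j - 1 by ring,
      show m + 1 - 1 + 2 * (j : ℤ) = m - 1 + 2 * j + 1 by ring,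
      show m + 2 - 1 + 2 * (j : ℤ) = m - 1 + 2 * j + 2 by ring]

/-- In one direction, the vertices of the spiral are obtained from the seed by iterating the seed
map and its inverse; in the other, the points of the seed are obtained from the spiral by iterating
the pentagram map. -/
lemma isDiffeomorphism_spiralEquiv (hn : 4 ≤ n) (hk : 1 ≤ k) (hkn : k ≤ n - 1) :
    IsDiffeomorphism (spiralEquiv hn hk hkn) := by
  have : NeZero n := ⟨by lia⟩
  constructor
  · intro l p hp i
    have := (dSmooth_seedEquiv_zpow hn hk hkn (i - 1)) _ _ hp
    exact (isPlot_seed_iff.1 this).1 1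
  · intro l p hp
    have key : ∀ (m : ℤ) (i : ZMod n), IsPlot fun z =>
        (orbit hn hk hkn ((spiralEquiv hn hk hkn).symm (p z)) m).1.1 i := by
      intro m i
      obtain ⟨r, hr, rfl⟩ := exists_base k i
      have h : ∀ z, ∀ m : ℤ, (p z).1 (m + 1) =
          (orbit hn hk hkn ((spiralEquiv hn hk hkn).symm (p z)) m).1.1 1 := by
        intro z m
        conv_lhs => rw [← (spiralEquiv hn hk hkn).apply_symm_apply (p z)]
        change (orbit hn hk hkn _ (m + 1 - 1)).1.1 1 = _
        rw [add_sub_cancel_right]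
      have e := fun z => (isOrbit_orbit hn hk hkn
        ((spiralEquiv hn hk hkn).symm (p z))).vertex_eq hn hk hkn (h z) hr m
      simp only [e]
      split_ifs with hrk
      · exact isPlot_iterate_pentagram hn hkn hp (by lia) _
      · exact isPlot_spiral_iff.1 hp _
    rw [isPlot_seed_iff]
    refine ⟨key 0, fun j => ?_⟩
    have e : ∀ z, ((spiralEquiv hn hk hkn).symm (p z)).1.2 j =
        (orbit hn hk hkn ((spiralEquiv hn hk hkn).symm (p z)) 1).1.1 (-(j : ℕ)) :=
      fun z => (newVertex_neg _ hkn j.2).symm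
    simp only [Function.comp_apply, e]
    exact key 1 _

end smooth

/-! ### Convex chains -/

section chain

/-- The horizontal position of the `m`-th vertex of a chain whose edges have widths `d`. -/
def abscissa (d : ℕ → ℝ) (m : ℕ) : ℝ := ∑ l ∈ Finset.range m, d l

/-- The steepness of the `m`-th edge; it decreases from `1`, by the factor `1 + t l` at the `l`-th
vertex. -/
def steepness (t : ℕ → ℝ) (m : ℕ) : ℝ := ∏ l ∈ Finset.range m, (1 + t (l + 1))⁻¹

/-- The depth of the `m`-th vertex of a descending chain. -/
def depth (d t : ℕ → ℝ) (m : ℕ) : ℝ := ∑ l ∈ Finset.range m, steepness t l * d l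

/-- The normal form of a convex polygon: the vertices `1` and `2` are the points at infinity of
the coordinate axes, and the remaining vertices form a descending convex chain in the affine
plane. -/
def chainVec (d t : ℕ → ℝ) : ℕ → Vec
  | 0 => 0
  | 1 => ![1, 0, 0]
  | 2 => ![0, 1, 0]
  | m + 3 => ![abscissa d m, -depth d t m, 1]

variable {d t : ℕ → ℝ}

lemma abscissa_succ (m : ℕ) : abscissa d (m + 1) = abscissa d m + d m := Finset.sum_range_succ ..

lemma steepness_succ (m : ℕ) : steepness t (m + 1) = steepness t m * (1 + t (m + 1))⁻¹ :=
  Finset.prod_range_succ ..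

lemma depth_succ (m : ℕ) : depth d t (m + 1) = depth d t m + steepness t m * d m :=
  Finset.sum_range_succ ..

lemma chainVec_det₁₂ (m : ℕ) :
    det3 (chainVec d t 1) (chainVec d t 2) (chainVec d t (m + 3)) = 1 := by
  simp [det3_eq, chainVec]

lemma chainVec_det₁ (i j : ℕ) : det3 (chainVec d t 1) (chainVec d t (i + 3)) (chainVec d t (j + 3))
    = depth d t j - depth d t i := by
  simp [det3_eq, chainVec]; ring

lemma chainVec_det₂ (i j : ℕ) : det3 (chainVec d t 2) (chainVec d t (i + 3)) (chainVec d t (j + 3))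
    = abscissa d j - abscissa d i := by
  simp [det3_eq, chainVec]

lemma chainVec_det (i j l : ℕ) :
    det3 (chainVec d t (i + 3)) (chainVec d t (j + 3)) (chainVec d t (l + 3)) =
      (depth d t j - depth d t i) * (abscissa d l - abscissa d j)
        - (abscissa d j - abscissa d i) * (depth d t l - depth d t j) := by
  simp [det3_eq, chainVec]; ring

lemma abscissa_lt (hd : ∀ m, 0 < d m) {i j : ℕ} (h : i < j) : abscissa d i < abscissa d j :=
  strictMono_nat_of_lt_succ (fun m => by rw [abscissa_succ]; linarith [hd m]) h

lemma steepness_pos (ht : ∀ m, 0 < t m) (m : ℕ) : 0 < steepness t m :=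
  Finset.prod_pos fun l _ => inv_pos.2 (by linarith [ht (l + 1)])

lemma steepness_eq_mul (ht : ∀ m, 0 < t m) (m : ℕ) :
    steepness t m = steepness t (m + 1) * (1 + t (m + 1)) := by
  rw [steepness_succ, mul_assoc, inv_mul_cancel₀ (by linarith [ht (m + 1)]), mul_one]

lemma steepness_succ_lt (ht : ∀ m, 0 < t m) (m : ℕ) : steepness t (m + 1) < steepness t m := by
  have := mul_pos (steepness_pos ht (m + 1)) (ht (m + 1))
  rw [steepness_eq_mul ht m]
  linarith

lemma depth_lt (hd : ∀ m, 0 < d m) (ht : ∀ m, 0 < t m) {i j : ℕ} (h : i < j) :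
    depth d t i < depth d t j :=
  strictMono_nat_of_lt_succ
    (fun m => by rw [depth_succ]; linarith [mul_pos (steepness_pos ht m) (hd m)]) h

lemma mul_abscissa_lt_depth (hd : ∀ m, 0 < d m) (ht : ∀ m, 0 < t m) {i j : ℕ} (h : i < j) :
    steepness t j * (abscissa d j - abscissa d i) < depth d t j - depth d t i := by
  induction j, h using Nat.le_induction with
  | base =>
    have := mul_lt_mul_of_pos_right (steepness_succ_lt ht i) (hd i)
    rw [abscissa_succ, depth_succ]
    linarith
  | succ j h ih =>
    have h1 := mul_lt_mul_of_pos_right (steepness_succ_lt ht j)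
      (sub_pos.2 (abscissa_lt hd (show i < j + 1 by lia)))
    rw [abscissa_succ] at h1 ⊢
    rw [depth_succ]
    linarith

lemma depth_le_mul_abscissa (hd : ∀ m, 0 < d m) (ht : ∀ m, 0 < t m) {j l : ℕ} (h : j ≤ l) :
    depth d t l - depth d t j ≤ steepness t j * (abscissa d l - abscissa d j) := by
  induction l, h using Nat.le_induction with
  | base => simp
  | succ l h ih =>
    have h1 := mul_le_mul_of_nonneg_right
      ((strictAnti_nat_of_succ_lt (steepness_succ_lt ht)).antitone h) (hd l).le
    rw [abscissa_succ, depth_succ]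
    linarith

/-- The chain is strictly monotone, and its slopes are strictly monotone, so it is convex. The first
property accounts for the triples which contain a vertex at infinity. -/
lemma chainVec_pos (hd : ∀ m, 0 < d m) (ht : ∀ m, 0 < t m) {i j l : ℕ} (hi : 1 ≤ i) (hij : i < j)
    (hjl : j < l) : 0 < det3 (chainVec d t i) (chainVec d t j) (chainVec d t l) := by
  obtain ⟨l, rfl⟩ : ∃ l', l = l' + 3 := ⟨l - 3, by lia⟩
  by_cases h1 : i = 1
  · subst h1
    by_cases h2 : j = 2
    · subst h2
      rw [chainVec_det₁₂]; exact one_pos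
    obtain ⟨j, rfl⟩ : ∃ j', j = j' + 3 := ⟨j - 3, by lia⟩
    rw [chainVec_det₁, sub_pos]
    exact depth_lt hd ht (by lia)
  obtain ⟨j, rfl⟩ : ∃ j', j = j' + 3 := ⟨j - 3, by lia⟩
  by_cases h2 : i = 2
  · subst h2
    rw [chainVec_det₂, sub_pos]
    exact abscissa_lt hd (by lia)
  obtain ⟨i, rfl⟩ : ∃ i', i = i' + 3 := ⟨i - 3, by lia⟩
  rw [chainVec_det]
  have h1 := mul_abscissa_lt_depth hd ht (show i < j by lia)
  have h2 := depth_le_mul_abscissa hd ht (show j ≤ l by lia)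
  have h3 := sub_pos.2 (abscissa_lt hd (show i < j by lia))
  have h4 := sub_pos.2 (abscissa_lt hd (show j < l by lia))
  have h5 := mul_lt_mul_of_pos_right h1 h4
  have h6 := mul_le_mul_of_nonneg_left h2 h3.le
  linarith

end chain

/-! ### Projective invariants of seeds -/

section invariants

/-- The ratio of the widths of the edges `m + 3` and `3`, in the affine chart in which the vertices
`1` and `2` are the points at infinity of the coordinate axes. -/
def widthRatio (V : ℕ → Vec) (m : ℕ) : ℝ :=
  (det3 (V 2) (V (m + 3)) (V (m + 4)) * det3 (V 1) (V 2) (V 3) * det3 (V 1) (V 2) (V 4)) /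
    (det3 (V 1) (V 2) (V (m + 3)) * det3 (V 1) (V 2) (V (m + 4)) * det3 (V 2) (V 3) (V 4))

/-- The relative change of the slope at the vertex `m + 3`, in the same chart. -/
def bend (V : ℕ → Vec) (m : ℕ) : ℝ :=
  (det3 (V 1) (V 2) (V (m + 3)) * det3 (V (m + 2)) (V (m + 3)) (V (m + 4))) /
    (det3 (V 2) (V (m + 2)) (V (m + 3)) * det3 (V 1) (V (m + 3)) (V (m + 4)))

/-- A projective invariant which determines the position of the point `B` on the edge `A₀A₁`. -/
def markRatio (a₀ a₁ a₂ a₃ b : Vec) : ℝ :=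
  (det3 a₀ b a₂ * det3 a₁ a₂ a₃) / (det3 b a₁ a₂ * det3 a₀ a₂ a₃)

variable {n k : ℕ}

/-- The index set of the coordinates on the space of projective classes of seeds. -/
abbrev CoordIndex (n k : ℕ) : Type := Fin (n - 4) ⊕ Fin (n - 4) ⊕ Fin k

/-- The coordinates of a seed, in terms of homogeneous coordinates of its points. -/
def coordOf (a : ZMod n → Vec) (b : Fin k → Vec) : CoordIndex n k → ℝ
  | .inl m => widthRatio (fun i => a i) (m + 1)
  | .inr (.inl m) => bend (fun i => a i) (m + 1)
  | .inr (.inr j) => markRatio (a (-(j : ℕ))) (a (-(j : ℕ) + 1)) (a (-(j : ℕ) + 2))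
      (a (-(j : ℕ) + 3)) (b j)

/-- The coordinates of a seed. -/
def coord (s : MarkedPolygon n k) : CoordIndex n k → ℝ :=
  coordOf (fun i => (s.1 i).rep) fun j => (s.2 j).rep

lemma div_eq_div_of_mul {c A B A' B' : ℝ} (hc : c ≠ 0) (hA : A = c * A') (hB : B = c * B') :
    A / B = A' / B' := by
  rw [hA, hB, mul_div_mul_left _ _ hc]

lemma widthRatio_smul (V : ℕ → Vec) {r : ℕ → ℝ} (hr : ∀ i, r i ≠ 0) (m : ℕ) :
    widthRatio (fun i => r i • V i) m = widthRatio V m := by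
  have h1 := hr 1
  have h2 := hr 2
  have h3 := hr 3
  have h4 := hr 4
  have h5 := hr (m + 3)
  have h6 := hr (m + 4)
  refine div_eq_div_of_mul (c := r 1 ^ 2 * r 2 ^ 3 * r 3 * r 4 * r (m + 3) * r (m + 4))
    (by positivity) ?_ ?_ <;>
  simp only [det3_smul_left, det3_smul_mid, det3_smul_right] <;> ring

lemma bend_smul (V : ℕ → Vec) {r : ℕ → ℝ} (hr : ∀ i, r i ≠ 0) (m : ℕ) :
    bend (fun i => r i • V i) m = bend V m := by
  have h1 := hr 1
  have h2 := hr 2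
  have h3 := hr (m + 2)
  have h4 := hr (m + 3)
  have h5 := hr (m + 4)
  refine div_eq_div_of_mul (c := r 1 * r 2 * r (m + 2) * r (m + 3) ^ 2 * r (m + 4))
    (by positivity) ?_ ?_ <;>
  simp only [det3_smul_left, det3_smul_mid, det3_smul_right] <;> ring

lemma markRatio_smul {a₀ a₁ a₂ a₃ b : Vec} {r₀ r₁ r₂ r₃ q : ℝ} (h₀ : r₀ ≠ 0) (h₁ : r₁ ≠ 0)
    (h₂ : r₂ ≠ 0) (h₃ : r₃ ≠ 0) (hq : q ≠ 0) :
    markRatio (r₀ • a₀) (r₁ • a₁) (r₂ • a₂) (r₃ • a₃) (q • b) = markRatio a₀ a₁ a₂ a₃ b := by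
  refine div_eq_div_of_mul (c := r₀ * q * r₁ * r₂ ^ 2 * r₃) (by positivity) ?_ ?_ <;>
  simp only [det3_smul_left, det3_smul_mid, det3_smul_right] <;> ring

lemma coordOf_smul {a : ZMod n → Vec} {b : Fin k → Vec} {r : ZMod n → ℝ} {q : Fin k → ℝ}
    (hr : ∀ i, r i ≠ 0) (hq : ∀ j, q j ≠ 0) :
    coordOf (fun i => r i • a i) (fun j => q j • b j) = coordOf a b := by
  funext i
  rcases i with m | m | j
  · exact widthRatio_smul (fun i => a i) (fun i => hr i) _
  · exact bend_smul (fun i => a i) (fun i => hr i) _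
  · exact markRatio_smul (hr _) (hr _) (hr _) (hr _) (hq _)

lemma coordOf_map {a : ZMod n → Vec} {b : Fin k → Vec} {L : Vec → Vec} {d : ℝ} (hd : 0 < d)
    (hL : ∀ u v w, det3 (L u) (L v) (L w) = d * det3 u v w) :
    coordOf (fun i => L (a i)) (fun j => L (b j)) = coordOf a b := by
  funext i
  rcases i with m | m | j
  · simp only [coordOf, widthRatio, hL]
    exact div_eq_div_of_mul (pow_pos hd 3).ne' (by ring) (by ring)
  · simp only [coordOf, bend, hL]
    exact div_eq_div_of_mul (pow_pos hd 2).ne' (by ring) (by ring)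
  · simp only [coordOf, markRatio, hL]
    exact div_eq_div_of_mul (pow_pos hd 2).ne' (by ring) (by ring)

/-- The coordinates do not depend on the choice of homogeneous coordinates. -/
lemma coord_eq {s : MarkedPolygon n k} {a : ZMod n → Vec} {b : Fin k → Vec}
    (ha : ∀ i, Represents (a i) (s.1 i)) (hb : ∀ j, Represents (b j) (s.2 j)) :
    coord s = coordOf a b := by
  choose r hr hra using fun i => (ha i).exists_smul (represents_rep (s.1 i))
  choose q hq hqb using fun j => (hb j).exists_smul (represents_rep (s.2 j))
  rw [coord, funext hra, funext hqb, coordOf_smul hr hq]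

lemma coord_smul (g : PGL3) (s : MarkedPolygon n k) : coord (g • s) = coord s := by
  obtain ⟨L, d, hd, hL, hg⟩ := exists_linear_smul g
  rw [coord_eq (s := g • s) (fun i => hg _ _ (represents_rep (s.1 i)))
    (fun j => hg _ _ (represents_rep (s.2 j))), coordOf_map hd hL]
  rfl

lemma markRatio_edge (x y : ℝ) (a₀ a₁ a₂ a₃ : Vec) (h : det3 a₀ a₁ a₂ ≠ 0) :
    markRatio a₀ a₁ a₂ a₃ (x • a₀ + y • a₁) = (y * det3 a₁ a₂ a₃) / (x * det3 a₀ a₂ a₃) := by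
  rw [markRatio, det3_comb_mid, det3_comb_left, det3_self_left, det3_self_left, mul_zero, mul_zero,
    zero_add, add_zero]
  exact div_eq_div_of_mul h (by ring) (by ring)

/-- The coordinates of a seed are positive. -/
lemma IsSeedLift.coord_pos (hn : 4 ≤ n) (hkn : k ≤ n - 1) {s : MarkedPolygon n k}
    {x y : ZMod n → ℝ} {a b : ZMod n → Vec} (h : IsSeedLift s x y a b) (i : CoordIndex n k) :
    0 < coord s i := by
  have hb : ∀ j : Fin k, Represents (b (-(j : ℕ))) (s.2 j) := by
    intro j
    rw [← newVertex_neg s hkn j.2]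
    exact h.newVertex _
  rw [coord_eq h.vertex hb]
  have p := h.convex.forall_pos
  rcases i with m | m | j
  · have hm := m.2
    have := p 2 (m + 1 + 3) (m + 1 + 4) (by lia) (by lia) (by lia) (by lia)
    have := p 1 2 3 (by lia) (by lia) (by lia) (by lia)
    have := p 1 2 4 (by lia) (by lia) (by lia) (by lia)
    have := p 1 2 (m + 1 + 3) (by lia) (by lia) (by lia) (by lia)
    have := p 1 2 (m + 1 + 4) (by lia) (by lia) (by lia) (by lia)
    have := p 2 3 4 (by lia) (by lia) (by lia) (by lia)
    simp only [coordOf, widthRatio]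
    positivity
  · have hm := m.2
    have := p 1 2 (m + 1 + 3) (by lia) (by lia) (by lia) (by lia)
    have := p (m + 1 + 2) (m + 1 + 3) (m + 1 + 4) (by lia) (by lia) (by lia) (by lia)
    have := p 2 (m + 1 + 2) (m + 1 + 3) (by lia) (by lia) (by lia) (by lia)
    have := p 1 (m + 1 + 3) (m + 1 + 4) (by lia) (by lia) (by lia) (by lia)
    simp only [coordOf, bend]
    positivity
  · simp only [coordOf]
    rw [h.step.eq, markRatio_edge _ _ _ _ _ _ (h.convex.pos₁₂ hn _).ne']
    have := h.step.pos_left _ (marked_neg (n := n) j.2 hkn)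
    have := h.step.pos_right (-(j : ℕ))
    have := h.convex.pos₁₂₃ hn (-(j : ℕ))
    have := h.convex.pos₂₃ hn (-(j : ℕ))
    positivity

/-- Seeds with the same vertices and the same coordinates are equal. -/
lemma eq_of_coord_eq (hn : 4 ≤ n) (hkn : k ≤ n - 1) {s t : MarkedPolygon n k} (hs : IsSeed s)
    (ht : IsSeed t) (hv : ∀ i, s.1 i = t.1 i) (hc : coord s = coord t) : s = t := by
  obtain ⟨x, y, a, b, h⟩ := hs.exists_lift hn
  obtain ⟨x', y', a', b', h'⟩ := ht.exists_lift hn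
  obtain ⟨r, hr, hra⟩ := h.convex.exists_pos_smul hn h'.convex h.vertex
    fun i => by rw [hv]; exact h'.vertex i
  refine Prod.ext (funext hv) (funext fun j => ?_)
  have hb : ∀ j : Fin k, Represents (b (-(j : ℕ))) (s.2 j) := by
    intro j
    rw [← newVertex_neg s hkn j.2]
    exact h.newVertex _
  have hb' : ∀ j : Fin k, Represents (b' (-(j : ℕ))) (t.2 j) := by
    intro j
    rw [← newVertex_neg t hkn j.2]
    exact h'.newVertex _
  rw [coord_eq h.vertex hb, coord_eq (fun i => by rw [← hv]; exact h.vertex i) hb'] at hc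
  have hc := congrFun hc (.inr (.inr j))
  obtain ⟨i, hi⟩ : ∃ i : ZMod n, i = -(j : ℕ) := ⟨_, rfl⟩
  have hb := hb j
  have hb' := hb' j
  simp only [coordOf] at hc
  have hm : Marked k i := hi ▸ marked_neg j.2 hkn
  rw [← hi] at hb hb' hc
  have p012 := h.convex.pos₁₂ hn i
  have p023 := h.convex.pos₂₃ hn i
  have p123 := h.convex.pos₁₂₃ hn i
  have hx := h.step.pos_left i hm
  have hy := h.step.pos_right i
  have hx' := mul_pos (h'.step.pos_left i hm) (hr i)
  have hy' := mul_pos (h'.step.pos_right i) (hr (i + 1))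
  have e := h'.step.eq i
  rw [hra, hra (i + 1), smul_smul, smul_smul] at e
  obtain ⟨u, hu⟩ : ∃ u, u = x' i * r i := ⟨_, rfl⟩
  obtain ⟨v, hv⟩ : ∃ v, v = y' i * r (i + 1) := ⟨_, rfl⟩
  rw [← hu] at e hx'
  rw [← hv] at e hy'
  rw [h.step.eq, e, markRatio_edge _ _ _ _ _ _ p012.ne', markRatio_edge _ _ _ _ _ _ p012.ne',
    div_eq_div_iff (by positivity) (by positivity)] at hc
  have hxy : y i * u = v * x i := by
    have : (det3 (a (i + 1)) (a (i + 2)) (a (i + 3)) * det3 (a i) (a (i + 2)) (a (i + 3))) *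
      (y i * u) = (det3 (a (i + 1)) (a (i + 2)) (a (i + 3)) *
        det3 (a i) (a (i + 2)) (a (i + 3))) * (v * x i) := by linarith
    exact mul_left_cancel₀ (by positivity) this
  have e' : b' i = (u / x i) • b i := by
    rw [e, h.step.eq, smul_add, smul_smul, smul_smul]
    congr 2 <;> field_simp
    linarith
  rw [e'] at hb'
  exact (hb.smul (by positivity)).eq hb'

end invariants

/-! ### Normal forms of seeds -/

section normalForm

/-- The point with given homogeneous coordinates (with an arbitrary value at `0`). -/
def toPoint (v : Vec) : RP2 :=
  if h : v ≠ 0 then Projectivization.mk ℝ v h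
  else Projectivization.mk ℝ (fun _ => 1) fun h => one_ne_zero (congrFun h 0)

lemma represents_toPoint {v : Vec} (h : v ≠ 0) : Represents v (toPoint v) := by
  rw [toPoint, dif_pos h]
  exact represents_mk h

/-- The positive sequence with logarithms `u` at the indices `1, …, l`, and constant `1`
elsewhere. -/
def expSeq {l : ℕ} (u : Fin l → ℝ) (m : ℕ) : ℝ :=
  if h : 1 ≤ m ∧ m ≤ l then Real.exp (u ⟨m - 1, by lia⟩) else 1

lemma expSeq_pos {l : ℕ} (u : Fin l → ℝ) (m : ℕ) : 0 < expSeq u m := by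
  rw [expSeq]
  split_ifs
  · exact Real.exp_pos _
  · exact one_pos

lemma expSeq_zero {l : ℕ} (u : Fin l → ℝ) : expSeq u 0 = 1 := dif_neg (by lia)

lemma expSeq_succ {l : ℕ} (u : Fin l → ℝ) (m : Fin l) : expSeq u (m + 1) = Real.exp (u m) := by
  rw [expSeq, dif_pos (by lia)]
  rfl

variable {n k : ℕ} (w : CoordIndex n k → ℝ)

/-- The vertices, in homogeneous coordinates, of the normal form of the seeds with logarithmic
coordinates `w`. -/
def normalVec (i : ZMod n) : Vec :=
  chainVec (expSeq fun m => w (.inl m)) (expSeq fun m => w (.inr (.inl m))) ((i - 1).val + 1)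

/-- The weight of the first endpoint in the marked point on an edge of the normal form. -/
def normalLeft (i : ZMod n) : ℝ :=
  if Marked k i then det3 (normalVec w (i + 1)) (normalVec w (i + 2)) (normalVec w (i + 3)) else 0

/-- The weight of the second endpoint in the marked point on an edge of the normal form. -/
def normalRight (i : ZMod n) : ℝ :=
  if h : (-i).val < k then Real.exp (w (.inr (.inr ⟨(-i).val, h⟩))) *
    det3 (normalVec w i) (normalVec w (i + 2)) (normalVec w (i + 3)) else 1

/-- The vertices of the successor of the normal form under the seed map. -/
def normalMark (i : ZMod n) : Vec :=
  normalLeft w i • normalVec w i + normalRight w i • normalVec w (i + 1)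

/-- The normal form of the seeds with logarithmic coordinates `w`. -/
def normalSeed : MarkedPolygon n k :=
  (fun i => toPoint (normalVec w i), fun j => toPoint (normalMark w (-(j : ℕ))))

lemma normalVec_natCast {m : ℕ} (hm : 1 ≤ m) (hmn : m ≤ n) : normalVec w (m : ZMod n) =
    chainVec (expSeq fun m => w (.inl m)) (expSeq fun m => w (.inr (.inl m))) m := by
  have : ((m : ZMod n) - 1).val = m - 1 := by
    rw [show (m : ZMod n) - 1 = ((m - 1 : ℕ) : ZMod n) by rw [Nat.cast_sub hm, Nat.cast_one],
      ZMod.val_natCast_of_lt (by lia)]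
  rw [normalVec, this, Nat.sub_add_cancel hm]

lemma normalVec_convex : PolyConvex (normalVec w) :=
  polyConvex_of_forall fun i j l hi hij hjl hl => by
    rw [normalVec_natCast w hi (by lia), normalVec_natCast w (by lia) (by lia),
      normalVec_natCast w (by lia) hl]
    exact chainVec_pos (expSeq_pos _) (expSeq_pos _) hi hij hjl

lemma normalStep (hn : 4 ≤ n) :
    IsStep k (normalLeft w) (normalRight w) (normalVec w) (normalMark w) := by
  refine ⟨fun i hi => ?_, fun i hi => if_neg hi, fun i => ?_, fun i => rfl⟩
  · rw [normalLeft, if_pos hi]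
    exact (normalVec_convex w).pos₁₂₃ hn i
  · rw [normalRight]
    split_ifs
    · exact mul_pos (Real.exp_pos _) ((normalVec_convex w).pos₂₃ hn i)
    · exact one_pos

lemma normalVec_ne_zero (hn : 4 ≤ n) (i : ZMod n) : normalVec w i ≠ 0 :=
  ne_zero_left_of_det3 ((normalVec_convex w).pos₁₂ hn i).ne'

lemma normalMark_ne_zero (hn : 4 ≤ n) (i : ZMod n) : normalMark w i ≠ 0 :=
  ne_zero_left_of_det3 (((normalStep w hn).polyConvex (normalVec_convex w)).pos₁₂ hn i).ne'

lemma isSeedLift_normalSeed (hn : 4 ≤ n) (hkn : k ≤ n - 1) :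
    IsSeedLift (normalSeed w) (normalLeft w) (normalRight w) (normalVec w) (normalMark w) := by
  have : NeZero n := ⟨by lia⟩
  refine ⟨normalVec_convex w, normalStep w hn,
    fun i => represents_toPoint (normalVec_ne_zero w hn i), fun i => ?_⟩
  by_cases hi : Marked k i
  · obtain ⟨j, hj, rfl⟩ := hi.exists_neg
    rw [newVertex_neg _ hkn hj]
    exact represents_toPoint (normalMark_ne_zero w hn _)
  · rw [newVertex_of_not_marked _ hi, normalMark, normalLeft, normalRight, if_neg hi,
      dif_neg (show ¬ (-i).val < k from hi), zero_smul, one_smul, zero_add]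
    exact represents_toPoint (normalVec_ne_zero w hn _)

lemma widthRatio_chainVec {d t : ℕ → ℝ} (hd : d 0 = 1) (m : ℕ) :
    widthRatio (chainVec d t) m = d m := by
  rw [widthRatio, show chainVec d t 3 = chainVec d t (0 + 3) from rfl,
    show chainVec d t 4 = chainVec d t (1 + 3) from rfl,
    show chainVec d t (m + 4) = chainVec d t (m + 1 + 3) from rfl]
  simp only [chainVec_det₁₂, chainVec_det₂, abscissa_succ]
  simp [abscissa, hd]

lemma bend_chainVec {d t : ℕ → ℝ} (hd : ∀ m, 0 < d m) (ht : ∀ m, 0 < t m) (m : ℕ) :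
    bend (chainVec d t) (m + 1) = t (m + 1) := by
  rw [bend, show chainVec d t (m + 1 + 4) = chainVec d t (m + 2 + 3) from rfl,
    show chainVec d t (m + 1 + 2) = chainVec d t (m + 3) from rfl, chainVec_det₁₂, chainVec_det₂,
    chainVec_det₁, chainVec_det, show m + 2 = m + 1 + 1 from rfl]
  simp only [abscissa_succ, depth_succ]
  rw [steepness_eq_mul ht m]
  have h1 := hd m
  have h2 := hd (m + 1)
  have h3 := steepness_pos ht (m + 1)
  rw [div_eq_iff]
  · ring
  · simp only [add_sub_cancel_left]
    positivity

/-- The coordinates can be prescribed arbitrarily. -/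
lemma coord_normalSeed (hn : 4 ≤ n) (hkn : k ≤ n - 1) (i : CoordIndex n k) :
    coord (normalSeed w) i = Real.exp (w i) := by
  have h := isSeedLift_normalSeed w hn hkn
  rw [coord_eq h.vertex (b := fun j => normalMark w (-(j : ℕ)))
    fun j => represents_toPoint (normalMark_ne_zero w hn _)]
  rcases i with m | m | j
  · have hm := m.2
    have e := widthRatio_chainVec (t := expSeq fun m => w (.inr (.inl m)))
      (expSeq_zero fun m => w (.inl m)) (m + 1)
    rw [expSeq_succ] at e
    rw [← e]
    simp only [coordOf, widthRatio]
    rw [normalVec_natCast w (m := 1) (by lia) (by lia),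
      normalVec_natCast w (m := 2) (by lia) (by lia),
      normalVec_natCast w (m := 3) (by lia) (by lia),
      normalVec_natCast w (m := 4) (by lia) (by lia),
      normalVec_natCast w (m := m + 1 + 3) (by lia) (by lia),
      normalVec_natCast w (m := m + 1 + 4) (by lia) (by lia)]
  · have hm := m.2
    have e := bend_chainVec (expSeq_pos fun m => w (.inl m))
      (expSeq_pos fun m => w (.inr (.inl m))) m
    rw [expSeq_succ] at e
    rw [← e]
    simp only [coordOf, bend]
    rw [normalVec_natCast w (m := 1) (by lia) (by lia),
      normalVec_natCast w (m := 2) (by lia) (by lia),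
      normalVec_natCast w (m := m + 1 + 2) (by lia) (by lia),
      normalVec_natCast w (m := m + 1 + 3) (by lia) (by lia),
      normalVec_natCast w (m := m + 1 + 4) (by lia) (by lia)]
  · obtain ⟨i, hi⟩ : ∃ i : ZMod n, i = -(j : ℕ) := ⟨_, rfl⟩
    have hm : Marked k i := hi ▸ marked_neg j.2 hkn
    have hj : (-i).val = j := by rw [hi, neg_neg, ZMod.val_natCast_of_lt (by lia)]
    have hj' : (⟨(-i).val, hm⟩ : Fin k) = j := Fin.ext hj
    simp only [coordOf]
    rw [← hi, normalMark, markRatio_edge _ _ _ _ _ _ ((normalVec_convex w).pos₁₂ hn i).ne',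
      normalLeft, if_pos hm, normalRight, dif_pos (show (-i).val < k from hm), hj']
    have h1 := (normalVec_convex w).pos₂₃ hn i
    have h2 := (normalVec_convex w).pos₁₂₃ hn i
    field_simp

end normalForm

/-! ### Transformation to normal form -/

section reconstruction

variable {n k : ℕ}

lemma steepness_eq_of_bend {V : ℕ → Vec} {t : ℕ → ℝ} (ht : ∀ m, 0 < t m)
    (hV : ∀ i j l, 1 ≤ i → i < j → j < l → l ≤ n → 0 < det3 (V i) (V j) (V l))
    (htV : ∀ m, m + 5 ≤ n → t (m + 1) = bend V (m + 1)) {m : ℕ} (hm : m + 4 ≤ n) :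
    steepness t m = det3 (V 1) (V (m + 3)) (V (m + 4)) * det3 (V 2) (V 3) (V 4) /
      (det3 (V 2) (V (m + 3)) (V (m + 4)) * det3 (V 1) (V 3) (V 4)) := by
  have p134 := hV 1 3 4 (by lia) (by lia) (by lia) (by lia)
  have p234 := hV 2 3 4 (by lia) (by lia) (by lia) (by lia)
  induction m with
  | zero =>
    simp only [steepness, Finset.range_zero, Finset.prod_empty, zero_add]
    field_simp
  | succ m ih =>
    have ih := ih (by lia)
    have h1 := ht (m + 1)
    have p1 := hV 1 (m + 3) (m + 4) (by lia) (by lia) (by lia) (by lia)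
    have p2 := hV 2 (m + 3) (m + 4) (by lia) (by lia) (by lia) (by lia)
    have p3 := hV 1 (m + 4) (m + 5) (by lia) (by lia) (by lia) (by lia)
    have p4 := hV 2 (m + 4) (m + 5) (by lia) (by lia) (by lia) (by lia)
    have plucker : det3 (V 1) (V (m + 3)) (V (m + 4)) * det3 (V 2) (V (m + 4)) (V (m + 5)) -
        det3 (V 2) (V (m + 3)) (V (m + 4)) * det3 (V 1) (V (m + 4)) (V (m + 5)) =
        det3 (V 1) (V 2) (V (m + 4)) * det3 (V (m + 3)) (V (m + 4)) (V (m + 5)) := by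
      simp only [det3_eq]; ring
    have hb : 1 + t (m + 1) = det3 (V 1) (V (m + 3)) (V (m + 4)) *
        det3 (V 2) (V (m + 4)) (V (m + 5)) / (det3 (V 2) (V (m + 3)) (V (m + 4)) *
        det3 (V 1) (V (m + 4)) (V (m + 5))) := by
      rw [htV m (by lia), bend]
      simp only [show m + 1 + 2 = m + 3 from rfl, show m + 1 + 3 = m + 4 from rfl,
        show m + 1 + 4 = m + 5 from rfl]
      rw [← plucker]
      field_simp
      ring
    rw [steepness_succ, ih, hb]
    simp only [show m + 1 + 3 = m + 4 from rfl, show m + 1 + 4 = m + 5 from rfl]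
    field_simp

lemma abscissa_eq_of_widthRatio {V : ℕ → Vec} {d : ℕ → ℝ}
    (hV : ∀ i j l, 1 ≤ i → i < j → j < l → l ≤ n → 0 < det3 (V i) (V j) (V l)) (hn : 4 ≤ n)
    (hdV : ∀ m, m + 4 ≤ n → d m = widthRatio V m) {m : ℕ} (hm : m + 3 ≤ n) :
    abscissa d m = det3 (V 1) (V 2) (V 4) / det3 (V 2) (V 3) (V 4) *
      (det3 (V 2) (V 3) (V (m + 3)) / det3 (V 1) (V 2) (V (m + 3))) := by
  have p234 := hV 2 3 4 (by lia) (by lia) (by lia) (by lia)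
  induction m with
  | zero => simp [abscissa]
  | succ m ih =>
    have ih := ih (by lia)
    have p1 := hV 1 2 (m + 3) (by lia) (by lia) (by lia) (by lia)
    have p2 := hV 1 2 (m + 4) (by lia) (by lia) (by lia) (by lia)
    have plucker : det3 (V 2) (V 3) (V (m + 4)) * det3 (V 1) (V 2) (V (m + 3)) -
        det3 (V 2) (V 3) (V (m + 3)) * det3 (V 1) (V 2) (V (m + 4)) =
        det3 (V 1) (V 2) (V 3) * det3 (V 2) (V (m + 3)) (V (m + 4)) := by
      simp only [det3_eq]; ring
    rw [abscissa_succ, ih, hdV m (by lia), widthRatio]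
    simp only [show m + 1 + 3 = m + 4 from rfl]
    field_simp
    linear_combination -(det3 (V 1) (V 2) (V 4)) * plucker

lemma depth_eq_of_bend {V : ℕ → Vec} {d t : ℕ → ℝ} (ht : ∀ m, 0 < t m)
    (hV : ∀ i j l, 1 ≤ i → i < j → j < l → l ≤ n → 0 < det3 (V i) (V j) (V l)) (hn : 4 ≤ n)
    (hdV : ∀ m, m + 4 ≤ n → d m = widthRatio V m)
    (htV : ∀ m, m + 5 ≤ n → t (m + 1) = bend V (m + 1)) {m : ℕ} (hm : m + 3 ≤ n) :
    depth d t m = det3 (V 1) (V 2) (V 4) / det3 (V 1) (V 3) (V 4) *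
      (det3 (V 1) (V 3) (V (m + 3)) / det3 (V 1) (V 2) (V (m + 3))) := by
  have p134 := hV 1 3 4 (by lia) (by lia) (by lia) (by lia)
  have p234 := hV 2 3 4 (by lia) (by lia) (by lia) (by lia)
  induction m with
  | zero => simp [depth]
  | succ m ih =>
    have ih := ih (by lia)
    have p1 := hV 1 2 (m + 3) (by lia) (by lia) (by lia) (by lia)
    have p2 := hV 1 2 (m + 4) (by lia) (by lia) (by lia) (by lia)
    have p3 := hV 2 (m + 3) (m + 4) (by lia) (by lia) (by lia) (by lia)
    have plucker : det3 (V 1) (V 3) (V (m + 4)) * det3 (V 1) (V 2) (V (m + 3)) -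
        det3 (V 1) (V 3) (V (m + 3)) * det3 (V 1) (V 2) (V (m + 4)) =
        det3 (V 1) (V 2) (V 3) * det3 (V 1) (V (m + 3)) (V (m + 4)) := by
      simp only [det3_eq]; ring
    rw [depth_succ, ih, steepness_eq_of_bend ht hV htV (by lia), hdV m (by lia), widthRatio]
    simp only [show m + 1 + 3 = m + 4 from rfl]
    field_simp
    linear_combination -(det3 (V 1) (V 2) (V 4)) * plucker

lemma cross_dotProduct (u v w : Vec) : dotProduct (crossProduct u v) w = det3 u v w := by
  simp [det3_eq, cross_apply, dotProduct, Fin.sum_univ_three]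
  ring

/-- A convex polygon can be brought into normal form by a projective transformation. -/
lemma exists_smul_eq_chainVec {V : ℕ → Vec} {d t : ℕ → ℝ} (ht : ∀ m, 0 < t m)
    (hV : ∀ i j l, 1 ≤ i → i < j → j < l → l ≤ n → 0 < det3 (V i) (V j) (V l)) (hn : 4 ≤ n)
    (hdV : ∀ m, m + 4 ≤ n → d m = widthRatio V m)
    (htV : ∀ m, m + 5 ≤ n → t (m + 1) = bend V (m + 1)) :
    ∃ g : GL (Fin 3) ℝ, ∀ m, 1 ≤ m → m ≤ n →
      ∃ r : ℝ, r ≠ 0 ∧ g.1.mulVec (V m) = r • chainVec d t m := by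
  have p123 := hV 1 2 3 (by lia) (by lia) (by lia) (by lia)
  have p124 := hV 1 2 4 (by lia) (by lia) (by lia) (by lia)
  have p134 := hV 1 3 4 (by lia) (by lia) (by lia) (by lia)
  have p234 := hV 2 3 4 (by lia) (by lia) (by lia) (by lia)
  obtain ⟨p, hp⟩ : ∃ p, p = det3 (V 1) (V 2) (V 4) / det3 (V 2) (V 3) (V 4) := ⟨_, rfl⟩
  obtain ⟨q, hq⟩ : ∃ q, q = det3 (V 1) (V 2) (V 4) / det3 (V 1) (V 3) (V 4) := ⟨_, rfl⟩
  have p0 : 0 < p := by rw [hp]; positivity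
  have q0 : 0 < q := by rw [hq]; positivity
  set M : Matrix (Fin 3) (Fin 3) ℝ := Matrix.of ![p • crossProduct (V 2) (V 3),
    (-q) • crossProduct (V 1) (V 3), crossProduct (V 1) (V 2)] with hM
  have hMv : ∀ v, M.mulVec v = ![p * det3 (V 2) (V 3) v, -q * det3 (V 1) (V 3) v,
      det3 (V 1) (V 2) v] := by
    intro v
    ext i
    fin_cases i
    · change dotProduct (p • crossProduct (V 2) (V 3)) v = p * det3 (V 2) (V 3) v
      rw [smul_dotProduct, cross_dotProduct, smul_eq_mul]
    · change dotProduct ((-q) • crossProduct (V 1) (V 3)) v = -q * det3 (V 1) (V 3) v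
      rw [smul_dotProduct, cross_dotProduct, smul_eq_mul]
    · exact cross_dotProduct (V 1) (V 2) v
  have h1 : M.mulVec (V 1) = (p * det3 (V 1) (V 2) (V 3)) • chainVec d t 1 := by
    rw [hMv, det3_self_outer, det3_self_outer, det3_rotate]
    simp [chainVec]
  have h2 : M.mulVec (V 2) = (q * det3 (V 1) (V 2) (V 3)) • chainVec d t 2 := by
    rw [hMv, det3_self_outer, det3_self_right, det3_swap_right]
    simp [chainVec]
  have h3 : ∀ m, m + 3 ≤ n →
      M.mulVec (V (m + 3)) = det3 (V 1) (V 2) (V (m + 3)) • chainVec d t (m + 3) := by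
    intro m hm
    have := hV 1 2 (m + 3) (by lia) (by lia) (by lia) (by lia)
    rw [hMv, chainVec, abscissa_eq_of_widthRatio hV hn hdV hm,
      depth_eq_of_bend ht hV hn hdV htV hm, ← hp, ← hq]
    ext i
    fin_cases i
    · simp; field_simp
    · simp; field_simp
    · simp
  have hdet : M.det ≠ 0 := by
    have := det3_mulVec M (V 1) (V 2) (V 3)
    rw [h1, h2, h3 0 (by lia), det3_smul_left, det3_smul_mid, det3_smul_right,
      chainVec_det₁₂, mul_one] at this
    intro h
    rw [h, zero_mul] at this
    exact absurd this (by positivity)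
  refine ⟨Matrix.GeneralLinearGroup.mkOfDetNeZero M hdet, fun m hm hmn => ?_⟩
  change ∃ r : ℝ, r ≠ 0 ∧ M.mulVec (V m) = r • chainVec d t m
  rcases m with _ | _ | _ | m
  · lia
  · exact ⟨_, by positivity, h1⟩
  · exact ⟨_, by positivity, h2⟩
  · exact ⟨_, (hV 1 2 (m + 3) (by lia) (by lia) (by lia) (by lia)).ne', h3 m hmn⟩

/-- Every seed is projectively equivalent to the normal form with the same coordinates. -/
lemma IsSeed.exists_smul_eq_normalSeed (hn : 4 ≤ n) (hkn : k ≤ n - 1) {s : MarkedPolygon n k}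
    (hs : IsSeed s) : ∃ g : PGL3, g • s = normalSeed fun i => Real.log (coord s i) := by
  have : NeZero n := ⟨by lia⟩
  obtain ⟨x, y, a, b, h⟩ := hs.exists_lift hn
  have hpos := h.coord_pos hn hkn
  have hb : ∀ j : Fin k, Represents (b (-(j : ℕ))) (s.2 j) := by
    intro j
    rw [← newVertex_neg s hkn j.2]
    exact h.newVertex _
  have hc := coord_eq h.vertex hb
  obtain ⟨w, hw⟩ : ∃ w : CoordIndex n k → ℝ, w = fun i => Real.log (coord s i) := ⟨_, rfl⟩
  have hwc : ∀ i, Real.exp (w i) = coord s i := by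
    intro i
    rw [hw]
    exact Real.exp_log (hpos i)
  rw [← hw]
  have hV := h.convex.forall_pos
  obtain ⟨g, hg⟩ := exists_smul_eq_chainVec (V := fun m : ℕ => a m)
    (d := expSeq fun m => w (.inl m)) (t := expSeq fun m => w (.inr (.inl m))) (expSeq_pos _) hV hn
    (by
      rintro (_ | m) hm
      · have p1 := hV 1 2 3 (by lia) (by lia) (by lia) (by lia)
        have p2 := hV 1 2 4 (by lia) (by lia) (by lia) (by lia)
        have p3 := hV 2 3 4 (by lia) (by lia) (by lia) (by lia)
        rw [expSeq_zero, widthRatio, zero_add, zero_add, eq_comm, div_eq_one_iff_eq (by positivity)]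
        ring
      · have := expSeq_succ (fun m => w (.inl m)) ⟨m, by lia⟩
        rw [hwc, hc] at this
        exact this)
    (by
      intro m hm
      have := expSeq_succ (fun m => w (.inr (.inl m))) ⟨m, by lia⟩
      rw [hwc, hc] at this
      exact this)
  refine ⟨Matrix.ProjGenLinGroup.mk g, eq_of_coord_eq hn hkn (hs.smul hn hkn _)
    ((isSeedLift_normalSeed w hn hkn).isSeed hkn) (fun i => ?_) ?_⟩
  · obtain ⟨r, hr, rfl⟩ : ∃ r : ℕ, r < n ∧ i = ((r + 1 : ℕ) : ZMod n) :=
      ⟨(i - 1).val, ZMod.val_lt _, by push_cast; rw [ZMod.natCast_zmod_val]; ring⟩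
    obtain ⟨c, hc, hgc⟩ := hg (r + 1) (by lia) (by lia)
    have h1 := (h.vertex ((r + 1 : ℕ) : ZMod n)).smul_mk g
    have h2 := (isSeedLift_normalSeed w hn hkn).vertex ((r + 1 : ℕ) : ZMod n)
    rw [hgc] at h1
    rw [normalVec_natCast w (by lia) (by lia)] at h2
    exact h1.eq (h2.smul hc)
  · funext i
    rw [coord_smul, coord_normalSeed w hn hkn, hwc]

end reconstruction

/-! ### Smoothness of the coordinates and of the normal form -/

section smoothCoordinates

variable {E : Type*} [NormedAddCommGroup E] [NormedSpace ℝ E]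

lemma contDiff_expSeq {l : ℕ} {u : E → Fin l → ℝ} (hu : ∀ i, ContDiff ℝ ∞ fun z => u z i) (m : ℕ) :
    ContDiff ℝ ∞ fun z => expSeq (u z) m := by
  by_cases h : 1 ≤ m ∧ m ≤ l
  · simp only [expSeq, dif_pos h]
    exact (hu _).exp
  · simp only [expSeq, dif_neg h]
    exact contDiff_const

lemma contDiff_chainVec {d t : E → ℕ → ℝ} (hd : ∀ m, ContDiff ℝ ∞ fun z => d z m)
    (ht : ∀ m, ContDiff ℝ ∞ fun z => t z m) (ht0 : ∀ z m, 0 < t z m) (m : ℕ) :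
    ContDiff ℝ ∞ fun z => chainVec (d z) (t z) m := by
  have hs : ∀ m, ContDiff ℝ ∞ fun z => steepness (t z) m := fun m =>
    contDiff_prod fun l _ => (contDiff_const.add (ht _)).inv fun z =>
      (add_pos one_pos (ht0 z (l + 1))).ne'
  rcases m with _ | _ | _ | m
  · exact contDiff_const
  · exact contDiff_const
  · exact contDiff_const
  · have ha : ContDiff ℝ ∞ fun z => abscissa (d z) m := ContDiff.sum fun l _ => hd l
    have hb : ContDiff ℝ ∞ fun z => depth (d z) (t z) m :=
      ContDiff.sum fun l _ => (hs l).mul (hd l)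
    refine contDiff_pi.2 fun i => ?_
    fin_cases i
    · exact ha
    · exact hb.neg
    · exact contDiff_const

lemma contDiff_det3 {f g h : E → Vec} (hf : ContDiff ℝ ∞ f) (hg : ContDiff ℝ ∞ g)
    (hh : ContDiff ℝ ∞ h) : ContDiff ℝ ∞ fun z => det3 (f z) (g z) (h z) :=
  contDiff_iff_contDiffAt.2 fun _ => contDiffAt_det3 hf.contDiffAt hg.contDiffAt hh.contDiffAt

variable {n k : ℕ} {w : E → CoordIndex n k → ℝ}

lemma contDiff_normalVec (hw : ∀ i, ContDiff ℝ ∞ fun z => w z i) (i : ZMod n) :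
    ContDiff ℝ ∞ fun z => normalVec (w z) i :=
  contDiff_chainVec (fun m => contDiff_expSeq (fun _ => hw _) m)
    (fun m => contDiff_expSeq (fun _ => hw _) m) (fun _ => expSeq_pos _) _

lemma contDiff_normalMark (hw : ∀ i, ContDiff ℝ ∞ fun z => w z i) (i : ZMod n) :
    ContDiff ℝ ∞ fun z => normalMark (w z) i := by
  have hv := contDiff_normalVec hw
  have hl : ContDiff ℝ ∞ fun z => normalLeft (w z) i := by
    unfold normalLeft
    split_ifs
    · exact contDiff_det3 (hv _) (hv _) (hv _)
    · exact contDiff_const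
  have hr : ContDiff ℝ ∞ fun z => normalRight (w z) i := by
    unfold normalRight
    split_ifs
    · exact (hw _).exp.mul (contDiff_det3 (hv _) (hv _) (hv _))
    · exact contDiff_const
  exact (hl.smul (hv i)).add (hr.smul (hv (i + 1)))

lemma isPlot_toPoint {m : ℕ} {f : EuclideanSpace ℝ (Fin m) → Vec} (hf : ContDiff ℝ ∞ f)
    (h : ∀ z, f z ≠ 0) : IsPlot fun z => toPoint (f z) :=
  isPlot_RP2_iff.2 fun _ => ⟨f, hf.contDiffAt,
    Filter.Eventually.of_forall fun z => represents_toPoint (h z)⟩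

/-- Positivity is only used to exclude that a denominator vanishes. -/
lemma contDiffAt_coordOf {a : E → ZMod n → Vec} {b : E → Fin k → Vec} {z : E}
    (ha : ∀ i, ContDiffAt ℝ ∞ (fun y => a y i) z) (hb : ∀ j, ContDiffAt ℝ ∞ (fun y => b y j) z)
    {i : CoordIndex n k} (hi : 0 < coordOf (a z) (b z) i) :
    ContDiffAt ℝ ∞ (fun y => coordOf (a y) (b y) i) z := by
  -- a positive quotient has a nonzero denominator
  have key : ∀ {A B : E → ℝ}, ContDiffAt ℝ ∞ A z → ContDiffAt ℝ ∞ B z → 0 < A z / B z →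
      ContDiffAt ℝ ∞ (fun y => A y / B y) z := by
    intro A B hA hB h
    exact hA.div hB fun h0 => by rw [h0, div_zero] at h; exact h.false
  rcases i with m | m | j
  · exact key
      (((contDiffAt_det3 (ha _) (ha _) (ha _)).mul (contDiffAt_det3 (ha _) (ha _) (ha _))).mul
      (contDiffAt_det3 (ha _) (ha _) (ha _))) (((contDiffAt_det3 (ha _) (ha _) (ha _)).mul
      (contDiffAt_det3 (ha _) (ha _) (ha _))).mul (contDiffAt_det3 (ha _) (ha _) (ha _))) hi
  · exact key ((contDiffAt_det3 (ha _) (ha _) (ha _)).mul (contDiffAt_det3 (ha _) (ha _) (ha _)))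
      ((contDiffAt_det3 (ha _) (ha _) (ha _)).mul (contDiffAt_det3 (ha _) (ha _) (ha _))) hi
  · exact key ((contDiffAt_det3 (ha _) (hb _) (ha _)).mul (contDiffAt_det3 (ha _) (ha _) (ha _)))
      ((contDiffAt_det3 (hb _) (ha _) (ha _)).mul (contDiffAt_det3 (ha _) (ha _) (ha _))) hi

lemma coord_pos (hn : 4 ≤ n) (hkn : k ≤ n - 1) (s : Seed n k) (i : CoordIndex n k) :
    0 < coord s.1 i := by
  obtain ⟨x, y, a, b, h⟩ := s.2.exists_lift hn
  exact h.coord_pos hn hkn i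

lemma contDiff_coord (hn : 4 ≤ n) (hkn : k ≤ n - 1) {m : ℕ}
    {p : EuclideanSpace ℝ (Fin m) → Seed n k} (hp : IsPlot p) (i : CoordIndex n k) :
    ContDiff ℝ ∞ fun z => coord (p z).1 i := by
  have : NeZero n := ⟨by lia⟩
  rw [isPlot_seed_iff] at hp
  rw [contDiff_iff_contDiffAt]
  intro z
  choose a ha ha' using fun i => isPlot_RP2_iff.1 (hp.1 i) z
  choose b hb hb' using fun j => isPlot_RP2_iff.1 (hp.2 j) z
  have e : ∀ᶠ y in 𝓝 z, coord (p y).1 = coordOf (fun i => a i y) fun j => b j y := by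
    filter_upwards [Filter.eventually_all.2 ha', Filter.eventually_all.2 hb'] with y h1 h2
    exact coord_eq h1 h2
  have hpos := coord_pos hn hkn (p z) i
  rw [e.self_of_nhds] at hpos
  exact (contDiffAt_coordOf (a := fun y i => a i y) (b := fun y j => b j y) ha hb
    hpos).congr_of_eventuallyEq (e.mono fun y hy => congrFun hy i)

end smoothCoordinates

/-! ### The space of seeds is a ball -/

section ball

variable {n k : ℕ}

/-- An enumeration of the coordinates of a seed. -/
def coordEquiv (n k : ℕ) : Fin ((2 * n - 8) + k) ≃ CoordIndex n k :=
  Fintype.equivOfCardEq (by simp only [Fintype.card_fin, Fintype.card_sum]; lia)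

/-- The logarithmic coordinates of a seed. -/
def logCoord (s : Seed n k) : EuclideanSpace ℝ (Fin ((2 * n - 8) + k)) :=
  WithLp.toLp 2 fun i => Real.log (coord s.1 (coordEquiv n k i))

/-- The normal form of the seeds with given logarithmic coordinates. -/
def seedOfLogCoord (hn : 4 ≤ n) (hkn : k ≤ n - 1) (v : EuclideanSpace ℝ (Fin ((2 * n - 8) + k))) :
    Seed n k :=
  ⟨normalSeed fun i => v ((coordEquiv n k).symm i), (isSeedLift_normalSeed _ hn hkn).isSeed hkn⟩

lemma dSmooth_logCoord (hn : 4 ≤ n) (hkn : k ≤ n - 1) : DSmooth (logCoord (n := n) (k := k)) := by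
  intro m p hp
  refine ContDiff.isPlot (contDiff_euclidean.2 fun i => ?_)
  exact (contDiff_coord hn hkn hp _).log fun z => (coord_pos hn hkn (p z) _).ne'

lemma dSmooth_seedOfLogCoord (hn : 4 ≤ n) (hkn : k ≤ n - 1) :
    DSmooth (seedOfLogCoord hn hkn) := by
  intro m p hp
  have hw : ∀ i, ContDiff ℝ ∞ fun z => p z ((coordEquiv n k).symm i) :=
    fun i => contDiff_euclidean.1 hp.contDiff _
  exact isPlot_seed_iff.2
    ⟨fun i => isPlot_toPoint (contDiff_normalVec hw i) fun z => normalVec_ne_zero _ hn _,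
      fun j => isPlot_toPoint (contDiff_normalMark hw _) fun z => normalMark_ne_zero _ hn _⟩

/-- The space of projective classes of seeds is a Euclidean space. -/
def seedSpaceEquiv (hn : 4 ≤ n) (hkn : k ≤ n - 1) :
    SeedSpace n k ≃ EuclideanSpace ℝ (Fin ((2 * n - 8) + k)) where
  toFun := Quotient.lift logCoord <| by
    rintro s t ⟨g, hg⟩
    have hg : g • t.1 = s.1 := hg
    rw [logCoord, logCoord, ← hg, coord_smul]
  invFun v := seedClass (seedOfLogCoord hn hkn v)
  left_inv := by
    refine Quotient.ind fun s => Quotient.sound ?_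
    obtain ⟨g, hg⟩ := s.2.exists_smul_eq_normalSeed hn hkn
    refine ⟨g, hg.trans ?_⟩
    simp [seedOfLogCoord, logCoord]
  right_inv v := by
    ext i
    change Real.log (coord (normalSeed _) _) = _
    rw [coord_normalSeed _ hn hkn, Real.log_exp, Equiv.symm_apply_apply]

lemma isDiffeomorphism_seedSpaceEquiv (hn : 4 ≤ n) (hkn : k ≤ n - 1) :
    IsDiffeomorphism (seedSpaceEquiv hn hkn) :=
  ⟨dSmooth_of_quotient (dSmooth_logCoord hn hkn),
    (dSmooth_quotient_mk _).comp (dSmooth_seedOfLogCoord hn hkn)⟩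

lemma isDiffeomorphism_unitBall (N : ℕ) :
    IsDiffeomorphism (Homeomorph.unitBall (E := EuclideanSpace ℝ (Fin N))).toEquiv := by
  constructor
  · intro m p hp _
    exact (Homeomorph.contDiff_unitBall.comp hp.contDiff).isPlot
  · intro m p hp
    have h : ContDiff ℝ ∞ fun z => (p z : EuclideanSpace ℝ (Fin N)) := (hp ()).contDiff
    exact (OpenPartialHomeomorph.contDiffOn_univUnitBall_symm.comp_contDiff h
      fun z => (p z).2).isPlot

/-- The correspondence between seeds and spirals, modulo projective transformations. -/
def classEquiv (hn : 4 ≤ n) (hk : 1 ≤ k) (hkn : k ≤ n - 1) : SpiralSpace n k ≃ SeedSpace n k :=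
  (Quotient.congr (spiralEquiv hn hk hkn) fun s t => by
    constructor
    · rintro ⟨g, hg⟩
      have hg : g • t.1 = s.1 := hg
      have h := ((generates_iff hn hk hkn t _).2 rfl).smul hn hkn g
      rw [hg] at h
      exact ⟨g, h.unique_path hn hk hkn ((generates_iff hn hk hkn s _).2 rfl)⟩
    · rintro ⟨g, hg⟩
      have hg : g • (spiralEquiv hn hk hkn t).1 = (spiralEquiv hn hk hkn s).1 := hg
      have h := ((generates_iff hn hk hkn t _).2 rfl).smul hn hkn g
      rw [hg] at h
      exact ⟨g, h.unique_seed hn hk hkn ((generates_iff hn hk hkn s _).2 rfl)⟩).symm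

lemma isDiffeomorphism_classEquiv (hn : 4 ≤ n) (hk : 1 ≤ k) (hkn : k ≤ n - 1) :
    IsDiffeomorphism (classEquiv hn hk hkn) :=
  (isDiffeomorphism_quotientCongr (isDiffeomorphism_spiralEquiv hn hk hkn) _).symm

lemma classEquiv_eq (hn : 4 ≤ n) (hk : 1 ≤ k) (hkn : k ≤ n - 1) {P : Spiral n k} {s : Seed n k}
    (h : Generates s.1 P.1) : classEquiv hn hk hkn (spiralClass P) = seedClass s := by
  rw [← (generates_iff hn hk hkn s P).1 h]
  exact (classEquiv hn hk hkn).apply_symm_apply (seedClass s)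

/-- The map on projective classes of seeds which is induced by the seed map. -/
def seedClassMap (hn : 4 ≤ n) (hk : 1 ≤ k) (hkn : k ≤ n - 1) : Equiv.Perm (SeedSpace n k) :=
  Quotient.congr (seedEquiv hn hk hkn) fun s t => by
    constructor
    · rintro ⟨g, hg⟩
      refine ⟨g, ?_⟩
      have hg : g • t.1 = s.1 := hg
      change g • seedMap t.1 = seedMap s.1
      rw [← hg, seedMap_smul hn hkn t.2]
    · rintro ⟨g, hg⟩
      refine ⟨g, ?_⟩
      have hg : g • seedMap t.1 = seedMap s.1 := hg
      change g • t.1 = s.1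
      rw [← seedMap_smul hn hkn t.2] at hg
      rw [← seedMapInv_seedMap hn hk hkn s.2, ← hg,
        seedMapInv_seedMap hn hk hkn (t.2.smul hn hkn g)]

lemma isDiffeomorphism_seedClassMap (hn : 4 ≤ n) (hk : 1 ≤ k) (hkn : k ≤ n - 1) :
    IsDiffeomorphism (seedClassMap hn hk hkn) :=
  isDiffeomorphism_quotientCongr (isDiffeomorphism_seedEquiv hn hk hkn) _

lemma Generates.shift {s : MarkedPolygon n k} {P : ℤ → RP2} (h : Generates s P) :
    Generates (seedMap s) (shift P) := by
  obtain ⟨S, rfl, hS, hSm, hP⟩ := h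
  exact ⟨fun m => S (m + 1), by rw [← hSm], fun m => hS _, fun m => hSm _, fun m => hP _⟩

end ball

end PentagramSpiral

end

open PentagramSpiral in
/-- The space `C(n, k)` is diffeomorphic to an open ball of dimension `(2n - 8) + k`. Every seed
generates exactly one labeled PLC pentagram spiral and every such spiral is generated by exactly one
seed. This induces a diffeomorphism `Ψ` from `C(n, k)` to the space of projective classes of seeds,
which turns the shift map into the map `τ` induced by the seed map, and `τ` is a diffeomorphism. -/
theorem theorem1p1 (n k : ℕ) (hn : 4 ≤ n) (hk : 1 ≤ k) (hkn : k ≤ n - 1) :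
    (∃ Φ : SpiralSpace n k ≃ Metric.ball (0 : EuclideanSpace ℝ (Fin ((2 * n - 8) + k))) 1,
      IsDiffeomorphism Φ) ∧
    (∀ s : Seed n k, ∃! P : Spiral n k, Generates s.1 P.1) ∧
    (∀ P : Spiral n k, ∃! s : Seed n k, Generates s.1 P.1) ∧
    ∃ (Ψ : SpiralSpace n k ≃ SeedSpace n k) (τ : SeedSpace n k ≃ SeedSpace n k),
      IsDiffeomorphism Ψ ∧ IsDiffeomorphism τ ∧
      (∀ (P : Spiral n k) (s : Seed n k), Generates s.1 P.1 → Ψ (spiralClass P) = seedClass s) ∧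
      (∀ s : Seed n k, ∃ h : IsSeed (seedMap s.1), τ (seedClass s) = seedClass ⟨seedMap s.1, h⟩) ∧
      ∀ c : SpiralSpace n k, Ψ (shiftMap n k c) = τ (Ψ c) := by
  refine ⟨⟨(classEquiv hn hk hkn).trans ((seedSpaceEquiv hn hkn).trans
      Homeomorph.unitBall.toEquiv), (isDiffeomorphism_classEquiv hn hk hkn).trans
      ((isDiffeomorphism_seedSpaceEquiv hn hkn).trans (isDiffeomorphism_unitBall _))⟩,
    fun s => ?_, fun P => ?_, classEquiv hn hk hkn, seedClassMap hn hk hkn,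
    isDiffeomorphism_classEquiv hn hk hkn, isDiffeomorphism_seedClassMap hn hk hkn,
    fun P s h => classEquiv_eq hn hk hkn h, fun s => ⟨isSeed_seedMap hn hkn s.2, rfl⟩, ?_⟩
  · exact ⟨spiralEquiv hn hk hkn s, (generates_iff hn hk hkn _ _).2 rfl,
      fun P hP => ((generates_iff hn hk hkn _ _).1 hP).symm⟩
  · exact ⟨(spiralEquiv hn hk hkn).symm P,
      (generates_iff hn hk hkn _ _).2 (Equiv.apply_symm_apply _ _),
      fun s hs => by rw [← (generates_iff hn hk hkn _ _).1 hs, Equiv.symm_apply_apply]⟩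
  · refine Quotient.ind fun P => ?_
    obtain ⟨s, rfl⟩ := (spiralEquiv hn hk hkn).surjective P
    have h := (generates_iff hn hk hkn s _).2 rfl
    have e := classEquiv_eq hn hk hkn h
    have e' := classEquiv_eq hn hk hkn (P := ⟨_, (spiralEquiv hn hk hkn s).2.shift⟩)
      (s := seedEquiv hn hk hkn s) h.shift
    exact e'.trans (congrArg (seedClassMap hn hk hkn) e.symm)
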